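/- **Corollary (Frankl–Füredi–Kalai inequalities for $\gamma$-vectors).** A *2-truncated cube* $P^n$ is a simple $n$-dimensional convex polytope obtained, up to combinatorial equivalence, from the cube $[0,1]^n$ by a finite sequence of truncations of faces of codimension 2; here a simple polytope $\tilde P$ is obtained from a simple polytope $P$ by truncation of a face $G$ if the boundary complex $\partial\tilde P^*$ of the dual polytope is the stellar subdivision of $\partial P^*$ along the simplex $\sigma_G$ corresponding to $G$. Let $f_i$ be the number of $i$-dimensional faces of $P$, and put $F(P)(\alpha,t)=\sum_{i=0}^n f_i\,\alpha^i t^{n-i}$ and $H(P)(\alpha,t)=F(P)(\alpha-t,t)$. The $\gamma$-vector $(\gamma_0,\dots,\gamma_{[n/2]})$ of $P$ is the integer vector given by $$H(P)=\sum_{i=0}^{[n/2]}\gamma_i(\alpha t)^i(\alpha+t)^{n-2i}.$$ Write $\binom{m}{k}_r$ for the number of $k$-cliques in the Turán graph $T_{m,r}$ (the complete $r$-partite graph on $m$ vertices with parts as equal as possible). For integers $m\ge 1$ and $r\ge k\ge 1$ there is a unique canonical representation $$m=\binom{n_k}{k}_r+\binom{n_{k-1}}{k-1}_{r-1}+\dots+\binom{n_{k-s}}{k-s}_{r-s}$$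 with $n_{k-i}-\left[\frac{n_{k-i}}{r-i}\right]>n_{k-i-1}$ for $0\le i<s$ and $n_{k-s}\ge k-s>0$. Put $$m^{\langle k\rangle_r}=\binom{n_k}{k+1}_r+\binom{n_{k-1}}{k}_{r-1}+\dots+\binom{n_{k-s}}{k-s+1}_{r-s},\qquad 0^{\langle k\rangle_r}=0.$$ Let $P^n$ be a 2-truncated cube and $r=[n/2]$. Then its $\gamma$-vector exists, and $$\gamma_i\ge 0\quad(0\le i\le r),\qquad \gamma_{k+1}\le\gamma_k^{\langle k\rangle_r}\quad(1\le k<r).$$ In particular, in dimensions $n=4$ and $n=5$ one has $\gamma_1\ge0$, $\gamma_2\ge0$ and $\gamma_2\le\frac{\gamma_1(\gamma_1-1)}{2}$. -/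

import Mathlib

open Finset

noncomputable section

namespace TwoTruncated

/-! ### Simple polytopes and their faces -/

/-- The nonempty faces of a convex polytope `P` in `ℝⁿ`: the sets of points of `P` at which some
linear functional is maximal on `P` (the zero functional gives `P` itself). -/
def IsFace {n : ℕ} (P F : Set (EuclideanSpace ℝ (Fin n))) : Prop :=
  IsExposed ℝ P F ∧ F.Nonempty

/-- The dimension of (the affine hull of) a nonempty set. -/
def faceDim {n : ℕ} (F : Set (EuclideanSpace ℝ (Fin n))) : ℕ :=
  Module.finrank ℝ (vectorSpan ℝ F)

/-- The poset of nonempty faces of `P`, ordered by inclusion. -/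
abbrev Face {n : ℕ} (P : Set (EuclideanSpace ℝ (Fin n))) : Type :=
  {F : Set (EuclideanSpace ℝ (Fin n)) // IsFace P F}

/-- `f_i(P)`, the number of `i`-dimensional faces of `P`. -/
def faceCount {n : ℕ} (P : Set (EuclideanSpace ℝ (Fin n))) (i : ℕ) : ℕ :=
  Set.ncard {F : Set (EuclideanSpace ℝ (Fin n)) | IsFace P F ∧ faceDim F = i}

/-- `P` is an `n`-dimensional simple convex polytope in `ℝⁿ`: the convex hull of a finite set, of
full dimension, each of whose vertices belongs to exactly `n` facets. -/
structure IsSimplePolytope {n : ℕ} (P : Set (EuclideanSpace ℝ (Fin n))) : Prop where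
  exists_finite : ∃ S : Set (EuclideanSpace ℝ (Fin n)), S.Finite ∧ P = convexHull ℝ S
  full_dim : affineSpan ℝ P = ⊤
  simple : ∀ V, IsFace P V → faceDim V = 0 →
    Set.ncard {F : Set (EuclideanSpace ℝ (Fin n)) | IsFace P F ∧ faceDim F + 1 = n ∧ V ⊆ F} = n

/-- The standard cube `[0,1]ⁿ`. -/
def stdCube (n : ℕ) : Set (EuclideanSpace ℝ (Fin n)) :=
  {x | ∀ i, 0 ≤ x i ∧ x i ≤ 1}

/-- Two polytopes have the same combinatorial type if their face posets are isomorphic. -/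
def CombEquiv {n : ℕ} (P Q : Set (EuclideanSpace ℝ (Fin n))) : Prop :=
  Nonempty (Face P ≃o Face Q)

/-! ### The dual simplicial complex and truncations -/

/-- The simplices of `K` together with the empty simplex, ordered by inclusion. -/
abbrev Simplex {V : Type} (K : PreAbstractSimplicialComplex V) : Type :=
  {τ : Finset V // τ = ∅ ∨ τ ∈ K.faces}

/-- An identification of the simplicial complex `K` with the boundary complex `∂P*` of the polytope
dual to `P`. A face `G` of `P` corresponds to a simplex `σ_G` of `∂P*`, with inclusions reversed,
and `P` itself corresponds to the empty simplex. -/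
abbrev DualBoundaryIso {n : ℕ} (P : Set (EuclideanSpace ℝ (Fin n)))
    (K : PreAbstractSimplicialComplex ℕ) : Type :=
  Face P ≃o (Simplex K)ᵒᵈ

/-- The stellar subdivision of `K` along the simplex `σ`, with new vertex `v`: the open star of `σ`
is removed and replaced by the cone with apex `v` over `∂σ ⋆ link σ`. -/
def stellar {V : Type} [DecidableEq V] (K : PreAbstractSimplicialComplex V) (σ : Finset V) (v : V) :
    PreAbstractSimplicialComplex V where
  faces := {τ | (τ ∈ K.faces ∧ ¬ σ ⊆ τ) ∨
    ∃ ρ : Finset V, ¬ σ ⊆ ρ ∧ ρ ∪ σ ∈ K.faces ∧ τ = insert v ρ}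
  isRelLowerSet_faces := by
    rintro τ (⟨h1, h2⟩ | ⟨ρ, h1, h2, rfl⟩)
    · refine ⟨(K.isRelLowerSet_faces h1).1, fun t ht hne => Or.inl ⟨?_, fun h => h2 (h.trans ht)⟩⟩
      exact (K.isRelLowerSet_faces h1).2 ht hne
    · refine ⟨Finset.insert_nonempty v ρ, fun t ht hne => ?_⟩
      by_cases hv : v ∈ t
      · right
        have hs : t.erase v ⊆ ρ := Finset.subset_insert_iff.mp ht
        have hσ : σ.Nonempty := by
          rw [Finset.nonempty_iff_ne_empty]
          rintro rfl
          exact h1 (Finset.empty_subset ρ)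
        refine ⟨t.erase v, fun h => h1 (h.trans hs), ?_, (Finset.insert_erase hv).symm⟩
        exact (K.isRelLowerSet_faces h2).2 (Finset.union_subset_union_left hs)
          (hσ.mono Finset.subset_union_right)
      · left
        have hs : t ⊆ ρ := (Finset.subset_insert_iff_of_notMem hv).mp ht
        exact ⟨(K.isRelLowerSet_faces h2).2 (hs.trans Finset.subset_union_left) hne,
          fun h => h1 (h.trans hs)⟩

/-- `P'` is obtained from `P` by truncation of the face `G`: the complex `∂P'*` is the stellar
subdivision of `∂P*` along `σ_G`, with some new vertex `v`. -/
def IsTruncation {n : ℕ} (P : Set (EuclideanSpace ℝ (Fin n))) (G : Face P)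
    (P' : Set (EuclideanSpace ℝ (Fin n))) : Prop :=
  ∃ (K : PreAbstractSimplicialComplex ℕ) (φ : DualBoundaryIso P K) (v : ℕ),
    (∀ τ ∈ K.faces, v ∉ τ) ∧
      Nonempty (DualBoundaryIso P' (stellar K (OrderDual.ofDual (φ G)).1 v))

/-- The 2-truncated cubes of dimension `n`: the simple polytopes obtained, up to combinatorial
equivalence, from the cube by successive truncations of faces of codimension 2. -/
inductive IsTwoTruncatedCube {n : ℕ} : Set (EuclideanSpace ℝ (Fin n)) → Prop
  | cube (P : Set (EuclideanSpace ℝ (Fin n))) :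
      IsSimplePolytope P → CombEquiv P (stdCube n) → IsTwoTruncatedCube P
  | truncate (P : Set (EuclideanSpace ℝ (Fin n))) (G : Face P)
      (P' : Set (EuclideanSpace ℝ (Fin n))) :
      IsTwoTruncatedCube P → faceDim G.1 + 2 = n → IsSimplePolytope P' → IsTruncation P G P' →
        IsTwoTruncatedCube P'

/-! ### Face polynomials and the γ-vector -/

open MvPolynomial in
/-- `F(P)(α,t) = ∑ f_i α^i t^(n-i)`, where `α = X 0` and `t = X 1`. -/
def fPoly {n : ℕ} (P : Set (EuclideanSpace ℝ (Fin n))) : MvPolynomial (Fin 2) ℤ :=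
  ∑ i ∈ range (n + 1), C (faceCount P i : ℤ) * X 0 ^ i * X 1 ^ (n - i)

open MvPolynomial in
/-- `H(P)(α,t) = F(P)(α - t, t)`. -/
def hPoly {n : ℕ} (P : Set (EuclideanSpace ℝ (Fin n))) : MvPolynomial (Fin 2) ℤ :=
  aeval ![X 0 - X 1, X 1] (fPoly P)

open MvPolynomial in
/-- `γ = (γ_0, …, γ_[n/2])`, extended by zero, satisfies
`H(P) = ∑ γ_i (αt)^i (α+t)^(n-2i)`. Such a `γ` is unique if it exists. -/
def IsGammaVector {n : ℕ} (P : Set (EuclideanSpace ℝ (Fin n))) (γ : ℕ → ℤ) : Prop :=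
  hPoly P = ∑ i ∈ range (n / 2 + 1), C (γ i) * (X 0 * X 1) ^ i * (X 0 + X 1) ^ (n - 2 * i) ∧
    ∀ i, n / 2 < i → γ i = 0

open Classical in
/-- The γ-vector of `P` (zero if `H(P)` has no expansion as above). -/
def gammaVector {n : ℕ} (P : Set (EuclideanSpace ℝ (Fin n))) : ℕ → ℤ :=
  if h : ∃ γ, IsGammaVector P γ then h.choose else 0

/-! ### The numbers in the Frankl–Füredi–Kalai inequalities -/

/-- The number of `k`-cliques in the Turán graph `T_{m,r}`, the complete `r`-partite graph on `m`
vertices with parts as equal as possible. -/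
def turanBinom (m k r : ℕ) : ℕ :=
  ((SimpleGraph.turanGraph m r).cliqueFinset k).card

/-- `m = ∑_{i=0}^{s} turanBinom (N (k-i)) (k-i) (r-i)` is the canonical representation of `m`. Only
the values of `N` at `k-s, …, k` matter. -/
structure IsCanonicalRep (m k r s : ℕ) (N : ℕ → ℕ) : Prop where
  lt : s < k
  gap : ∀ i < s, N (k - i - 1) < N (k - i) - N (k - i) / (r - i)
  last : k - s ≤ N (k - s)
  eq : m = ∑ i ∈ range (s + 1), turanBinom (N (k - i)) (k - i) (r - i)

open Classical in
/-- `m^{⟨k⟩_r}`, obtained from the canonical representation of `m` by raising all clique sizes by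
one. It is `0` for `m = 0` (the empty sum), the only `m` without a canonical representation when
`1 ≤ k ≤ r`. -/
def turanPower (m k r : ℕ) : ℕ :=
  if h : ∃ p : ℕ × (ℕ → ℕ), IsCanonicalRep m k r p.1 p.2 then
    ∑ i ∈ range (h.choose.1 + 1), turanBinom (h.choose.2 (k - i)) (k - i + 1) (r - i)
  else 0

end TwoTruncated

end

/-! The proof shows that the γ-vector of a 2-truncated cube is the clique vector of a finite graph
whose cliques have at most `n / 2` vertices, and then that clique vectors of graphs without `(r +
1)`-cliques satisfy the Frankl–Füredi–Kalai inequalities.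

Realization. The dual of the cube is the cross polytope, with γ-vector `(1, 0, …, 0)`, the clique
vector of the empty graph. Truncating a face of codimension 2 subdivides an edge `e` of the dual
complex, and the γ-polynomial grows by one formal variable times the γ-polynomial of the link of
`e`. If the link of `e` has the clique vector of an induced subgraph, this is exactly the effect of
adding a vertex joined to that subgraph. For the induction to run, all links must be realized
simultaneously by induced subgraphs of one graph, and the complex must stay flag; this is
`IsRealization`, preserved by `IsRealizable.stellar`. A separate geometric argument
(`faceDim_faceOf_add_card`) converts simplex sizes into face dimensions, so that face numbers can be
read off the dual complex.

Clique vectors. Colored sets are modelled as sets of natural numbers with distinct residues modulo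
`r`, the residue being the color. The colored Kruskal–Katona theorem (`shadowBound`) says that
colexicographic initial segments of such sets have the smallest shadows. Its proof takes a
competitor with least total colexicographic value: induction on the number of colors makes it
compressed, and an exchange of its last member against the first missing set shows that it is
initial. The case of pairs is Turán's theorem.

Frohmader's argument (`cliqueBound`) transfers this to graphs: take a vertex whose neighborhood `N`
contains the most cliques of the relevant size, add the vertices outside `N` one at a time, and
replace the clique families met on the way by initial segments with one color fewer. The inequality
of consecutive clique numbers follows because a canonical representation locates a specific set in
the colexicographic order, together with the position of that set without its minimum
(`exists_isWitness`). -/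

namespace TwoTruncated

/-! ### Rainbow sets and the colexicographic order -/

/-- The binary value of a finite set of natural numbers. Comparing binary values is comparing
in the colexicographic order. -/
def colexVal (A : Finset ℕ) : ℕ := ∑ a ∈ A, 2 ^ a

lemma colexVal_injective : Function.Injective colexVal := Finset.geomSum_injective le_rfl

lemma colexVal_lt_two_pow {A : Finset ℕ} {b : ℕ} (h : ∀ a ∈ A, a < b) : colexVal A < 2 ^ b :=
  Nat.geomSum_lt le_rfl h

lemma two_pow_le_colexVal {A : Finset ℕ} {a : ℕ} (h : a ∈ A) : 2 ^ a ≤ colexVal A :=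
  Finset.single_le_sum (f := fun a => 2 ^ a) (fun _ _ => Nat.zero_le _) h

lemma colexVal_insert {A : Finset ℕ} {a : ℕ} (h : a ∉ A) :
    colexVal (insert a A) = 2 ^ a + colexVal A := Finset.sum_insert h

lemma colexVal_erase {A : Finset ℕ} {a : ℕ} (h : a ∈ A) :
    colexVal (A.erase a) + 2 ^ a = colexVal A := Finset.sum_erase_add _ _ h

lemma two_pow_add_le {a b c : ℕ} (ha : a < c) (hb : b < c) :
    2 ^ a + 2 ^ b ≤ 2 ^ c := by
  obtain ⟨c, rfl⟩ : ∃ d, c = d + 1 := ⟨c - 1, by omega⟩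
  have h1 : 2 ^ a ≤ 2 ^ c := Nat.pow_le_pow_right (by norm_num) (by omega)
  have h2 : 2 ^ b ≤ 2 ^ c := Nat.pow_le_pow_right (by norm_num) (by omega)
  rw [pow_succ]; omega

/-- Used to compare double exchanges: one element above both elements on the other side decides the
colexicographic order. -/
lemma two_pow_add_lt {a b c d : ℕ} (ha : a < c) (hb : b < c) :
    2 ^ a + 2 ^ b < 2 ^ c + 2 ^ d := by
  have := two_pow_add_le ha hb
  have : 0 < 2 ^ d := by positivity
  omega

/-- `A` has `K` elements, whose residues modulo `r` lie in `R` and are pairwise distinct. -/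
structure IsRainbow (r : ℕ) (R : Finset ℕ) (K : ℕ) (A : Finset ℕ) : Prop where
  card : #A = K
  mem : ∀ a ∈ A, a % r ∈ R
  inj : ∀ a ∈ A, ∀ b ∈ A, a % r = b % r → a = b

variable {r K : ℕ} {R A B : Finset ℕ} {F J J' : Finset (Finset ℕ)}

lemma IsRainbow.card_image (h : IsRainbow r R K A) : #(A.image (· % r)) = K := by
  rw [Finset.card_image_of_injOn, h.card]
  exact fun a ha b hb => h.inj a ha b hb

lemma IsRainbow.image_subset (h : IsRainbow r R K A) : A.image (· % r) ⊆ R := by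
  intro c hc
  obtain ⟨a, ha, rfl⟩ := Finset.mem_image.1 hc
  exact h.mem a ha

lemma IsRainbow.le_card (h : IsRainbow r R K A) : K ≤ #R := by
  rw [← h.card_image]; exact Finset.card_le_card h.image_subset

lemma IsRainbow.erase (h : IsRainbow r R (K + 1) A) {a : ℕ} (ha : a ∈ A) :
    IsRainbow r (R.erase (a % r)) K (A.erase a) where
  card := by rw [Finset.card_erase_of_mem ha, h.card]; rfl
  mem b hb := by
    have hb' := Finset.mem_erase.1 hb
    exact Finset.mem_erase.2 ⟨fun e => hb'.1 (h.inj _ hb'.2 _ ha e), h.mem _ hb'.2⟩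
  inj b hb c hc := h.inj b (Finset.mem_of_mem_erase hb) c (Finset.mem_of_mem_erase hc)

lemma IsRainbow.mono {R' : Finset ℕ} (h : IsRainbow r R K A) (hR : R ⊆ R') :
    IsRainbow r R' K A := ⟨h.card, fun a ha => hR (h.mem a ha), h.inj⟩

lemma IsRainbow.insert (h : IsRainbow r R K A) {a : ℕ} (ha : a % r ∈ R)
    (ha' : ∀ b ∈ A, b % r ≠ a % r) : IsRainbow r R (K + 1) (insert a A) where
  card := by
    rw [Finset.card_insert_of_notMem (fun h' => ha' a h' rfl), h.card]
  mem b hb := by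
    rcases Finset.mem_insert.1 hb with rfl | hb
    · exact ha
    · exact h.mem b hb
  inj b hb c hc e := by
    rcases Finset.mem_insert.1 hb with hb' | hb' <;> rcases Finset.mem_insert.1 hc with hc' | hc'
    · rw [hb', hc']
    · exact absurd (hb' ▸ e.symm) (ha' c hc')
    · exact absurd (hc' ▸ e) (ha' b hb')
    · exact h.inj b hb' c hc' e

/-- Replacing an element of a rainbow set. -/
lemma IsRainbow.swap (h : IsRainbow r R K A) {x y : ℕ} (hx : x ∈ A) (hy : y % r ∈ R)
    (hy' : ∀ b ∈ A, b ≠ x → b % r ≠ y % r) : IsRainbow r R K (Insert.insert y (A.erase x)) := by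
  obtain ⟨K, rfl⟩ : ∃ k, K = k + 1 := by
    have := Finset.card_pos.2 ⟨x, hx⟩
    rw [h.card] at this
    exact ⟨K - 1, by omega⟩
  refine ((h.erase hx).mono (Finset.erase_subset _ _)).insert hy fun b hb => ?_
  exact hy' b (Finset.mem_of_mem_erase hb) (Finset.ne_of_mem_erase hb)

lemma colexVal_swap {x y : ℕ} (hx : x ∈ A) (hy : y ∉ A) :
    colexVal (insert y (A.erase x)) + 2 ^ x = colexVal A + 2 ^ y := by
  rw [colexVal_insert (fun h => hy (Finset.mem_of_mem_erase h)), ← colexVal_erase hx]; ring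

lemma IsRainbow.not_mem_of_color (h : IsRainbow r R K A) {x y : ℕ} (hx : x ∈ A)
    (hxy : x % r = y % r) (hne : x ≠ y) : y ∉ A := fun hy => hne (h.inj x hx y hy hxy)

/-- `J` is an initial segment of the rainbow `K`-sets in the colexicographic order. -/
structure IsInit (r : ℕ) (R : Finset ℕ) (K : ℕ) (J : Finset (Finset ℕ)) : Prop where
  rainbow : ∀ A ∈ J, IsRainbow r R K A
  down : ∀ A ∈ J, ∀ B, IsRainbow r R K B → colexVal B ≤ colexVal A → B ∈ J

lemma IsInit.subset_or (h : IsInit r R K J) (h' : IsInit r R K J') : J ⊆ J' ∨ J' ⊆ J := by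
  by_contra! hc
  obtain ⟨⟨A, hA, hA'⟩, ⟨B, hB, hB'⟩⟩ :=
    And.imp Finset.not_subset.1 Finset.not_subset.1 hc
  rcases le_total (colexVal A) (colexVal B) with hl | hl
  · exact hA' (h'.down B hB A (h.rainbow A hA) hl)
  · exact hB' (h.down A hA B (h'.rainbow B hB) hl)

lemma IsInit.subset_of_card_le (h : IsInit r R K J) (h' : IsInit r R K J') (hc : #J ≤ #J') :
    J ⊆ J' := by
  rcases h.subset_or h' with hs | hs
  · exact hs
  · exact (Finset.eq_of_subset_of_card_le hs hc).ge

lemma isInit_empty : IsInit r R K ∅ := ⟨by simp, by simp⟩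

/-- While an earlier rainbow set is missing, exchange it for a later member; the sum of the values
drops, so this stops. The alternative at the end says that the sum falls strictly unless nothing was
exchanged, which is what minimality arguments need. -/
lemma exists_isInit_of_family (F : Finset (Finset ℕ)) (hF : ∀ A ∈ F, IsRainbow r R K A) :
    ∃ J, IsInit r R K J ∧ #J = #F ∧
      (J = F ∨ ∑ A ∈ J, colexVal A < ∑ A ∈ F, colexVal A) := by
  induction hs : ∑ A ∈ F, colexVal A using Nat.strong_induction_on generalizing F with
  | _ s ih =>
    by_cases hI : IsInit r R K F
    · exact ⟨F, hI, rfl, Or.inl rfl⟩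
    · obtain ⟨B, hB, A, hA, hAB, hAF⟩ : ∃ B ∈ F, ∃ A, IsRainbow r R K A ∧
          colexVal A ≤ colexVal B ∧ A ∉ F := by
        by_contra! hcon
        exact hI ⟨hF, fun B hB A hA hl => hcon B hB A hA hl⟩
      have hlt : colexVal A < colexVal B := lt_of_le_of_ne hAB fun e =>
        hAF (colexVal_injective e ▸ hB)
      have hAE : A ∉ F.erase B := fun h => hAF (Finset.mem_of_mem_erase h)
      have hsum : ∑ C ∈ insert A (F.erase B), colexVal C < s := by
        rw [Finset.sum_insert hAE]
        have := Finset.sum_erase_add F colexVal hB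
        omega
      obtain ⟨J, hJ, hc, hd⟩ := ih _ hsum (insert A (F.erase B)) (by
        intro C hC
        rcases Finset.mem_insert.1 hC with rfl | hC
        · exact hA
        · exact hF C (Finset.mem_of_mem_erase hC)) rfl
      refine ⟨J, hJ, ?_, Or.inr ?_⟩
      · rw [hc, Finset.card_insert_of_notMem hAE, Finset.card_erase_of_mem hB]
        have := Finset.card_pos.2 ⟨B, hB⟩
        omega
      · rcases hd with rfl | hd <;> omega

/-- If there are at least `K ≥ 1` colors there are initial segments of every size. -/
lemma exists_isInit_card (hr : ∀ c ∈ R, c < r) (hK : K + 1 ≤ #R) (m : ℕ) :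
    ∃ J, IsInit r R (K + 1) J ∧ #J = m := by
  obtain ⟨S, hS, hSc⟩ := Finset.exists_subset_card_eq hK
  have hrb : IsRainbow r R (K + 1) S :=
    ⟨hSc, fun a ha => by rw [Nat.mod_eq_of_lt (hr a (hS ha))]; exact hS ha, fun a ha b hb e => by
      rwa [Nat.mod_eq_of_lt (hr a (hS ha)), Nat.mod_eq_of_lt (hr b (hS hb))] at e⟩
  -- The numbers `c + r * j` all have the color of `c`, so putting them in place of `c` gives
  -- infinitely many rainbow sets, any `m` of which can be pushed down to an initial segment.
  obtain ⟨c, hc⟩ : S.Nonempty := Finset.card_pos.1 (by omega)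
  have hr0 : 0 < r := (Nat.zero_le _).trans_lt (hr c (hS hc))
  have hb : ∀ j, ∀ b ∈ S, b ≠ c → b % r ≠ (c + r * j) % r := fun j b hb hne e => by
    rw [Nat.add_mul_mod_self_left] at e
    exact hne (hrb.inj b hb c hc e)
  have hinj : Function.Injective fun j => insert (c + r * j) (S.erase c) := by
    intro j j' e
    have hm : c + r * j ∈ insert (c + r * j') (S.erase c) := by
      have e' : insert (c + r * j) (S.erase c) = insert (c + r * j') (S.erase c) := e
      rw [← e']; exact Finset.mem_insert_self _ _
    rcases Finset.mem_insert.1 hm with h | h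
    · have : r * j = r * j' := by omega
      exact Nat.eq_of_mul_eq_mul_left hr0 this
    · exact absurd rfl (hb j _ (Finset.mem_of_mem_erase h) (Finset.ne_of_mem_erase h))
  obtain ⟨J, hJ, hc', -⟩ := exists_isInit_of_family (r := r) (R := R) (K := K + 1)
    ((range m).image fun j => insert (c + r * j) (S.erase c)) (by
      intro A hA
      obtain ⟨j, -, rfl⟩ := Finset.mem_image.1 hA
      exact hrb.swap hc (by rw [Nat.add_mul_mod_self_left]; exact hrb.mem c hc) (hb j))
  exact ⟨J, hJ, by rw [hc', Finset.card_image_of_injective _ hinj, card_range]⟩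

/-! ### Shadows of initial segments -/

open scoped FinsetFamily

/-- The colexicographic comparison is decided at the largest element that is not common. -/
lemma exists_max_diff {A B : Finset ℕ} (h : colexVal A < colexVal B) :
    ∃ t ∈ B, t ∉ A ∧ ∀ u, t < u → (u ∈ A ↔ u ∈ B) := by
  obtain ⟨t, ht, hmax⟩ := Finset.exists_max_image (symmDiff A B) id (by
    rw [Finset.nonempty_iff_ne_empty]
    intro e
    rw [← Finset.bot_eq_empty, symmDiff_eq_bot] at e
    exact h.ne (by rw [e]))
  have hu : ∀ u, t < u → (u ∈ A ↔ u ∈ B) := fun u hu => by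
    by_contra hc
    have : u ∈ symmDiff A B := by rw [Finset.mem_symmDiff]; tauto
    exact absurd (hmax u this) (by simpa using hu)
  rcases Finset.mem_symmDiff.1 ht with ⟨h1, h2⟩ | ⟨h1, h2⟩
  · exfalso
    refine absurd h (not_lt.2 ?_)
    unfold colexVal
    rw [← Finset.sum_filter_add_sum_filter_not B (fun u => t < u),
      ← Finset.sum_filter_add_sum_filter_not A (fun u => t < u)]
    have e : B.filter (fun u => t < u) = A.filter (fun u => t < u) := by
      ext u; simp only [Finset.mem_filter]
      constructor <;> rintro ⟨h, h'⟩ <;> exact ⟨by simpa [hu u h'] using h, h'⟩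
    rw [e]
    have h3 : ∑ u ∈ B.filter (fun u => ¬ t < u), 2 ^ u < 2 ^ t := Nat.geomSum_lt le_rfl (by
      intro u hu
      obtain ⟨h4, h5⟩ := Finset.mem_filter.1 hu
      rcases eq_or_ne u t with rfl | h
      · exact absurd h4 h2
      · omega)
    have h4 : 2 ^ t ≤ ∑ u ∈ A.filter (fun u => ¬ t < u), 2 ^ u :=
      Finset.single_le_sum (f := fun a => 2 ^ a) (fun _ _ => Nat.zero_le _) (by simp [h1])
    omega
  · exact ⟨t, h1, h2, hu⟩

lemma colexVal_lt_of_max_diff {A B : Finset ℕ} {t : ℕ} (ht : t ∈ B) (ht' : t ∉ A)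
    (h : ∀ u, t < u → u ∈ A → u ∈ B) : colexVal A < colexVal B := by
  by_contra! hc
  rcases hc.eq_or_lt with he | hlt
  · exact ht' (colexVal_injective he ▸ ht)
  · obtain ⟨s, hs, hs', hsu⟩ := exists_max_diff hlt
    rcases lt_trichotomy s t with hl | rfl | hl
    · exact ht' ((hsu t hl).1 ht)
    · exact ht' hs
    · exact hs' (h s hl hs)

/-- Let `t` be the largest element where `B` and `A.erase a` differ. Adding to `B` an element below
`t` of a free color cannot overtake `A`. If `r ≤ t`, every free color has a representative below
`r`. If `t < r`, elements below `t` are their own residues, and the absence of a free one forces `B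
= A.erase t`, so that `t` itself can be added. -/
lemma IsRainbow.card_insert_le_of_mem_shadow_le (hr : ∀ c ∈ R, c < r)
    {A B : Finset ℕ} (hA : IsRainbow r R (K + 1) A) (hB : IsRainbow r R K B) {a : ℕ} (ha : a ∈ A)
    (hmin : ∀ b ∈ A, a ≤ b) (hle : colexVal B ≤ colexVal (A.erase a)) :
    ∃ y, IsRainbow r R (K + 1) (Insert.insert y B) ∧ y ∉ B ∧
      colexVal (Insert.insert y B) ≤ colexVal A := by
  rcases hle.eq_or_lt with he | hlt
  · have := colexVal_injective he
    subst this
    exact ⟨a, by rwa [Finset.insert_erase ha], Finset.notMem_erase _ _, by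
      rw [Finset.insert_erase ha]⟩
  obtain ⟨t, htA', htB, hu⟩ := exists_max_diff hlt
  have htA := Finset.mem_of_mem_erase htA'
  have hat : a < t := lt_of_le_of_ne (hmin t htA) (Finset.ne_of_mem_erase htA').symm
  -- any admissible element below `t` will do
  have key : ∀ y, y < t → y % r ∈ R → (∀ b ∈ B, b % r ≠ y % r) →
      ∃ y, IsRainbow r R (K + 1) (Insert.insert y B) ∧ y ∉ B ∧
        colexVal (Insert.insert y B) ≤ colexVal A := fun y hyt hyR hyB =>
    ⟨y, hB.insert hyR hyB, fun h => hyB y h rfl, (colexVal_lt_of_max_diff htA (by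
      rw [Finset.mem_insert, not_or]; exact ⟨by omega, htB⟩) (by
      intro u htu hu'
      rcases Finset.mem_insert.1 hu' with rfl | hu'
      · omega
      · exact Finset.mem_of_mem_erase ((hu u htu).1 hu'))).le⟩
  have hfree : ∃ c ∈ R, c ∉ B.image (· % r) := by
    by_contra! hc
    have h1 := Finset.card_le_card (show R ⊆ B.image (· % r) from hc)
    rw [hB.card_image] at h1
    have := hA.le_card
    omega
  by_cases htr : r ≤ t
  · obtain ⟨c, hc, hcB⟩ := hfree
    have hcr := hr c hc
    refine key c (by omega) (by rwa [Nat.mod_eq_of_lt hcr]) fun b hb e => hcB ?_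
    rw [Nat.mod_eq_of_lt hcr] at e
    exact Finset.mem_image.2 ⟨b, hb, e⟩
  · push Not at htr
    by_contra hno
    -- every element below `t` of a color that is not used above `t` belongs to `B`
    have hall : ∀ y < t, y ∈ A → y ∈ B := by
      intro y hyt hyA
      by_contra hyB
      refine hno (key y hyt (hA.mem y hyA) fun b hb e => ?_)
      rcases lt_trichotomy b t with hl | rfl | hl
      · rw [Nat.mod_eq_of_lt (by omega), Nat.mod_eq_of_lt (by omega)] at e
        exact hyB (e ▸ hb)
      · exact htB hb
      · have := Finset.mem_of_mem_erase ((hu b hl).1 hb)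
        have := hA.inj b this y hyA e
        omega
    -- so `B` contains `A \ t`, and has the same size
    have hsub : A.erase t ⊆ B := by
      intro y hy
      obtain ⟨hne, hyA⟩ := Finset.mem_erase.1 hy
      rcases lt_or_gt_of_ne hne with hl | hl
      · exact hall y hl hyA
      · exact (hu y hl).2 (Finset.mem_erase.2 ⟨by omega, hyA⟩)
    have heq := Finset.eq_of_subset_of_card_le hsub (by
      rw [hB.card, Finset.card_erase_of_mem htA, hA.card]; rfl)
    refine hno ⟨t, ?_, htB, ?_⟩ <;> rw [← heq, Finset.insert_erase htA]
    exact hA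

lemma IsInit.mem_shadow (hr : ∀ c ∈ R, c < r) (h : IsInit r R (K + 1) J)
    {A B : Finset ℕ} (hA : A ∈ J) (hB : IsRainbow r R K B) {a : ℕ} (ha : a ∈ A)
    (hmin : ∀ b ∈ A, a ≤ b) (hle : colexVal B ≤ colexVal (A.erase a)) : B ∈ ∂ J := by
  obtain ⟨y, hy, hyB, hl⟩ := (h.rainbow A hA).card_insert_le_of_mem_shadow_le hr hB ha hmin hle
  exact Finset.mem_shadow_iff_insert_mem.2 ⟨y, hyB, h.down A hA _ hy hl⟩

lemma rainbow_shadow (hF : ∀ A ∈ F, IsRainbow r R (K + 1) A) :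
    ∀ A ∈ ∂ F, IsRainbow r R K A := by
  intro A hA
  obtain ⟨B, hB, b, hb, rfl⟩ := Finset.mem_shadow_iff.1 hA
  exact ((hF B hB).erase hb).mono (Finset.erase_subset _ _)

/-- Among the sets obtained from `C` by removing one element, removing the minimum gives the latest
one, so it suffices to stay before that set. -/
lemma IsInit.shadow (hr : ∀ c ∈ R, c < r) (h : IsInit r R (K + 1) J) : IsInit r R K (∂ J) := by
  refine ⟨rainbow_shadow h.rainbow, fun A hA B hB hl => ?_⟩
  obtain ⟨C, hC, c, hc, rfl⟩ := Finset.mem_shadow_iff.1 hA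
  obtain ⟨a, ha, hmin⟩ := Finset.exists_min_image C id ⟨c, hc⟩
  refine h.mem_shadow hr hC hB ha hmin (hl.trans ?_)
  have h1 := colexVal_erase hc
  have h2 := colexVal_erase ha
  have : 2 ^ a ≤ 2 ^ c := Nat.pow_le_pow_right (by norm_num) (hmin c hc)
  omega

/-! ### Families assembled from their sections at a color -/

/-- The sets of `J₀`, together with the sets of `J w` enlarged by the vertex `g w`. -/
def assemble {α : Type*} (J₀ : Finset (Finset ℕ)) (W : Finset α) (g : α → ℕ)
    (J : α → Finset (Finset ℕ)) : Finset (Finset ℕ) :=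
  J₀ ∪ W.biUnion fun w => (J w).image (insert (g w))

/-- No set of the family uses the color `i`. -/
def AvoidsColor (r i : ℕ) (F : Finset (Finset ℕ)) : Prop := ∀ A ∈ F, ∀ a ∈ A, a % r ≠ i

section Assemble

variable {α : Type*} {J₀ : Finset (Finset ℕ)} {W : Finset α} {g : α → ℕ}
  {J : α → Finset (Finset ℕ)} {r i K : ℕ} {R : Finset ℕ}

lemma mem_assemble {A : Finset ℕ} : A ∈ assemble J₀ W g J ↔
    A ∈ J₀ ∨ ∃ w ∈ W, ∃ C ∈ J w, insert (g w) C = A := by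
  simp [assemble]

lemma AvoidsColor.shadow {F : Finset (Finset ℕ)} (h : AvoidsColor r i F) :
    AvoidsColor r i (∂ F) := by
  intro A hA a ha
  obtain ⟨B, hB, b, hb, rfl⟩ := Finset.mem_shadow_iff.1 hA
  exact h B hB a (Finset.mem_of_mem_erase ha)

lemma avoidsColor_of_erase {F : Finset (Finset ℕ)}
    (h : ∀ A ∈ F, IsRainbow r (R.erase i) K A) : AvoidsColor r i F :=
  fun A hA a ha => Finset.ne_of_mem_erase ((h A hA).mem a ha)

/-- The pieces are disjoint because a set of the family has at most one vertex of color `i`, and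
this vertex determines its piece. -/
lemma sum_assemble (h0 : AvoidsColor r i J₀) (hJ : ∀ w ∈ W, AvoidsColor r i (J w))
    (hg : Set.InjOn g W) (hgi : ∀ w ∈ W, g w % r = i) (f : Finset ℕ → ℕ) :
    ∑ A ∈ assemble J₀ W g J, f A =
      ∑ A ∈ J₀, f A + ∑ w ∈ W, ∑ A ∈ J w, f (insert (g w) A) := by
  have hnot : ∀ w ∈ W, ∀ v ∈ W, ∀ C ∈ J w, g v ∉ C := fun w hw v hv C hC h =>
    hJ w hw C hC _ h (hgi v hv)
  rw [assemble, Finset.sum_union, Finset.sum_biUnion]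
  · congr 1
    refine Finset.sum_congr rfl fun w hw => Finset.sum_image fun A hA B hB e => ?_
    have := congrArg (fun S => Finset.erase S (g w)) e
    simpa [Finset.erase_insert (hnot w hw w hw A hA),
      Finset.erase_insert (hnot w hw w hw B hB)] using this
  · intro w hw v hv hne
    rw [Function.onFun, Finset.disjoint_left]
    intro A hA hB
    obtain ⟨C, hC, rfl⟩ := Finset.mem_image.1 hA
    obtain ⟨D, hD, e⟩ := Finset.mem_image.1 hB
    have : g v ∈ insert (g w) C := e ▸ Finset.mem_insert_self _ _
    rcases Finset.mem_insert.1 this with h | h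
    · exact hne (hg hw hv h.symm)
    · exact hnot w hw v hv C hC h
  · rw [Finset.disjoint_left]
    intro A hA hB
    obtain ⟨w, hw, hB⟩ := Finset.mem_biUnion.1 hB
    obtain ⟨C, hC, rfl⟩ := Finset.mem_image.1 hB
    exact h0 _ hA _ (Finset.mem_insert_self _ _) (hgi w hw)

lemma card_assemble (h0 : AvoidsColor r i J₀) (hJ : ∀ w ∈ W, AvoidsColor r i (J w))
    (hg : Set.InjOn g W) (hgi : ∀ w ∈ W, g w % r = i) :
    #(assemble J₀ W g J) = #J₀ + ∑ w ∈ W, #(J w) := by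
  simpa only [Finset.sum_const, smul_eq_mul, mul_one] using sum_assemble h0 hJ hg hgi fun _ => 1

lemma sum_colexVal_assemble (h0 : AvoidsColor r i J₀) (hJ : ∀ w ∈ W, AvoidsColor r i (J w))
    (hg : Set.InjOn g W) (hgi : ∀ w ∈ W, g w % r = i) :
    ∑ A ∈ assemble J₀ W g J, colexVal A =
      ∑ A ∈ J₀, colexVal A + ∑ w ∈ W, (#(J w) * 2 ^ g w + ∑ A ∈ J w, colexVal A) := by
  rw [sum_assemble h0 hJ hg hgi]
  congr 1
  refine Finset.sum_congr rfl fun w hw => ?_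
  rw [← smul_eq_mul, ← Finset.sum_const, ← Finset.sum_add_distrib]
  refine Finset.sum_congr rfl fun A hA => colexVal_insert fun h => hJ w hw A hA _ h (hgi w hw)

/-- Removing the vertex of color `i` returns a member of `J w`; removing any other vertex takes a
shadow inside the piece. -/
lemma shadow_assemble (hJ : ∀ w ∈ W, AvoidsColor r i (J w)) (hgi : ∀ w ∈ W, g w % r = i) :
    ∂ (assemble J₀ W g J) =
      assemble (∂ J₀ ∪ W.biUnion J) W g fun w => ∂ (J w) := by
  have hnot : ∀ w ∈ W, ∀ C ∈ J w, g w ∉ C := fun w hw C hC h => hJ w hw C hC _ h (hgi w hw)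
  ext A
  rw [mem_assemble, Finset.mem_shadow_iff]
  constructor
  · rintro ⟨B, hB, b, hb, rfl⟩
    rcases mem_assemble.1 hB with hB | ⟨w, hw, C, hC, rfl⟩
    · exact Or.inl (Finset.mem_union_left _ (Finset.erase_mem_shadow hB hb))
    · by_cases hbw : b = g w
      · subst hbw
        rw [Finset.erase_insert (hnot w hw C hC)]
        exact Or.inl (Finset.mem_union_right _ (Finset.mem_biUnion.2 ⟨w, hw, hC⟩))
      · have hbC : b ∈ C := (Finset.mem_insert.1 hb).resolve_left hbw
        exact Or.inr ⟨w, hw, C.erase b, Finset.erase_mem_shadow hC hbC,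
          (Finset.erase_insert_of_ne (Ne.symm hbw)).symm⟩
  · rintro (h | ⟨w, hw, C, hC, rfl⟩)
    · rcases Finset.mem_union.1 h with h | h
      · obtain ⟨B, hB, b, hb, rfl⟩ := Finset.mem_shadow_iff.1 h
        exact ⟨B, mem_assemble.2 (Or.inl hB), b, hb, rfl⟩
      · obtain ⟨w, hw, hA⟩ := Finset.mem_biUnion.1 h
        exact ⟨insert (g w) A, mem_assemble.2 (Or.inr ⟨w, hw, A, hA, rfl⟩), g w,
          Finset.mem_insert_self _ _, Finset.erase_insert (hnot w hw A hA)⟩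
    · obtain ⟨B, hB, b, hb, rfl⟩ := Finset.mem_shadow_iff.1 hC
      exact ⟨insert (g w) B, mem_assemble.2 (Or.inr ⟨w, hw, B, hB, rfl⟩), b,
        Finset.mem_insert_of_mem hb,
        Finset.erase_insert_of_ne fun e => hnot w hw B hB (e ▸ hb)⟩

lemma card_shadow_assemble (h0 : AvoidsColor r i J₀) (hJ : ∀ w ∈ W, AvoidsColor r i (J w))
    (hg : Set.InjOn g W) (hgi : ∀ w ∈ W, g w % r = i) :
    #(∂ (assemble J₀ W g J)) = #(∂ J₀ ∪ W.biUnion J) + ∑ w ∈ W, #(∂ (J w)) := by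
  rw [shadow_assemble hJ hgi, card_assemble (r := r) (i := i) _ (fun w hw => (hJ w hw).shadow) hg hgi]
  intro A hA
  rcases Finset.mem_union.1 hA with hA | hA
  · exact h0.shadow A hA
  · obtain ⟨w, hw, hA⟩ := Finset.mem_biUnion.1 hA
    exact hJ w hw A hA

lemma rainbow_assemble (hi : i ∈ R) (h0 : ∀ A ∈ J₀, IsRainbow r (R.erase i) (K + 1) A)
    (hJ : ∀ w ∈ W, ∀ A ∈ J w, IsRainbow r (R.erase i) K A) (hgi : ∀ w ∈ W, g w % r = i) :
    ∀ A ∈ assemble J₀ W g J, IsRainbow r R (K + 1) A := by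
  intro A hA
  rcases mem_assemble.1 hA with hA | ⟨w, hw, C, hC, rfl⟩
  · exact (h0 A hA).mono (Finset.erase_subset _ _)
  · refine ((hJ w hw C hC).mono (Finset.erase_subset _ _)).insert (hgi w hw ▸ hi) fun b hb => ?_
    rw [hgi w hw]
    exact Finset.ne_of_mem_erase ((hJ w hw C hC).mem b hb)

/-- Initial segments are nested, so their union is the largest of them. -/
lemma card_union_biUnion_le {J' : Finset (Finset ℕ)} {M : ℕ} (hJ' : IsInit r R K J')
    (hJ : ∀ w ∈ W, IsInit r R K (J w)) (hc' : #J' ≤ M) (hc : ∀ w ∈ W, #(J w) ≤ M) :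
    #(J' ∪ W.biUnion J) ≤ M := by
  classical
  suffices h : ∀ s ⊆ W, ∃ J'', IsInit r R K J'' ∧ J' ∪ s.biUnion J ⊆ J'' ∧ #J'' ≤ M by
    obtain ⟨J'', -, h4, h5⟩ := h _ subset_rfl
    exact (Finset.card_le_card h4).trans h5
  intro s
  induction s using Finset.induction_on with
  | empty => exact fun _ => ⟨J', hJ', by simp, hc'⟩
  | insert w s hws ih =>
    intro hs
    obtain ⟨J'', h1, h2, h3⟩ := ih ((Finset.subset_insert _ _).trans hs)
    have hw := hs (Finset.mem_insert_self _ _)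
    rw [Finset.biUnion_insert, Finset.union_left_comm]
    rcases h1.subset_or (hJ w hw) with h | h
    · exact ⟨J w, hJ w hw, Finset.union_subset subset_rfl (h2.trans h), hc w hw⟩
    · exact ⟨J'', h1, Finset.union_subset h h2, h3⟩

end Assemble

/-! ### Compression: replacing the sections at a color by initial segments -/

section Sections

variable {r i K : ℕ} {R : Finset ℕ} {F : Finset (Finset ℕ)}

/-- The sets of `F` that do not use the color `i`. -/
def section₀ (r i : ℕ) (F : Finset (Finset ℕ)) : Finset (Finset ℕ) :=
  F.filter fun A => ∀ a ∈ A, a % r ≠ i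

/-- The link of the vertex `w` in `F`. -/
def sectionAt (F : Finset (Finset ℕ)) (w : ℕ) : Finset (Finset ℕ) :=
  (F.filter fun A => w ∈ A).image fun A => A.erase w

lemma mem_sectionAt {w : ℕ} {C : Finset ℕ} :
    C ∈ sectionAt F w ↔ w ∉ C ∧ insert w C ∈ F := by
  simp only [sectionAt, Finset.mem_image, Finset.mem_filter]
  constructor
  · rintro ⟨A, ⟨hA, hw⟩, rfl⟩
    exact ⟨Finset.notMem_erase _ _, by rwa [Finset.insert_erase hw]⟩
  · rintro ⟨h1, h2⟩
    exact ⟨_, ⟨h2, Finset.mem_insert_self _ _⟩, Finset.erase_insert h1⟩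

/-- The vertices of color `i` used by `F`. -/
def colorClass (r i : ℕ) (F : Finset (Finset ℕ)) : Finset ℕ :=
  (F.biUnion id).filter fun a => a % r = i

lemma assemble_sections (r i : ℕ) (F : Finset (Finset ℕ)) :
    assemble (section₀ r i F) (colorClass r i F) id (sectionAt F) = F := by
  ext A
  rw [mem_assemble]
  constructor
  · rintro (h | ⟨w, hw, C, hC, rfl⟩)
    · exact (Finset.mem_filter.1 h).1
    · exact (mem_sectionAt.1 hC).2
  · intro hA
    by_cases h : ∀ a ∈ A, a % r ≠ i
    · exact Or.inl (Finset.mem_filter.2 ⟨hA, h⟩)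
    · push Not at h
      obtain ⟨w, hw, hwi⟩ := h
      exact Or.inr ⟨w, Finset.mem_filter.2 ⟨Finset.mem_biUnion.2 ⟨A, hA, hw⟩, hwi⟩, A.erase w,
        mem_sectionAt.2 ⟨Finset.notMem_erase _ _, by rwa [Finset.insert_erase hw]⟩,
        Finset.insert_erase hw⟩

lemma rainbow_section₀ (hF : ∀ A ∈ F, IsRainbow r R K A) :
    ∀ A ∈ section₀ r i F, IsRainbow r (R.erase i) K A := fun A hA =>
  have h := Finset.mem_filter.1 hA
  ⟨(hF A h.1).card, fun a ha => Finset.mem_erase.2 ⟨h.2 a ha, (hF A h.1).mem a ha⟩, (hF A h.1).inj⟩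

lemma rainbow_sectionAt (hF : ∀ A ∈ F, IsRainbow r R (K + 1) A) {w : ℕ} (hw : w % r = i) :
    ∀ A ∈ sectionAt F w, IsRainbow r (R.erase i) K A := fun A hA => by
  have h := mem_sectionAt.1 hA
  have := (hF _ h.2).erase (Finset.mem_insert_self w A)
  rwa [hw, Finset.erase_insert h.1] at this

/-- The shadow inequality for families of rainbow `K`-sets: initial segments have the smallest
shadows. -/
def ShadowBound (r : ℕ) (R : Finset ℕ) (K : ℕ) : Prop :=
  ∀ F : Finset (Finset ℕ), (∀ A ∈ F, IsRainbow r R K A) → ∀ J, IsInit r R K J → #J ≤ #F →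
    #(∂ J) ≤ #(∂ F)

/-- A family is compressed if its sections at all colors are initial segments. -/
def IsCompressed (r : ℕ) (R : Finset ℕ) (K : ℕ) (F : Finset (Finset ℕ)) : Prop :=
  ∀ B ∈ F, ∀ A, IsRainbow r R K A → colexVal A < colexVal B →
    ((∃ a ∈ A, a ∈ B) ∨ ∃ i ∈ R, (∀ a ∈ A, a % r ≠ i) ∧ ∀ b ∈ B, b % r ≠ i) → A ∈ F

/-- A family that minimizes the sum of its colexicographic values, subject to a bound on its
shadow, has initial segments as sections. -/
lemma sections_isInit (hr : ∀ c ∈ R, c < r) (hi : i ∈ R)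
    (h1 : ShadowBound r (R.erase i) (K + 2)) (h2 : ShadowBound r (R.erase i) (K + 1))
    (hF : ∀ A ∈ F, IsRainbow r R (K + 2) A)
    (hmin : ∀ F', (∀ A ∈ F', IsRainbow r R (K + 2) A) → #F' = #F → #(∂ F') ≤ #(∂ F) →
      ∑ A ∈ F, colexVal A ≤ ∑ A ∈ F', colexVal A) :
    IsInit r (R.erase i) (K + 2) (section₀ r i F) ∧
      ∀ w ∈ colorClass r i F, IsInit r (R.erase i) (K + 1) (sectionAt F w) := by
  have hr' : ∀ c ∈ R.erase i, c < r := fun c hc => hr c (Finset.mem_of_mem_erase hc)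
  have hW : ∀ w ∈ colorClass r i F, w % r = i := fun w hw => (Finset.mem_filter.1 hw).2
  have hF0 := rainbow_section₀ (i := i) hF
  have hFw := fun w hw => rainbow_sectionAt hF (hW w hw)
  obtain ⟨J₀, hJ₀, hc₀, hs₀⟩ := exists_isInit_of_family _ hF0
  have hex : ∀ w, ∃ J, w ∈ colorClass r i F → IsInit r (R.erase i) (K + 1) J ∧
      #J = #(sectionAt F w) ∧ (J = sectionAt F w ∨
        ∑ A ∈ J, colexVal A < ∑ A ∈ sectionAt F w, colexVal A) := fun w => by
    by_cases hw : w ∈ colorClass r i F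
    · obtain ⟨J, hJ⟩ := exists_isInit_of_family _ (hFw w hw)
      exact ⟨J, fun _ => hJ⟩
    · exact ⟨∅, fun h => absurd h hw⟩
  choose J hJ using hex
  have a0 := avoidsColor_of_erase hF0
  have aw := fun w hw => avoidsColor_of_erase (hFw w hw)
  have b0 := avoidsColor_of_erase hJ₀.rainbow
  have bw := fun w hw => avoidsColor_of_erase (hJ w hw).1.rainbow
  have hid : Set.InjOn id (colorClass r i F : Set ℕ) := Set.injOn_id _
  set F' := assemble J₀ (colorClass r i F) id J with hF'
  have hcard : #F' = #F := by
    conv_rhs => rw [← assemble_sections r i F]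
    rw [hF', card_assemble b0 bw hid hW, card_assemble a0 aw hid hW, hc₀]
    congr 1
    exact Finset.sum_congr rfl fun w hw => (hJ w hw).2.1
  have hsh : #(∂ F') ≤ #(∂ F) := by
    conv_rhs => rw [← assemble_sections r i F]
    rw [hF', card_shadow_assemble b0 bw hid hW, card_shadow_assemble a0 aw hid hW]
    -- The links are handled by the bound for `K + 1`. The part of the shadow without color `i` is
    -- now a union of nested initial segments, hence no larger than the largest, and each of them is
    -- bounded by the old union.
    refine Nat.add_le_add ?_ (Finset.sum_le_sum fun w hw =>
      h2 _ (hFw w hw) _ (hJ w hw).1 (hJ w hw).2.1.le)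
    refine card_union_biUnion_le (hJ₀.shadow hr') (fun w hw => (hJ w hw).1)
      ((h1 _ hF0 _ hJ₀ hc₀.le).trans (Finset.card_le_card Finset.subset_union_left))
      fun w hw => ?_
    rw [(hJ w hw).2.1]
    exact Finset.card_le_card ((Finset.subset_biUnion_of_mem _ hw).trans
      Finset.subset_union_right)
  -- Minimality of `F` now forbids any section to have changed, since each change lowers the sum
  -- strictly.
  have hsum := hmin F' (rainbow_assemble hi hJ₀.rainbow (fun w hw => (hJ w hw).1.rainbow) hW)
    hcard hsh
  have hle : ∀ w ∈ colorClass r i F, ∑ A ∈ J w, colexVal A ≤ ∑ A ∈ sectionAt F w, colexVal A :=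
    fun w hw => by rcases (hJ w hw).2.2 with h | h; exacts [h ▸ le_rfl, h.le]
  conv_lhs at hsum => rw [← assemble_sections r i F]
  rw [hF', sum_colexVal_assemble b0 bw hid hW, sum_colexVal_assemble a0 aw hid hW] at hsum
  have hterm : ∀ w ∈ colorClass r i F, #(J w) * 2 ^ id w + ∑ A ∈ J w, colexVal A ≤
      #(sectionAt F w) * 2 ^ id w + ∑ A ∈ sectionAt F w, colexVal A := fun w hw => by
    rw [(hJ w hw).2.1]; exact Nat.add_le_add_left (hle w hw) _
  have hS := Finset.sum_le_sum hterm
  constructor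
  · rcases hs₀ with h | h
    · exact h ▸ hJ₀
    · omega
  · intro w hw
    rcases (hJ w hw).2.2 with h | h
    · exact h ▸ (hJ w hw).1
    · exfalso
      have h3 := Finset.sum_lt_sum hterm ⟨w, hw, by rw [(hJ w hw).2.1]; omega⟩
      have : ∑ A ∈ J₀, colexVal A ≤ ∑ A ∈ section₀ r i F, colexVal A := by
        rcases hs₀ with h | h; exacts [h ▸ le_rfl, h.le]
      omega

/-- Sets sharing a vertex `w` are compared in the link of `w`; sets missing a common color are
compared in the section that avoids it. Both are initial segments. -/
lemma isCompressed_of_minimal (hr : ∀ c ∈ R, c < r)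
    (h1 : ∀ i ∈ R, ShadowBound r (R.erase i) (K + 2))
    (h2 : ∀ i ∈ R, ShadowBound r (R.erase i) (K + 1))
    (hF : ∀ A ∈ F, IsRainbow r R (K + 2) A)
    (hmin : ∀ F', (∀ A ∈ F', IsRainbow r R (K + 2) A) → #F' = #F → #(∂ F') ≤ #(∂ F) →
      ∑ A ∈ F, colexVal A ≤ ∑ A ∈ F', colexVal A) : IsCompressed r R (K + 2) F := by
  rintro B hB A hA hAB (⟨w, hwA, hwB⟩ | ⟨i, hi, hiA, hiB⟩)
  · have hwR := hA.mem w hwA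
    have h := (sections_isInit hr hwR (h1 _ hwR) (h2 _ hwR) hF hmin).2 w
      (Finset.mem_filter.2 ⟨Finset.mem_biUnion.2 ⟨B, hB, hwB⟩, rfl⟩)
    have := h.down (B.erase w) (mem_sectionAt.2 ⟨Finset.notMem_erase _ _, by
      rwa [Finset.insert_erase hwB]⟩) (A.erase w) (hA.erase hwA) (by
        have := colexVal_erase hwA
        have := colexVal_erase hwB
        omega)
    simpa [Finset.insert_erase hwA] using (mem_sectionAt.1 this).2
  · have h := (sections_isInit hr hi (h1 _ hi) (h2 _ hi) hF hmin).1
    exact (Finset.mem_filter.1 (h.down B (Finset.mem_filter.2 ⟨hB, hiB⟩) A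
      ⟨hA.card, fun a ha => Finset.mem_erase.2 ⟨hiA a ha, hA.mem a ha⟩, hA.inj⟩ hAB.le)).1

end Sections

/-! ### Minimal compressed families are initial segments -/

lemma add_le_of_mod_eq {a b r : ℕ} (h : a % r = b % r) (hab : a < b) : a + r ≤ b := by
  have h1 : r ∣ b - a := (Nat.modEq_iff_dvd' hab.le).1 h
  have := Nat.le_of_dvd (by omega) h1
  omega

lemma sub_mod_self {y r : ℕ} (h : r ≤ y) : (y - r) % r = y % r := by
  rw [Nat.mod_eq_sub_mod h]

/-- Two sets have an element or a missing color in common. -/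
def Meets (r : ℕ) (R A B : Finset ℕ) : Prop :=
  (∃ a ∈ A, a ∈ B) ∨ ∃ i ∈ R, (∀ a ∈ A, a % r ≠ i) ∧ ∀ b ∈ B, b % r ≠ i

/-- `A` is the first rainbow set missing from `F`, `B` is the last one in `F`, and `A < B`. -/
structure IsGap (r : ℕ) (R : Finset ℕ) (K : ℕ) (F : Finset (Finset ℕ)) (A B : Finset ℕ) :
    Prop where
  rainbow : ∀ C ∈ F, IsRainbow r R K C
  compressed : IsCompressed r R K F
  left : IsRainbow r R K A
  left_not_mem : A ∉ F
  right_mem : B ∈ F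
  lt : colexVal A < colexVal B
  below : ∀ C, IsRainbow r R K C → colexVal C < colexVal A → C ∈ F
  above : ∀ C ∈ F, colexVal C ≤ colexVal B

/-- The elements `x` of `A` such that `A \ x` is not in the shadow of an earlier set. -/
def uncovered (r : ℕ) (R A : Finset ℕ) : Finset ℕ :=
  A.filter fun x => ∀ y < x, y % r ∈ R → y % r ∈ (A.erase x).image (· % r)

variable {r K : ℕ} {R A B : Finset ℕ} {F : Finset (Finset ℕ)}

/-- Otherwise `x - r` is a smaller element of the same color, and no other element of `A` has that
color. -/
lemma uncovered_lt {x : ℕ} (hA : IsRainbow r R K A) (hx : x ∈ uncovered r R A) (hr : 0 < r) :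
    x < r := by
  by_contra! h
  obtain ⟨hxA, hx⟩ := Finset.mem_filter.1 hx
  have := hx (x - r) (by omega) (by rw [sub_mod_self h]; exact hA.mem x hxA)
  obtain ⟨a, ha, e⟩ := Finset.mem_image.1 this
  have e : a % r = (x - r) % r := e
  rw [sub_mod_self h] at e
  exact Finset.ne_of_mem_erase ha (hA.inj a (Finset.mem_of_mem_erase ha) x hxA e)

/-! ### Exchanging the last member for the first missing set -/

namespace IsGap

lemma right (h : IsGap r R K F A B) : IsRainbow r R K B := h.rainbow B h.right_mem

lemma not_meets (h : IsGap r R K F A B) : ¬ Meets r R A B := fun hm =>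
  h.left_not_mem (h.compressed B h.right_mem A h.left h.lt hm)

lemma disjoint (h : IsGap r R K F A B) {a b : ℕ} (ha : a ∈ A) (hb : b ∈ B) : a ≠ b := by
  rintro rfl
  exact h.not_meets (Or.inl ⟨a, ha, hb⟩)

lemma exists_color (h : IsGap r R K F A B) {i : ℕ} (hi : i ∈ R) (hA : ∀ a ∈ A, a % r ≠ i) :
    ∃ b ∈ B, b % r = i := by
  by_contra! hc
  exact h.not_meets (Or.inr ⟨i, hi, hA, hc⟩)

/-- Compression from `B` to `C` and from `C` to `A` would put `A` into `F`. Most structural facts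
about a gap come from exhibiting such a `C`. -/
lemma not_between (h : IsGap r R K F A B) {C : Finset ℕ} (hC : IsRainbow r R K C)
    (h1 : colexVal A < colexVal C) (h2 : colexVal C < colexVal B) (h3 : Meets r R A C)
    (h4 : Meets r R C B) : False :=
  h.left_not_mem (h.compressed C (h.compressed B h.right_mem C hC h2 h4) A h.left h1 h3)

lemma lt_max (h : IsGap r R K F A B) {b : ℕ} (hb : b ∈ B) (hmax : ∀ y ∈ B, y ≤ b) :
    ∀ a ∈ A, a < b := by
  intro a ha
  by_contra! hc
  have hne := h.disjoint ha hb
  have h1 := two_pow_le_colexVal ha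
  have h2 : colexVal B < 2 ^ a := colexVal_lt_two_pow fun y hy => by
    have := hmax y hy
    omega
  have := h.lt
  omega

/-- Exchanging `A` and `B`. -/
lemma swap_of_card_uncovered_le {K : ℕ} (h : IsGap r R (K + 1) F A B)
    (hu : #(uncovered r R A) ≤ #(uncovered r R B)) :
    ∃ F', (∀ A ∈ F', IsRainbow r R (K + 1) A) ∧ #F' = #F ∧ #(∂ F') ≤ #(∂ F) ∧
      ∑ A ∈ F', colexVal A < ∑ A ∈ F, colexVal A := by
  have hAE : A ∉ F.erase B := fun h' => h.left_not_mem (Finset.mem_of_mem_erase h')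
  refine ⟨insert A (F.erase B), ?_, ?_, ?_, ?_⟩
  · intro C hC
    rcases Finset.mem_insert.1 hC with rfl | hC
    · exact h.left
    · exact h.rainbow C (Finset.mem_of_mem_erase hC)
  · rw [Finset.card_insert_of_notMem hAE, Finset.card_erase_of_mem h.right_mem]
    have := Finset.card_pos.2 ⟨B, h.right_mem⟩
    omega
  · have h1 : ∂ (insert A (F.erase B)) ⊆ ∂ (F.erase B) ∪ (uncovered r R A).image A.erase := by
      intro D hD
      obtain ⟨C, hC, c, hc, rfl⟩ := Finset.mem_shadow_iff.1 hD
      rcases Finset.mem_insert.1 hC with rfl | hC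
      · by_cases hcu : c ∈ uncovered r R C
        · exact Finset.mem_union_right _ (Finset.mem_image_of_mem _ hcu)
        · have hcu' : ∃ y < c, y % r ∈ R ∧ y % r ∉ (C.erase c).image (· % r) := by
            by_contra! hcon
            exact hcu (Finset.mem_filter.2 ⟨hc, hcon⟩)
          obtain ⟨y, hyc, hyR, hy⟩ := hcu'
          have hy' : ∀ a ∈ C.erase c, a % r ≠ y % r := fun a ha e =>
            hy (Finset.mem_image.2 ⟨a, ha, e⟩)
          have hyC : y ∉ C.erase c := fun h' => hy' y h' rfl
          have hyC' : y ∉ C := fun h' => hyC (Finset.mem_erase.2 ⟨by omega, h'⟩)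
          have hv := colexVal_swap hc hyC'
          have hp : 2 ^ y < 2 ^ c := Nat.pow_lt_pow_right (by norm_num) hyc
          have hlt := h.lt
          refine Finset.mem_union_left _ (Finset.mem_shadow_iff_insert_mem.2 ⟨y, hyC, ?_⟩)
          refine Finset.mem_erase.2 ⟨fun e => ?_, h.below _ ?_ (by omega)⟩
          · rw [e] at hv; omega
          · exact h.left.swap hc hyR fun a ha hne => hy' a (Finset.mem_erase.2 ⟨hne, ha⟩)
      · exact Finset.mem_union_left _ (Finset.erase_mem_shadow hC hc)
    have h2 : ∂ (F.erase B) ∪ (uncovered r R B).image B.erase ⊆ ∂ F := by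
      refine Finset.union_subset (Finset.shadow_mono (Finset.erase_subset _ _)) fun D hD => ?_
      obtain ⟨c, hc, rfl⟩ := Finset.mem_image.1 hD
      exact Finset.erase_mem_shadow h.right_mem (Finset.mem_filter.1 hc).1
    -- Another member of `F` over `B.erase x` would replace `x` by a smaller element, against `x`
    -- being uncovered, or by a larger one, and then come after `B`.
    have h3 : Disjoint (∂ (F.erase B)) ((uncovered r R B).image B.erase) := by
      rw [Finset.disjoint_left]
      intro D hD hD'
      obtain ⟨x, hx, rfl⟩ := Finset.mem_image.1 hD'
      obtain ⟨hxB, hx⟩ := Finset.mem_filter.1 hx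
      obtain ⟨y, hy, hyF⟩ := Finset.mem_shadow_iff_insert_mem.1 hD
      obtain ⟨hne, hyF⟩ := Finset.mem_erase.1 hyF
      have hrb := h.rainbow _ hyF
      have hyx : y ≠ x := fun e => hne (by rw [e, Finset.insert_erase hxB])
      have hyB : y ∉ B := fun h' => hy (Finset.mem_erase.2 ⟨hyx, h'⟩)
      rcases lt_or_gt_of_ne hyx with hl | hl
      · obtain ⟨a, ha, e⟩ := Finset.mem_image.1 (hx y hl (hrb.mem y (Finset.mem_insert_self _ _)))
        have := hrb.inj a (Finset.mem_insert_of_mem ha) y (Finset.mem_insert_self _ _) e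
        exact hy (this ▸ ha)
      · have hv := colexVal_swap hxB hyB
        have hp : 2 ^ x < 2 ^ y := Nat.pow_lt_pow_right (by norm_num) hl
        have := h.above _ hyF
        omega
    have h4 : #((uncovered r R B).image B.erase) = #(uncovered r R B) :=
      Finset.card_image_of_injOn fun x hx y hy e => by
        by_contra hne
        have : x ∈ B.erase y := Finset.mem_erase.2 ⟨hne, (Finset.mem_filter.1 hx).1⟩
        have e' : B.erase x = B.erase y := e
        rw [← e'] at this
        exact Finset.notMem_erase _ _ this
    have h5 := Finset.card_le_card h2
    rw [Finset.card_union_of_disjoint h3, h4] at h5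
    have h6 := (Finset.card_le_card h1).trans (Finset.card_union_le _ _)
    have h7 : #((uncovered r R A).image A.erase) ≤ _ := Finset.card_image_le
    omega
  · rw [Finset.sum_insert hAE]
    have := Finset.sum_erase_add F colexVal h.right_mem
    have := h.lt
    omega

/-- The configuration in which exchanging `A` and `B` does not help. -/
structure IsExceptional (r : ℕ) (R A B : Finset ℕ) (x b : ℕ) : Prop where
  mem_left : x ∈ A
  lt : x < r
  mem_right : b ∈ B
  max : ∀ y ∈ B, y ≤ b
  color : x % r = b % r
  window : ∀ a ∈ A, a ≠ x → b < a + r ∧ a < b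
  colors_left : ∀ c ∈ R, ∃ a ∈ A, a % r = c
  colors_right : ∀ c ∈ R, ∃ y ∈ B, y % r = c
  le : ∀ y ∈ B, r ≤ y

/-- An uncovered element of `A` whose color is used by `B` has the color of the maximum of `B`. -/
lemma color_eq_of_uncovered (h : IsGap r R K F A B) {x y b : ℕ} (hx : x ∈ uncovered r R A)
    (hb : b ∈ B) (hmax : ∀ y ∈ B, y ≤ b) (hy : y ∈ B) (hxy : x % r = y % r) : y = b := by
  by_contra hne
  obtain ⟨hxA, hx⟩ := Finset.mem_filter.1 hx
  have hxy' := h.disjoint hxA hy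
  have hlt : x < y := by
    by_contra! hc
    obtain ⟨a, ha, e⟩ := Finset.mem_image.1 (hx y (by omega) (h.right.mem y hy))
    exact Finset.ne_of_mem_erase ha
      (h.left.inj a (Finset.mem_of_mem_erase ha) x hxA (e.trans hxy.symm))
  have hxB : x ∉ B := fun h' => h.disjoint hxA h' rfl
  have hv := colexVal_swap hy hxB
  have hp : 2 ^ x < 2 ^ y := Nat.pow_lt_pow_right (by norm_num) hlt
  -- Exchanging `y` for `x` keeps the maximum `b`, so the result lies strictly between `A` and `B`
  -- and meets both.
  have hbC : b ∈ insert x (B.erase y) :=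
    Finset.mem_insert_of_mem (Finset.mem_erase.2 ⟨Ne.symm hne, hb⟩)
  refine h.not_between (h.right.swap hy (h.left.mem x hxA) fun a ha hane e => ?_) ?_
    (by omega) (Or.inl ⟨x, hxA, Finset.mem_insert_self _ _⟩) (Or.inl ⟨b, hbC, hb⟩)
  · exact hane (h.right.inj a ha y hy (e.trans hxy))
  · exact (colexVal_lt_two_pow (h.lt_max hb hmax)).trans_le (two_pow_le_colexVal hbC)

end IsGap
variable {r K : ℕ} {R A B : Finset ℕ} {F : Finset (Finset ℕ)}

lemma exists_minimal_nat {α : Type*} (p : α → Prop) (f : α → ℕ) (h : ∃ a, p a) :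
    ∃ a, p a ∧ ∀ b, p b → f a ≤ f b := by
  obtain ⟨a, ha, hmin⟩ := WellFounded.has_min (measure f).wf {a | p a} h
  exact ⟨a, ha, fun b hb => not_lt.1 (hmin b hb)⟩

namespace IsGap

/-- Exchanging an element of `B` above `x`, other than `b`, for `x` would give a set between; so `B`
without its maximum lies below `x`. As `x` is uncovered, `B.erase b` and `A.erase x` then use the
same colors. This excludes a second uncovered element of `A` and makes the minimum of `B` uncovered.
-/
lemma card_uncovered_le_of_color_not_mem (h : IsGap r R K F A B) (hr : 0 < r) (hK : 2 ≤ K)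
    {x b : ℕ} (hx : x ∈ uncovered r R A) (hb : b ∈ B) (hmax : ∀ y ∈ B, y ≤ b)
    (hcol : ∀ y ∈ B, y % r ≠ x % r) : #(uncovered r R A) ≤ #(uncovered r R B) := by
  obtain ⟨hxA, hx'⟩ := Finset.mem_filter.1 hx
  have hxr := uncovered_lt h.left hx hr
  have hxB : x ∉ B := fun h' => h.disjoint hxA h' rfl
  have hlt : ∀ y ∈ B, y ≠ b → y < x := by
    intro y hy hne
    by_contra! hc
    have hxy := h.disjoint hxA hy
    have hv := colexVal_swap hy hxB
    have hp : 2 ^ x < 2 ^ y := Nat.pow_lt_pow_right (by norm_num) (by omega)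
    have hbC : b ∈ insert x (B.erase y) :=
      Finset.mem_insert_of_mem (Finset.mem_erase.2 ⟨Ne.symm hne, hb⟩)
    exact h.not_between (h.right.swap hy (h.left.mem x hxA) fun a ha _ => hcol a ha)
      ((colexVal_lt_two_pow (h.lt_max hb hmax)).trans_le (two_pow_le_colexVal hbC))
      (by omega) (Or.inl ⟨x, hxA, Finset.mem_insert_self _ _⟩) (Or.inl ⟨b, hbC, hb⟩)
  have himg : (B.erase b).image (· % r) = (A.erase x).image (· % r) := by
    refine Finset.eq_of_subset_of_card_le (fun c hc => ?_) ?_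
    · obtain ⟨y, hy, rfl⟩ := Finset.mem_image.1 hc
      have hyB := Finset.mem_of_mem_erase hy
      exact hx' y (hlt y hyB (Finset.ne_of_mem_erase hy)) (h.right.mem y hyB)
    · rw [Finset.card_image_of_injOn (s := B.erase b), Finset.card_erase_of_mem hb, h.right.card,
        ← h.left.card, ← Finset.card_erase_of_mem hxA]
      · exact Finset.card_image_le
      · exact fun y hy z hz e => h.right.inj y (Finset.mem_of_mem_erase hy) z
          (Finset.mem_of_mem_erase hz) e
  have h1 : uncovered r R A ⊆ {x} := by
    intro x₂ hx₂
    rw [Finset.mem_singleton]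
    by_contra hne
    have hx₂A := (Finset.mem_filter.1 hx₂).1
    have : x₂ % r ∈ (A.erase x).image (· % r) :=
      Finset.mem_image.2 ⟨x₂, Finset.mem_erase.2 ⟨hne, hx₂A⟩, rfl⟩
    rw [← himg] at this
    obtain ⟨y, hy, e⟩ := Finset.mem_image.1 this
    exact Finset.ne_of_mem_erase hy
      (h.color_eq_of_uncovered hx₂ hb hmax (Finset.mem_of_mem_erase hy) e.symm)
  refine (Finset.card_le_card h1).trans ?_
  rw [Finset.card_singleton, Nat.succ_le_iff, Finset.card_pos]
  obtain ⟨y, hy, hymin⟩ := Finset.exists_min_image B id ⟨b, hb⟩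
  have hyb : y ≠ b := by
    rintro rfl
    have : B ⊆ {y} := fun z hz => Finset.mem_singleton.2 (le_antisymm (hmax z hz) (hymin z hz))
    have := Finset.card_le_card this
    rw [h.right.card, Finset.card_singleton] at this
    omega
  have hyx := hlt y hy hyb
  refine ⟨y, Finset.mem_filter.2 ⟨hy, fun z hz hzR => ?_⟩⟩
  have := hx' z (by omega) hzR
  rw [← himg] at this
  obtain ⟨y', hy', e⟩ := Finset.mem_image.1 this
  have e : y' % r = z % r := e
  refine Finset.mem_image.2 ⟨y', Finset.mem_erase.2 ⟨?_, Finset.mem_of_mem_erase hy'⟩, e⟩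
  -- Here `z < y < x < r`, so residues are the numbers themselves and `z`, `y` have different
  -- colors.
  rintro rfl
  rw [Nat.mod_eq_of_lt (by omega), Nat.mod_eq_of_lt (by omega)] at e
  omega

/-- The failure of a clause generally produces a rainbow set strictly between `A` and `B` that meets
both; the lower bound on `B` instead comes from the absence of uncovered elements. -/
lemma isExceptional (h : IsGap r R K F A B) (hr : ∀ c ∈ R, c < r) (hr0 : 0 < r) (hK : 3 ≤ K)
    {x b : ℕ} (hx : x ∈ uncovered r R A) (hb : b ∈ B) (hmax : ∀ y ∈ B, y ≤ b)
    (hxb : x % r = b % r) (hB : uncovered r R B = ∅) : IsExceptional r R A B x b := by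
  have hxA := (Finset.mem_filter.1 hx).1
  have hxr := uncovered_lt h.left hx hr0
  have hAb := h.lt_max hb hmax
  have hAlt : colexVal A < 2 ^ b := colexVal_lt_two_pow hAb
  have hbB : 2 ^ b ≤ colexVal B := two_pow_le_colexVal hb
  have hxcol : ∀ a ∈ A, a ≠ x → a % r ≠ b % r := fun a ha hne e =>
    hne (h.left.inj a ha x hxA (e.trans hxb.symm))
  have hltb : ∀ y ∈ B, y ≠ b → y < b := fun y hy hne => lt_of_le_of_ne (hmax y hy) hne
  -- moving an element of `A` up to an element of `B`
  have up : ∀ y ∈ B, y ≠ b → ∀ a ∈ A, a ≠ x → (∀ a' ∈ A, a' ≠ a → a' % r ≠ y % r) → y < a := by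
    intro y hy hyb a ha hax hcol
    by_contra! hc
    have hay := h.disjoint ha hy
    have hyA : y ∉ A := fun h' => h.disjoint h' hy rfl
    have hv := colexVal_swap ha hyA
    have hp : 2 ^ a < 2 ^ y := Nat.pow_lt_pow_right (by norm_num) (by omega)
    have hC : colexVal (insert y (A.erase a)) < 2 ^ b := colexVal_lt_two_pow fun z hz => by
      rcases Finset.mem_insert.1 hz with rfl | hz
      · exact hltb z hy hyb
      · exact hAb z (Finset.mem_of_mem_erase hz)
    exact h.not_between (h.left.swap ha (h.right.mem y hy) hcol) (by omega) (by omega)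
      (Or.inl ⟨x, hxA, Finset.mem_insert_of_mem (Finset.mem_erase.2 ⟨Ne.symm hax, hxA⟩)⟩)
      (Or.inl ⟨y, Finset.mem_insert_self _ _, hy⟩)
  have hnotunc : ∀ y ∈ B, ∃ z < y, z % r ∈ R ∧ ∀ y' ∈ B, y' ≠ y → y' % r ≠ z % r := by
    intro y hy
    by_contra! hc
    have : y ∈ uncovered r R B := Finset.mem_filter.2 ⟨hy, fun z hz hzR => by
      obtain ⟨y', h1, h2, h3⟩ := hc z hz hzR
      exact Finset.mem_image.2 ⟨y', Finset.mem_erase.2 ⟨h2, h1⟩, h3⟩⟩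
    rw [hB] at this
    exact absurd this (Finset.notMem_empty _)
  have colA : ∀ c ∈ R, ∃ a ∈ A, a % r = c := by
    intro c hc
    by_contra! hcA
    obtain ⟨y, hy, hyc⟩ := h.exists_color hc hcA
    have hyb : y ≠ b := by
      rintro rfl
      exact hcA x hxA (hxb.trans hyc)
    -- If `A` misses the color `c` of `y`, then exchanging `y` for a smaller unused color `s` leaves
    -- `c` missing from both sets, which therefore meet.
    have hs : ∀ s ∈ R, (∀ z ∈ B, z % r ≠ s) → y < s := by
      intro s hsR hsB
      by_contra! hsy
      have hss := Nat.mod_eq_of_lt (hr s hsR)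
      have hsB' : s ∉ B := fun h' => hsB s h' hss
      have hne : s ≠ y := fun e => hsB' (e ▸ hy)
      have hv := colexVal_swap hy hsB'
      have hp : 2 ^ s < 2 ^ y := Nat.pow_lt_pow_right (by norm_num) (by omega)
      have hbC : b ∈ insert s (B.erase y) :=
        Finset.mem_insert_of_mem (Finset.mem_erase.2 ⟨Ne.symm hyb, hb⟩)
      refine h.not_between (h.right.swap hy (by rwa [hss]) fun z hz _ => by
        rw [hss]; exact hsB z hz) (hAlt.trans_le (two_pow_le_colexVal hbC)) (by omega)
        (Or.inr ⟨c, hc, hcA, fun z hz e => ?_⟩) (Or.inl ⟨b, hbC, hb⟩)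
      rcases Finset.mem_insert.1 hz with rfl | hz
      · exact hsB y hy (by rw [hyc, ← hss, e])
      · exact Finset.ne_of_mem_erase hz
          (h.right.inj z (Finset.mem_of_mem_erase hz) y hy (e.trans hyc.symm))
    obtain ⟨s, hsR, hsB⟩ : ∃ s ∈ R, s ∉ B.image (· % r) := by
      by_contra! hcon
      have h1 := Finset.card_le_card (show R ⊆ B.image (· % r) from hcon)
      have h2 : A.image (· % r) ⊆ R.erase c := fun d hd => by
        obtain ⟨a, ha, rfl⟩ := Finset.mem_image.1 hd
        exact Finset.mem_erase.2 ⟨hcA a ha, h.left.mem a ha⟩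
      have h3 := Finset.card_le_card h2
      rw [h.left.card_image, Finset.card_erase_of_mem hc] at h3
      rw [h.right.card_image] at h1
      omega
    have hys := hs s hsR fun z hz e => hsB (Finset.mem_image.2 ⟨z, hz, e⟩)
    have hsr := hr s hsR
    obtain ⟨z, hzy, hzR, hz⟩ := hnotunc y hy
    have hzz : z % r = z := Nat.mod_eq_of_lt (by omega)
    rw [hzz] at hzR hz
    have := hs z hzR fun y' hy' => by
      rcases eq_or_ne y' y with rfl | hne
      · rw [Nat.mod_eq_of_lt (by omega)]; omega
      · exact hz y' hy' hne
    omega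
  have colB : ∀ c ∈ R, ∃ y ∈ B, y % r = c := by
    have h1 : R ⊆ A.image (· % r) := fun c hc => Finset.mem_image.2 (colA c hc)
    have h2 := Finset.card_le_card h1
    rw [h.left.card_image, ← h.right.card_image] at h2
    have h3 := Finset.eq_of_subset_of_card_le h.right.image_subset h2
    intro c hc
    rw [← h3] at hc
    exact Finset.mem_image.1 hc
  -- All colors occur in `B`, so the smaller element showing that `y` is not uncovered can only have
  -- the color of `y` itself.
  have hle : ∀ y ∈ B, r ≤ y := by
    intro y hy
    obtain ⟨z, hzy, hzR, hz⟩ := hnotunc y hy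
    obtain ⟨y', hy', e⟩ := colB _ hzR
    have : y' = y := by
      by_contra hne
      exact hz y' hy' hne e
    subst this
    have := add_le_of_mod_eq e.symm hzy
    omega
  -- It suffices to treat the second largest element `p` of `B`. If `a` has another color, two
  -- exchanges in `B` are made at once: `p` for `p - r`, and the element `y` of the color of `a` for
  -- `a`.
  have hBA : ∀ a ∈ A, a ≠ x → ∀ y ∈ B, y ≠ b → y < a := by
    intro a ha hax y₀ hy₀ hy₀b
    obtain ⟨p, hp, hpmax⟩ := Finset.exists_max_image (B.erase b) id
      ⟨y₀, Finset.mem_erase.2 ⟨hy₀b, hy₀⟩⟩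
    obtain ⟨hpb, hpB⟩ := Finset.mem_erase.1 hp
    refine (hpmax y₀ (Finset.mem_erase.2 ⟨hy₀b, hy₀⟩)).trans_lt ?_
    simp only [id]
    by_cases hap : a % r = p % r
    · exact up p hpB hpb a ha hax fun a' ha' hne e => hne (h.left.inj a' ha' a ha (e.trans hap.symm))
    · by_contra! hc
      have hne := h.disjoint ha hpB
      obtain ⟨y, hy, hya⟩ := colB _ (h.left.mem a ha)
      have hyp : y ≠ p := by rintro rfl; exact hap hya.symm
      have hyb : y ≠ b := by rintro rfl; exact hxcol a ha hax hya.symm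
      have hrp := hle p hpB
      have hprm := sub_mod_self hrp
      have hprB : p - r ∉ B := h.right.not_mem_of_color hpB hprm.symm (by omega)
      have hC₁ := h.right.swap hpB (y := p - r) (by rw [hprm]; exact h.right.mem p hpB)
        fun z hz hzp e => hzp (h.right.inj z hz p hpB (e.trans hprm))
      have hyC₁ : y ∈ insert (p - r) (B.erase p) :=
        Finset.mem_insert_of_mem (Finset.mem_erase.2 ⟨hyp, hy⟩)
      have haC₁ : a ∉ insert (p - r) (B.erase p) := by
        rw [Finset.mem_insert, not_or]
        refine ⟨fun e => hap (by rw [e, hprm]), fun h' => ?_⟩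
        exact h.disjoint ha (Finset.mem_of_mem_erase h') rfl
      have hC := hC₁.swap hyC₁ (h.left.mem a ha) fun z hz hzy e =>
        hzy (hC₁.inj z hz y hyC₁ (e.trans hya.symm))
      have hv₁ := colexVal_swap hpB hprB
      have hv₂ := colexVal_swap hyC₁ haC₁
      have hpow : 2 ^ (p - r) + 2 ^ a < 2 ^ p + 2 ^ y := two_pow_add_lt (by omega) (by omega)
      have hbC : b ∈ insert a ((insert (p - r) (B.erase p)).erase y) :=
        Finset.mem_insert_of_mem (Finset.mem_erase.2 ⟨Ne.symm hyb,
          Finset.mem_insert_of_mem (Finset.mem_erase.2 ⟨Ne.symm hpb, hb⟩)⟩)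
      exact h.not_between hC (hAlt.trans_le (two_pow_le_colexVal hbC)) (by omega)
        (Or.inl ⟨a, ha, Finset.mem_insert_self _ _⟩) (Or.inl ⟨b, hbC, hb⟩)
  refine ⟨hxA, hxr, hb, hmax, hxb, fun a ha hax => ⟨?_, hAb a ha⟩, colA, colB, hle⟩
  -- An `a` outside the window would allow raising `x` to `b - r` while lowering `a` to the element
  -- `y` of its color in `B`; the resulting set lies between.
  by_contra! hc
  have hrb := hle b hb
  have hbrm := sub_mod_self hrb
  have hab : a ≠ b - r := by
    rintro rfl
    exact hxcol _ ha hax hbrm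
  obtain ⟨y, hy, hya⟩ := colB _ (h.left.mem a ha)
  have hyb : y ≠ b := by rintro rfl; exact hxcol a ha hax hya.symm
  have hyr := hle y hy
  have hylt := hBA a ha hax y hy hyb
  have hbrA : b - r ∉ A := h.left.not_mem_of_color hxA (hxb.trans hbrm.symm) (by omega)
  have hC₁ := h.left.swap hxA (y := b - r) (by rw [hbrm]; exact h.right.mem b hb)
    fun z hz hzx e => hxcol z hz hzx (e.trans hbrm)
  have haC₁ : a ∈ insert (b - r) (A.erase x) :=
    Finset.mem_insert_of_mem (Finset.mem_erase.2 ⟨hax, ha⟩)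
  have hyC₁ : y ∉ insert (b - r) (A.erase x) := by
    rw [Finset.mem_insert, not_or]
    refine ⟨by omega, fun h' => h.disjoint (Finset.mem_of_mem_erase h') hy rfl⟩
  have hC := hC₁.swap haC₁ (h.right.mem y hy) fun z hz hza e =>
    hza (hC₁.inj z hz a haC₁ (e.trans hya))
  have hv₁ := colexVal_swap hxA hbrA
  have hv₂ := colexVal_swap haC₁ hyC₁
  have hpow : 2 ^ x + 2 ^ a < 2 ^ (b - r) + 2 ^ y := two_pow_add_lt (by omega) (by omega)
  have hlt : colexVal (insert y ((insert (b - r) (A.erase x)).erase a)) < 2 ^ b :=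
    colexVal_lt_two_pow fun z hz => by
      rcases Finset.mem_insert.1 hz with rfl | hz
      · exact hltb z hy hyb
      · rcases Finset.mem_insert.1 (Finset.mem_of_mem_erase hz) with rfl | hz
        · omega
        · exact hAb z (Finset.mem_of_mem_erase hz)
  -- A third element of `A`, available because `3 ≤ K`, survives both exchanges and makes the new
  -- set meet `A`.
  obtain ⟨a₂, ha₂⟩ : ((A.erase x).erase a).Nonempty := by
    rw [← Finset.card_pos, Finset.card_erase_of_mem (Finset.mem_erase.2 ⟨hax, ha⟩),
      Finset.card_erase_of_mem hxA, h.left.card]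
    omega
  obtain ⟨h1, h2⟩ := Finset.mem_erase.1 ha₂
  exact h.not_between hC (by omega) (by omega)
    (Or.inl ⟨a₂, Finset.mem_of_mem_erase h2, Finset.mem_insert_of_mem
      (Finset.mem_erase.2 ⟨h1, Finset.mem_insert_of_mem h2⟩)⟩)
    (Or.inl ⟨y, Finset.mem_insert_self _ _, hy⟩)

/-- Unless some uncovered element of `A` has a color unused by `B`, all of them have the color of
the maximum of `B`. Then there is at most one, and the inequality can fail only if `B` has none. -/
lemma card_uncovered_le_or (h : IsGap r R K F A B) (hr : ∀ c ∈ R, c < r) (hr0 : 0 < r)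
    (hK : 3 ≤ K) : #(uncovered r R A) ≤ #(uncovered r R B) ∨ ∃ x b, IsExceptional r R A B x b := by
  rcases (uncovered r R A).eq_empty_or_nonempty with hA | ⟨x, hx⟩
  · left; simp [hA]
  obtain ⟨b, hb, hmax⟩ := Finset.exists_max_image B id (by
    rw [← Finset.card_pos, h.right.card]; omega)
  by_cases hc : ∃ x ∈ uncovered r R A, ∀ y ∈ B, y % r ≠ x % r
  · obtain ⟨x, hx, hcol⟩ := hc
    exact Or.inl (h.card_uncovered_le_of_color_not_mem hr0 (by omega) hx hb hmax hcol)
  · push Not at hc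
    have hcol : ∀ x ∈ uncovered r R A, x % r = b % r := fun x hx => by
      obtain ⟨y, hy, e⟩ := hc x hx
      rw [← h.color_eq_of_uncovered hx hb hmax hy e.symm, e]
    rcases (uncovered r R B).eq_empty_or_nonempty with hB | hB
    · exact Or.inr ⟨x, b, h.isExceptional hr hr0 hK hx hb hmax (hcol x hx) hB⟩
    · left
      refine le_trans (Finset.card_le_one.2 fun y hy z hz => ?_) (Finset.card_pos.2 hB)
      exact h.left.inj y (Finset.mem_filter.1 hy).1 z (Finset.mem_filter.1 hz).1
        ((hcol y hy).trans (hcol z hz).symm)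

/-- In the exceptional configuration several sets are exchanged at once. -/
lemma swap_of_isExceptional {K x b : ℕ} (h : IsGap r R (K + 1) F A B) (hK : 1 ≤ K) (hr0 : 0 < r)
    (he : IsExceptional r R A B x b) :
    ∃ F', (∀ A ∈ F', IsRainbow r R (K + 1) A) ∧ #F' = #F ∧ #(∂ F') ≤ #(∂ F) ∧
      ∑ A ∈ F', colexVal A < ∑ A ∈ F, colexVal A := by
  obtain ⟨y, hy, hymin⟩ := Finset.exists_min_image B id ⟨b, he.mem_right⟩
  have hyb : y ≠ b := by
    rintro rfl
    have : B ⊆ {y} := fun z hz => Finset.mem_singleton.2 (le_antisymm (he.max z hz) (hymin z hz))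
    have := Finset.card_le_card this
    rw [h.right.card, Finset.card_singleton] at this
    omega
  have hylt : y < b := lt_of_le_of_ne (he.max y hy) hyb
  have hry := he.le y hy
  -- The element of `A` with the color of `y` lies in the window of length `r` below `b`. It cannot
  -- lie below `y`, so it is at least `y + r`.
  have hyb' : y + r < b := by
    obtain ⟨a, ha, hay⟩ := he.colors_left _ (h.right.mem y hy)
    have hax : a ≠ x := by
      rintro rfl
      exact hyb (h.right.inj y hy b he.mem_right (hay.symm.trans he.color))
    have hw := he.window a ha hax
    rcases lt_or_gt_of_ne (h.disjoint ha hy) with hl | hl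
    · have := add_le_of_mod_eq hay hl
      omega
    · have := add_le_of_mod_eq hay.symm hl
      omega
  -- There are `y / r + 1` numbers of the color of `y` up to `y`; by the previous gap, equally many
  -- numbers of the color of `x`, starting at `x`, stay at distance at least `r` below `b`.
  have hxj : ∀ j < y / r + 1, x + r * j + r ≤ b := by
    intro j hj
    have h1 := Nat.div_add_mod b r
    have h2 := he.color
    rw [Nat.mod_eq_of_lt he.lt] at h2
    have h3 : y / r + 1 ≤ b / r := by
      rw [← Nat.add_div_right _ hr0]
      exact Nat.div_le_div_right hyb'.le
    have h4 : r * (j + 1) ≤ r * (b / r) := Nat.mul_le_mul_left _ (by omega)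
    rw [mul_add, mul_one] at h4
    omega
  have hxm : ∀ j, (x + r * j) % r = x % r := fun j => Nat.add_mul_mod_self_left _ _ _
  have hym : ∀ j, (y % r + r * j) % r = y % r := fun j => by
    rw [Nat.add_mul_mod_self_left, Nat.mod_mod]
  set Aj : ℕ → Finset ℕ := fun j => insert (x + r * j) (A.erase x) with hAj
  set Bj : ℕ → Finset ℕ := fun j => insert (y % r + r * j) (B.erase y) with hBj
  have hAjr : ∀ j, IsRainbow r R (K + 1) (Aj j) := fun j =>
    h.left.swap he.mem_left (by rw [hxm]; exact h.left.mem x he.mem_left) fun a ha hne e =>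
      hne (h.left.inj a ha x he.mem_left (e.trans (hxm j)))
  have hBjr : ∀ j, IsRainbow r R (K + 1) (Bj j) := fun j =>
    h.right.swap hy (by rw [hym]; exact h.right.mem y hy) fun a ha hne e =>
      hne (h.right.inj a ha y hy (e.trans (hym j)))
  have hxn : ∀ j, x + r * j ∉ A.erase x := fun j h' => Finset.ne_of_mem_erase h'
    (h.left.inj _ (Finset.mem_of_mem_erase h') x he.mem_left (hxm j))
  have hyn : ∀ j, y % r + r * j ∉ B.erase y := fun j h' => Finset.ne_of_mem_erase h'
    (h.right.inj _ (Finset.mem_of_mem_erase h') y hy (hym j))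
  have hAv : ∀ j, colexVal (Aj j) + 2 ^ x = colexVal A + 2 ^ (x + r * j) := fun j => by
    rw [hAj, colexVal_insert (hxn j), ← colexVal_erase he.mem_left]; ring
  have hBv : ∀ j, colexVal (Bj j) + 2 ^ y = colexVal B + 2 ^ (y % r + r * j) := fun j => by
    rw [hBj, colexVal_insert (hyn j), ← colexVal_erase hy]; ring
  have hAlt : ∀ j < y / r + 1, ∀ a ∈ Aj j, a < b := fun j hj a ha => by
    rcases Finset.mem_insert.1 ha with rfl | ha
    · have := hxj j hj
      omega
    · exact (he.window a (Finset.mem_of_mem_erase ha) (Finset.ne_of_mem_erase ha)).2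
  have hbB : ∀ j, b ∈ Bj j := fun j =>
    Finset.mem_insert_of_mem (Finset.mem_erase.2 ⟨Ne.symm hyb, he.mem_right⟩)
  have hBF : ∀ j < y / r + 1, Bj j ∈ F := by
    intro j hj
    have h1 : y % r + r * j ≤ y := by
      have h1 := Nat.div_add_mod y r
      have h4 : r * j ≤ r * (y / r) := Nat.mul_le_mul_left _ (by omega)
      omega
    have h2 : 2 ^ (y % r + r * j) ≤ 2 ^ y := Nat.pow_le_pow_right (by norm_num) h1
    have h3 := hBv j
    rcases (show colexVal (Bj j) ≤ colexVal B by omega).eq_or_lt with h4 | h4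
    · rw [colexVal_injective h4]; exact h.right_mem
    · exact h.compressed B h.right_mem _ (hBjr j) h4 (Or.inl ⟨b, hbB j, he.mem_right⟩)
  have hAF : ∀ j, Aj j ∉ F := by
    intro j hj
    have h2 : 2 ^ x ≤ 2 ^ (x + r * j) := Nat.pow_le_pow_right (by norm_num) (by omega)
    have h3 := hAv j
    rcases (show colexVal A ≤ colexVal (Aj j) by omega).eq_or_lt with h4 | h4
    · exact h.left_not_mem (colexVal_injective h4 ▸ hj)
    · obtain ⟨a, ha⟩ : (A.erase x).Nonempty := by
        rw [← Finset.card_pos, Finset.card_erase_of_mem he.mem_left, h.left.card]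
        omega
      exact h.left_not_mem (h.compressed _ hj A h.left h4
        (Or.inl ⟨a, Finset.mem_of_mem_erase ha, Finset.mem_insert_of_mem ha⟩))
  have hAinj : Function.Injective Aj := fun j j' e => by
    have h1 := hAv j
    rw [e, hAv j'] at h1
    have h2 := Nat.pow_right_injective le_rfl (Nat.add_left_cancel h1)
    exact Nat.eq_of_mul_eq_mul_left hr0 (Nat.add_left_cancel h2.symm)
  have hBinj : Function.Injective Bj := fun j j' e => by
    have h1 := hBv j
    rw [e, hBv j'] at h1
    have h2 := Nat.pow_right_injective le_rfl (Nat.add_left_cancel h1)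
    exact Nat.eq_of_mul_eq_mul_left hr0 (Nat.add_left_cancel h2.symm)
  set 𝓐 := (range (y / r + 1)).image Aj with h𝓐
  set 𝓑 := (range (y / r + 1)).image Bj with h𝓑
  have hAc : #𝓐 = y / r + 1 := by rw [h𝓐, Finset.card_image_of_injective _ hAinj, card_range]
  have hBc : #𝓑 = y / r + 1 := by rw [h𝓑, Finset.card_image_of_injective _ hBinj, card_range]
  have hBsub : 𝓑 ⊆ F := fun C hC => by
    obtain ⟨j, hj, rfl⟩ := Finset.mem_image.1 hC
    exact hBF j (Finset.mem_range.1 hj)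
  have hdisj : Disjoint (F \ 𝓑) 𝓐 := Finset.disjoint_left.2 fun C hC hC' => by
    obtain ⟨j, -, rfl⟩ := Finset.mem_image.1 hC'
    exact hAF j (Finset.mem_sdiff.1 hC).1
  refine ⟨F \ 𝓑 ∪ 𝓐, ?_, ?_, ?_, ?_⟩
  · intro C hC
    rcases Finset.mem_union.1 hC with hC | hC
    · exact h.rainbow C (Finset.mem_sdiff.1 hC).1
    · obtain ⟨j, -, rfl⟩ := Finset.mem_image.1 hC
      exact hAjr j
  · have h1 := Finset.card_le_card hBsub
    rw [Finset.card_union_of_disjoint hdisj, Finset.card_sdiff_of_subset hBsub, hAc, hBc]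
    omega
  · have h1 : ∂ (F \ 𝓑 ∪ 𝓐) ⊆ insert (A.erase x) (∂ (F \ 𝓑)) := by
      intro D hD
      obtain ⟨C, hC, c, hc, rfl⟩ := Finset.mem_shadow_iff.1 hD
      rcases Finset.mem_union.1 hC with hC | hC
      · exact Finset.mem_insert_of_mem (Finset.erase_mem_shadow hC hc)
      obtain ⟨j, hj, rfl⟩ := Finset.mem_image.1 hC
      have hj := Finset.mem_range.1 hj
      rcases Finset.mem_insert.1 hc with rfl | hc'
      · rw [hAj, Finset.erase_insert (hxn j)]
        exact Finset.mem_insert_self _ _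
      · have hcA := Finset.mem_of_mem_erase hc'
        have hw := he.window c hcA (Finset.ne_of_mem_erase hc')
        have hxj' := hxj j hj
        have hrc : r ≤ c := by omega
        have hcm := sub_mod_self hrc
        have hcn : c - r ∉ Aj j := (hAjr j).not_mem_of_color hc hcm.symm (by omega)
        have hv := colexVal_swap hc hcn
        have hv' := hAv j
        have hpow : 2 ^ (x + r * j) + 2 ^ (c - r) < 2 ^ c + 2 ^ x :=
          two_pow_add_lt (by omega) (by omega)
        have hC₂ := (hAjr j).swap hc (y := c - r) (by rw [hcm]; exact (hAjr j).mem c hc)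
          fun a ha hne e => hne ((hAjr j).inj a ha c hc (e.trans hcm))
        refine Finset.mem_insert_of_mem (Finset.mem_shadow_iff_insert_mem.2 ⟨c - r,
          fun h' => hcn (Finset.mem_of_mem_erase h'), Finset.mem_sdiff.2
            ⟨h.below _ hC₂ (by omega), fun hB => ?_⟩⟩)
        obtain ⟨i, -, e⟩ := Finset.mem_image.1 hB
        have hb := hbB i
        rw [e] at hb
        rcases Finset.mem_insert.1 hb with hb | hb
        · omega
        · exact absurd (hAlt j hj b (Finset.mem_of_mem_erase hb)) (lt_irrefl _)
    have h2 : insert (B.erase y) (∂ (F \ 𝓑)) ⊆ ∂ F :=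
      Finset.insert_subset (Finset.erase_mem_shadow h.right_mem hy)
        (Finset.shadow_mono Finset.sdiff_subset)
    -- All colors are used by `B`, so an element extending `B.erase y` has the color of `y`. It is
    -- at most `y` because `B` is the last member, and all these extensions have been removed.
    have h3 : B.erase y ∉ ∂ (F \ 𝓑) := by
      intro hD
      obtain ⟨z, hz, hzF⟩ := Finset.mem_shadow_iff_insert_mem.1 hD
      obtain ⟨hzF, hzB⟩ := Finset.mem_sdiff.1 hzF
      have hrb := h.rainbow _ hzF
      have hzm := Finset.mem_insert_self z (B.erase y)
      obtain ⟨y', hy', e⟩ := he.colors_right _ (hrb.mem z hzm)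
      have hyy : y' = y := by
        by_contra hne
        have hmem := Finset.mem_erase.2 ⟨hne, hy'⟩
        have := hrb.inj y' (Finset.mem_insert_of_mem hmem) z hzm e
        exact hz (this ▸ hmem)
      subst hyy
      have hv : colexVal (insert z (B.erase y')) + 2 ^ y' = colexVal B + 2 ^ z := by
        rw [colexVal_insert hz, ← colexVal_erase hy]; ring
      have hab := h.above _ hzF
      have hzy : z ≤ y' := (Nat.pow_le_pow_iff_right (a := 2) (by norm_num)).1 (by omega)
      refine hzB (Finset.mem_image.2 ⟨z / r, Finset.mem_range.2
        (Nat.lt_succ_of_le (Nat.div_le_div_right hzy)), ?_⟩)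
      rw [hBj]
      simp only [e, Nat.mod_add_div]
    have h4 := Finset.card_le_card h2
    rw [Finset.card_insert_of_notMem h3] at h4
    exact (Finset.card_le_card h1).trans ((Finset.card_insert_le _ _).trans h4)
  · rw [Finset.sum_union hdisj]
    have h1 := Finset.sum_sdiff (f := colexVal) hBsub
    have h2 : ∑ C ∈ 𝓐, colexVal C < ∑ C ∈ 𝓑, colexVal C := by
      rw [h𝓐, h𝓑, Finset.sum_image hAinj.injOn, Finset.sum_image hBinj.injOn]
      refine Finset.sum_lt_sum_of_nonempty ⟨0, by simp⟩ fun j hj => ?_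
      exact (colexVal_lt_two_pow (hAlt j (Finset.mem_range.1 hj))).trans_le
        (two_pow_le_colexVal (hbB j))
    omega

end IsGap

/-- A family that is not initial has a gap, formed by its first missing set and its last member. One
of the two exchanges then contradicts minimality. -/
lemma isInit_of_minimal (hr : ∀ c ∈ R, c < r) (hr0 : 0 < r) (hK : 2 ≤ K)
    (hF : ∀ A ∈ F, IsRainbow r R (K + 1) A) (hcomp : IsCompressed r R (K + 1) F)
    (hmin : ∀ F', (∀ A ∈ F', IsRainbow r R (K + 1) A) → #F' = #F → #(∂ F') ≤ #(∂ F) →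
      ∑ A ∈ F, colexVal A ≤ ∑ A ∈ F', colexVal A) : IsInit r R (K + 1) F := by
  by_contra hI
  obtain ⟨B, hB, A, hA, hAB, hAF⟩ : ∃ B ∈ F, ∃ A, IsRainbow r R (K + 1) A ∧
      colexVal A ≤ colexVal B ∧ A ∉ F := by
    by_contra! hcon
    exact hI ⟨hF, fun B hB A hA hl => hcon B hB A hA hl⟩
  obtain ⟨B', hB', hmax⟩ := Finset.exists_max_image F colexVal ⟨B, hB⟩
  obtain ⟨A', ⟨hA', hAF'⟩, hminA⟩ := exists_minimal_nat
    (fun A => IsRainbow r R (K + 1) A ∧ A ∉ F) colexVal ⟨A, hA, hAF⟩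
  have hgap : IsGap r R (K + 1) F A' B' :=
    { rainbow := hF
      compressed := hcomp
      left := hA'
      left_not_mem := hAF'
      right_mem := hB'
      lt := by
        have h1 := (hminA A ⟨hA, hAF⟩).trans (hAB.trans (hmax B hB))
        exact lt_of_le_of_ne h1 fun e => hAF' (colexVal_injective e ▸ hB')
      below := fun C hC hl => by
        by_contra hCF
        exact absurd (hminA C ⟨hC, hCF⟩) (not_le.2 hl)
      above := hmax }
  obtain ⟨F', h1, h2, h3, h4⟩ :
      ∃ F', (∀ A ∈ F', IsRainbow r R (K + 1) A) ∧ #F' = #F ∧ #(∂ F') ≤ #(∂ F) ∧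
      ∑ A ∈ F', colexVal A < ∑ A ∈ F, colexVal A := by
    rcases hgap.card_uncovered_le_or hr hr0 (by omega) with h | ⟨x, b, h⟩
    · exact hgap.swap_of_card_uncovered_le h
    · exact hgap.swap_of_isExceptional (by omega) hr0 h
  exact absurd (hmin F' h1 h2 h3) (not_le.2 h4)

/-- The colored Kruskal–Katona theorem of Frankl, Füredi and Kalai, reduced to the case of
graphs. -/
theorem shadowBound_of_two (h2 : ∀ R : Finset ℕ, (∀ c ∈ R, c < r) → ShadowBound r R 2) :
    ∀ (K : ℕ) (R : Finset ℕ), (∀ c ∈ R, c < r) → ShadowBound r R (K + 2) := by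
  intro K R
  induction hn : #R using Nat.strong_induction_on generalizing K R with
  | _ n ih =>
    subst hn
    intro hr
    obtain _ | K := K
    · exact h2 R hr
    intro F hF J hJ hc
    rcases R.eq_empty_or_nonempty with rfl | ⟨c₀, hc₀⟩
    · have : J = ∅ := Finset.eq_empty_of_forall_notMem fun A hA => by
        have := (hJ.rainbow A hA).le_card
        simp at this
      simp [this]
    have hr0 : 0 < r := (Nat.zero_le _).trans_lt (hr c₀ hc₀)
    have hr' : ∀ i, ∀ c ∈ R.erase i, c < r := fun i c hc => hr c (Finset.mem_of_mem_erase hc)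
    -- choose a competitor with the least sum of values
    obtain ⟨F', ⟨hF', hcF, hsF⟩, hmin⟩ := exists_minimal_nat
      (fun F' : Finset (Finset ℕ) => (∀ A ∈ F', IsRainbow r R (K + 1 + 2) A) ∧ #F' = #F ∧
        #(∂ F') ≤ #(∂ F)) (fun F' => ∑ A ∈ F', colexVal A) ⟨F, hF, rfl, le_rfl⟩
    have hmin' : ∀ F'', (∀ A ∈ F'', IsRainbow r R (K + 1 + 2) A) → #F'' = #F' →
        #(∂ F'') ≤ #(∂ F') → ∑ A ∈ F', colexVal A ≤ ∑ A ∈ F'', colexVal A :=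
      fun F'' h1 h2 h3 => hmin F'' ⟨h1, h2.trans hcF, h3.trans hsF⟩
    have hcomp := isCompressed_of_minimal hr
      (fun i hi => ih _ (Finset.card_erase_lt_of_mem hi) (K + 1) _ rfl (hr' i))
      (fun i hi => ih _ (Finset.card_erase_lt_of_mem hi) K _ rfl (hr' i)) hF' hmin'
    have hI := isInit_of_minimal hr hr0 (by omega) hF' hcomp hmin'
    exact (Finset.card_le_card (Finset.shadow_mono
      (hJ.subset_of_card_le hI (hc.trans hcF.ge)))).trans hsF

/-! ### Counting rainbow sets by cliques of Turán graphs -/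

section Enumeration

variable {r : ℕ} {R : Finset ℕ}

/-- Numbers with color in `R` are listed in increasing order, one block of `#R` for each period `r`.
Their colors thereby become residues modulo `#R`, as in the Turán graph. -/
lemma exists_colorEnum (hr : ∀ c ∈ R, c < r) (hR : R.Nonempty) :
    ∃ e : ℕ → ℕ, StrictMono e ∧ (∀ a, a % r ∈ R ↔ ∃ m, e m = a) ∧
      (∀ m m', e m % r = e m' % r ↔ m % #R = m' % #R) ∧ ∀ m, e m / r = m / #R := by
  have hρ : 0 < #R := hR.card_pos
  let s : ℕ → ℕ := fun m => R.orderEmbOfFin rfl ⟨m % #R, Nat.mod_lt _ hρ⟩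
  have hsR : ∀ m, s m ∈ R := fun m => Finset.orderEmbOfFin_mem _ _ _
  have hsr : ∀ m, s m < r := fun m => hr _ (hsR m)
  have hslt : ∀ m m', s m < s m' ↔ m % #R < m' % #R := fun m m' => by
    simp only [s, OrderEmbedding.lt_iff_lt, Fin.mk_lt_mk]
  have hseq : ∀ m m', s m = s m' ↔ m % #R = m' % #R := fun m m' => by
    simp only [s, EmbeddingLike.apply_eq_iff_eq, Fin.mk.injEq]
  have hmod : ∀ m, (r * (m / #R) + s m) % r = s m := fun m => by
    rw [Nat.mul_add_mod, Nat.mod_eq_of_lt (hsr m)]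
  have hr0 : 0 < r := (Nat.zero_le _).trans_lt (hsr 0)
  refine ⟨fun m => r * (m / #R) + s m, fun m m' hm => ?_, fun a => ⟨fun ha => ?_, ?_⟩,
    fun m m' => ?_, fun m => ?_⟩
  · simp only
    rcases (Nat.div_le_div_right (c := #R) hm.le).eq_or_lt with h | h
    · have h1 := Nat.div_add_mod m #R
      have h2 := Nat.div_add_mod m' #R
      rw [h] at h1 ⊢
      have := (hslt m m').2 (by omega)
      omega
    · have := hsr m
      have h3 : r * (m / #R + 1) ≤ r * (m' / #R) := Nat.mul_le_mul_left _ h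
      rw [mul_add, mul_one] at h3
      omega
  · have : a % r ∈ Set.range (R.orderEmbOfFin rfl) := by
      rw [Finset.range_orderEmbOfFin]; exact ha
    obtain ⟨j, hj⟩ := this
    refine ⟨#R * (a / r) + j, ?_⟩
    have h1 : s (#R * (a / r) + j) = a % r := by
      rw [← hj]
      simp only [s, Nat.mul_add_mod, Nat.mod_eq_of_lt j.2]
    have h2 : (#R * (a / r) + j) / #R = a / r := by
      rw [Nat.mul_add_div hρ, Nat.div_eq_of_lt j.2, add_zero]
    simp only [h1, h2, Nat.div_add_mod]
  · rintro ⟨m, rfl⟩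
    simp only [hmod, hsR]
  · simp only [hmod, hseq]
  · simp only
    rw [Nat.mul_add_div hr0, Nat.div_eq_of_lt (hsr m), add_zero]

/-- The number of `a < d` whose residue modulo `r` lies in `R`. -/
def colorCount (r : ℕ) (R : Finset ℕ) (d : ℕ) : ℕ := #((range d).filter fun a => a % r ∈ R)

lemma colorCount_mono {d d' : ℕ} (h : d ≤ d') : colorCount r R d ≤ colorCount r R d' :=
  Finset.card_le_card (Finset.filter_subset_filter _ (Finset.range_mono h))

lemma colorCount_enum {e : ℕ → ℕ} (he : StrictMono e) (heR : ∀ a, a % r ∈ R ↔ ∃ m, e m = a)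
    (m : ℕ) : colorCount r R (e m) = m := by
  have : (range (e m)).filter (fun a => a % r ∈ R) = (range m).image e := by
    ext a
    simp only [Finset.mem_filter, Finset.mem_range, Finset.mem_image, heR]
    constructor
    · rintro ⟨h, j, rfl⟩
      exact ⟨j, he.lt_iff_lt.1 h, rfl⟩
    · rintro ⟨j, h, rfl⟩
      exact ⟨he h, j, rfl⟩
  rw [colorCount, this, Finset.card_image_of_injective _ he.injective, card_range]

lemma exists_colorCount_eq (hr : ∀ c ∈ R, c < r) (hR : R.Nonempty) (m : ℕ) :
    ∃ d, d % r ∈ R ∧ colorCount r R d = m := by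
  obtain ⟨e, he, heR, -⟩ := exists_colorEnum hr hR
  exact ⟨e m, (heR _).2 ⟨m, rfl⟩, colorCount_enum he heR m⟩

/-- The color of `d` occurs `d / r` times below `d`, and the enumeration identifies this with the
count divided by `#R`. This is the origin of the terms `n - [n / r]` in canonical representations.
-/
lemma colorCount_erase (hr : ∀ c ∈ R, c < r) {d : ℕ} (hd : d % r ∈ R) :
    colorCount r (R.erase (d % r)) d = colorCount r R d - colorCount r R d / #R := by
  obtain ⟨e, he, heR, -, hdiv⟩ := exists_colorEnum hr ⟨_, hd⟩
  obtain ⟨m, rfl⟩ := (heR d).1 hd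
  rw [colorCount_enum he heR m, ← hdiv m]
  have hr0 : 0 < r := (Nat.zero_le _).trans_lt (hr _ hd)
  have h1 : (range (e m)).filter (fun a => a % r = e m % r) =
      (range (e m / r)).image fun j => e m % r + r * j := by
    ext a
    simp only [Finset.mem_filter, Finset.mem_range, Finset.mem_image]
    have h3 := Nat.div_add_mod (e m) r
    constructor
    · rintro ⟨h, h'⟩
      refine ⟨a / r, ?_, by rw [← h', Nat.mod_add_div]⟩
      by_contra! hc
      have h4 := Nat.mul_le_mul_left r hc
      have h5 := Nat.div_add_mod a r
      omega
    · rintro ⟨j, h, rfl⟩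
      have h4 : r * (j + 1) ≤ r * (e m / r) := Nat.mul_le_mul_left _ h
      rw [mul_add, mul_one] at h4
      exact ⟨by omega, by rw [Nat.add_mul_mod_self_left, Nat.mod_mod]⟩
  have h2 : #((range (e m)).filter (fun a => a % r = e m % r)) = e m / r := by
    rw [h1, Finset.card_image_of_injective, card_range]
    intro j j' h
    exact Nat.eq_of_mul_eq_mul_left hr0 (Nat.add_left_cancel h)
  have h3 := Finset.card_filter_add_card_filter_not (s := (range (e m)).filter (· % r ∈ R))
    (fun a => a % r = e m % r)
  rw [Finset.filter_filter, Finset.filter_filter] at h3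
  have h4 : (range (e m)).filter (fun a => a % r ∈ R ∧ a % r = e m % r) =
      (range (e m)).filter (fun a => a % r = e m % r) :=
    Finset.filter_congr fun a _ => ⟨And.right, fun h => ⟨h ▸ hd, h⟩⟩
  have h5 : (range (e m)).filter (fun a => a % r ∈ R ∧ ¬ a % r = e m % r) =
      (range (e m)).filter (fun a => a % r ∈ R.erase (e m % r)) :=
    Finset.filter_congr fun a _ => by rw [Finset.mem_erase, and_comm]
  have h6 := colorCount_enum he heR m
  unfold colorCount at h6 ⊢
  rw [h4, h2, h5, h6] at h3
  omega

open Classical in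
/-- The rainbow `k`-sets of numbers below `d`. -/
noncomputable def rainbowBelow (r : ℕ) (R : Finset ℕ) (k d : ℕ) : Finset (Finset ℕ) :=
  ((range d).powersetCard k).filter (IsRainbow r R k)

lemma mem_rainbowBelow {k d : ℕ} {A : Finset ℕ} :
    A ∈ rainbowBelow r R k d ↔ IsRainbow r R k A ∧ ∀ a ∈ A, a < d := by
  simp only [rainbowBelow, Finset.mem_filter, Finset.mem_powersetCard]
  constructor
  · rintro ⟨⟨h1, -⟩, h2⟩
    exact ⟨h2, fun a ha => Finset.mem_range.1 (h1 ha)⟩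
  · rintro ⟨h1, h2⟩
    exact ⟨⟨fun a ha => Finset.mem_range.2 (h2 a ha), h1.card⟩, h1⟩

lemma isInit_rainbowBelow {k d : ℕ} : IsInit r R k (rainbowBelow r R k d) := by
  refine ⟨fun A hA => (mem_rainbowBelow.1 hA).1, fun A hA B hB hle => ?_⟩
  refine mem_rainbowBelow.2 ⟨hB, fun b hb => ?_⟩
  by_contra! hc
  have h1 := colexVal_lt_two_pow (mem_rainbowBelow.1 hA).2
  have h2 := two_pow_le_colexVal hb
  have h3 : 2 ^ d ≤ 2 ^ b := Nat.pow_le_pow_right (by norm_num) hc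
  omega

/-- Under the increasing enumeration, having different colors is adjacency in the Turán graph, so
rainbow sets are cliques. -/
lemma card_rainbowBelow (hr : ∀ c ∈ R, c < r) (k d : ℕ) :
    #(rainbowBelow r R k d) = turanBinom (colorCount r R d) k #R := by
  set n := colorCount r R d with hn
  obtain ⟨e, hinj, hmem, hmod⟩ : ∃ e : Fin n → ℕ, Function.Injective e ∧
      (∀ a, (a < d ∧ a % r ∈ R) ↔ ∃ m, e m = a) ∧
      (∀ m m', e m % r = e m' % r ↔ (m : ℕ) % #R = m' % #R) := by
    rcases R.eq_empty_or_nonempty with rfl | hR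
    · have h0 : n = 0 := by simp [hn, colorCount]
      have : IsEmpty (Fin n) := by rw [h0]; infer_instance
      exact ⟨fun _ => 0, Function.injective_of_subsingleton _, by simp, by simp⟩
    · obtain ⟨e, he, heR, hmod, -⟩ := exists_colorEnum hr hR
      refine ⟨fun m => e m, fun m m' h => Fin.ext (he.injective h), fun a => ⟨?_, ?_⟩,
        fun m m' => hmod m m'⟩
      · rintro ⟨h1, h2⟩
        obtain ⟨m, rfl⟩ := (heR a).1 h2
        refine ⟨⟨m, ?_⟩, rfl⟩
        have h3 := colorCount_mono (r := r) (R := R) (Nat.succ_le_of_lt h1)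
        rw [← hn] at h3
        refine lt_of_lt_of_le ?_ h3
        rw [colorCount, Finset.range_add_one, Finset.filter_insert, if_pos h2,
          Finset.card_insert_of_notMem (by simp)]
        exact Nat.lt_succ_of_le (colorCount_enum he heR m).ge
      · rintro ⟨m, rfl⟩
        refine ⟨?_, (heR _).2 ⟨m, rfl⟩⟩
        by_contra! hc
        have h3 := colorCount_mono (r := r) (R := R) hc
        rw [colorCount_enum he heR, ← hn] at h3
        exact absurd m.2 (by omega)
  symm
  unfold turanBinom
  refine Finset.card_bij (fun s _ => s.map ⟨e, hinj⟩) ?_ ?_ ?_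
  · intro s hs
    rw [SimpleGraph.mem_cliqueFinset_iff, SimpleGraph.isNClique_iff] at hs
    refine mem_rainbowBelow.2 ⟨⟨by rw [Finset.card_map, hs.2], ?_, ?_⟩, ?_⟩
    · intro a ha
      obtain ⟨v, -, rfl⟩ := Finset.mem_map.1 ha
      exact ((hmem _).2 ⟨v, rfl⟩).2
    · intro a ha b hb hab
      obtain ⟨v, hv, rfl⟩ := Finset.mem_map.1 ha
      obtain ⟨w, hw, rfl⟩ := Finset.mem_map.1 hb
      by_contra hne
      have hvw : v ≠ w := fun h => hne (h ▸ rfl)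
      exact (SimpleGraph.turanGraph_adj.1 (hs.1 hv hw hvw)) ((hmod v w).1 hab)
    · intro a ha
      obtain ⟨v, -, rfl⟩ := Finset.mem_map.1 ha
      exact ((hmem _).2 ⟨v, rfl⟩).1
  · intro s _ t _ h
    exact Finset.map_injective _ h
  · intro A hA
    obtain ⟨h1, h2⟩ := mem_rainbowBelow.1 hA
    have hmap : (univ.filter fun v => e v ∈ A).map ⟨e, hinj⟩ = A := by
      ext a
      simp only [Finset.mem_map, Finset.mem_filter, Finset.mem_univ, true_and,
        Function.Embedding.coeFn_mk]
      constructor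
      · rintro ⟨v, hv, rfl⟩; exact hv
      · intro ha
        obtain ⟨v, rfl⟩ := (hmem a).1 ⟨h2 a ha, h1.mem a ha⟩
        exact ⟨v, ha, rfl⟩
    refine ⟨univ.filter fun v => e v ∈ A, ?_, hmap⟩
    rw [SimpleGraph.mem_cliqueFinset_iff, SimpleGraph.isNClique_iff]
    refine ⟨fun v hv w hw hvw => SimpleGraph.turanGraph_adj.2 fun h => hvw ?_, ?_⟩
    · exact hinj (h1.inj _ (by simpa using hv) _ (by simpa using hw) ((hmod v w).2 h))
    · rw [← h1.card, ← Finset.card_map ⟨e, hinj⟩, hmap]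

end Enumeration

/-! ### Cliques inside a vertex set -/

section Cliques

open Classical in
/-- The `k`-cliques of `G` with vertices in `U`. -/
noncomputable def cliquesIn (G : SimpleGraph ℕ) (U : Finset ℕ) (k : ℕ) : Finset (Finset ℕ) :=
  (U.powersetCard k).filter fun s => G.IsClique s

variable {G : SimpleGraph ℕ} {U U' s : Finset ℕ} {k : ℕ}

lemma mem_cliquesIn : s ∈ cliquesIn G U k ↔ (s ⊆ U ∧ #s = k) ∧ G.IsClique s := by
  simp [cliquesIn, Finset.mem_powersetCard]

lemma cliquesIn_mono (h : U ⊆ U') : cliquesIn G U k ⊆ cliquesIn G U' k := fun s hs => by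
  rw [mem_cliquesIn] at hs ⊢
  exact ⟨⟨hs.1.1.trans h, hs.1.2⟩, hs.2⟩

lemma cliquesIn_one : #(cliquesIn G U 1) = #U := by
  have : cliquesIn G U 1 = U.powersetCard 1 := by
    ext s
    rw [mem_cliquesIn, Finset.mem_powersetCard, and_iff_left_iff_imp]
    rintro ⟨-, hs⟩
    obtain ⟨a, rfl⟩ := Finset.card_eq_one.1 hs
    simp
  rw [this, Finset.card_powersetCard, Nat.choose_one_right]

lemma cliquesIn_eq_empty_of_le {j : ℕ} (h : cliquesIn G U j = ∅) (hjk : j ≤ k) :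
    cliquesIn G U k = ∅ := by
  refine Finset.eq_empty_of_forall_notMem fun s hs => ?_
  rw [mem_cliquesIn] at hs
  obtain ⟨t, hts, htc⟩ := Finset.exists_subset_card_eq (hs.1.2.symm ▸ hjk)
  have : t ∈ cliquesIn G U j := mem_cliquesIn.2 ⟨⟨hts.trans hs.1.1, htc⟩, hs.2.subset hts⟩
  rw [h] at this
  exact absurd this (Finset.notMem_empty _)

open Classical in
/-- The neighbors of `v` in `U`. -/
noncomputable def nbrs (G : SimpleGraph ℕ) (U : Finset ℕ) (v : ℕ) : Finset ℕ := U.filter (G.Adj v)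

lemma mem_nbrs {v a : ℕ} : a ∈ nbrs G U v ↔ a ∈ U ∧ G.Adj v a := by simp [nbrs]

lemma nbrs_mono (h : U ⊆ U') (v : ℕ) : nbrs G U v ⊆ nbrs G U' v := fun a ha => by
  rw [mem_nbrs] at ha ⊢
  exact ⟨h ha.1, ha.2⟩

lemma insert_mem_cliquesIn {v : ℕ} (hs : s ∈ cliquesIn G (nbrs G U v) k) (hv : v ∈ U')
    (hU : U ⊆ U') : insert v s ∈ cliquesIn G U' (k + 1) := by
  rw [mem_cliquesIn] at hs ⊢
  have hadj : ∀ a ∈ s, a ∈ U ∧ G.Adj v a := fun a ha => mem_nbrs.1 (hs.1.1 ha)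
  refine ⟨⟨Finset.insert_subset hv fun a ha => hU (hadj a ha).1, ?_⟩, ?_⟩
  · rw [Finset.card_insert_of_notMem (fun h => G.loopless.irrefl v (hadj v h).2), hs.1.2]
  · rw [Finset.coe_insert, SimpleGraph.isClique_insert]
    exact ⟨hs.2, fun a ha _ => (hadj a ha).2⟩

lemma cliquesIn_nbrs_eq_empty {v : ℕ} (hv : v ∈ U) (h : cliquesIn G U (k + 1) = ∅) :
    cliquesIn G (nbrs G U v) k = ∅ := by
  refine Finset.eq_empty_of_forall_notMem fun s hs => ?_
  have := insert_mem_cliquesIn hs hv subset_rfl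
  rw [h] at this
  exact absurd this (Finset.notMem_empty _)

lemma card_cliquesIn_insert {v : ℕ} (hv : v ∉ U) :
    #(cliquesIn G (insert v U) (k + 1)) =
      #(cliquesIn G U (k + 1)) + #(cliquesIn G (nbrs G U v) k) := by
  have hvn : ∀ s ∈ cliquesIn G (nbrs G U v) k, v ∉ s := fun s hs h =>
    hv (mem_nbrs.1 ((mem_cliquesIn.1 hs).1.1 h)).1
  have : cliquesIn G (insert v U) (k + 1) =
      cliquesIn G U (k + 1) ∪ (cliquesIn G (nbrs G U v) k).image (insert v) := by
    ext s
    rw [Finset.mem_union, Finset.mem_image]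
    constructor
    · intro hs
      rw [mem_cliquesIn] at hs
      by_cases hvs : v ∈ s
      · refine Or.inr ⟨s.erase v, mem_cliquesIn.2 ⟨⟨fun a ha => ?_, ?_⟩, ?_⟩,
          Finset.insert_erase hvs⟩
        · obtain ⟨h1, h2⟩ := Finset.mem_erase.1 ha
          exact mem_nbrs.2 ⟨(Finset.mem_insert.1 (hs.1.1 h2)).resolve_left h1,
            hs.2 hvs h2 (Ne.symm h1)⟩
        · rw [Finset.card_erase_of_mem hvs, hs.1.2]; rfl
        · exact hs.2.subset (Finset.erase_subset _ _)
      · refine Or.inl (mem_cliquesIn.2 ⟨⟨fun a ha => ?_, hs.1.2⟩, hs.2⟩)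
        exact (Finset.mem_insert.1 (hs.1.1 ha)).resolve_left fun h => hvs (h ▸ ha)
    · rintro (hs | ⟨t, ht, rfl⟩)
      · exact cliquesIn_mono (Finset.subset_insert _ _) hs
      · exact insert_mem_cliquesIn ht (Finset.mem_insert_self _ _) (Finset.subset_insert _ _)
  rw [this, Finset.card_union_of_disjoint, Finset.card_image_of_injOn]
  · intro s hs t ht e
    have := congrArg (fun S => Finset.erase S v) e
    simpa [Finset.erase_insert (hvn s hs), Finset.erase_insert (hvn t ht)] using this
  · rw [Finset.disjoint_left]
    intro s hs hs'
    obtain ⟨t, -, rfl⟩ := Finset.mem_image.1 hs'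
    exact hv ((mem_cliquesIn.1 hs).1.1 (Finset.mem_insert_self _ _))

/-- Counting cliques by adding vertices one at a time. -/
lemma exists_card_cliquesIn_union (G : SimpleGraph ℕ) (N W : Finset ℕ) (h : Disjoint N W) :
    ∃ L : ℕ → Finset ℕ, (∀ w ∈ W, L w ⊆ nbrs G (N ∪ W) w) ∧ ∀ k,
      #(cliquesIn G (N ∪ W) (k + 1)) =
        #(cliquesIn G N (k + 1)) + ∑ w ∈ W, #(cliquesIn G (L w) k) := by
  induction W using Finset.induction_on with
  | empty => exact ⟨fun _ => ∅, by simp, by simp⟩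
  | insert w W hw ih =>
    rw [Finset.disjoint_insert_right] at h
    obtain ⟨L, hL, hc⟩ := ih h.2
    have hwn : w ∉ N ∪ W := by simp [h.1, hw]
    have hsub : N ∪ W ⊆ N ∪ insert w W :=
      Finset.union_subset_union_right (Finset.subset_insert _ _)
    -- The new vertex `w` is recorded with its neighbors among the vertices present so far, so each
    -- clique is counted at its last vertex in `W`.
    refine ⟨Function.update L w (nbrs G (N ∪ W) w), fun v hv => ?_, fun k => ?_⟩
    · rcases eq_or_ne v w with rfl | hne
      · rw [Function.update_self]
        exact nbrs_mono hsub _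
      · rw [Function.update_of_ne hne]
        exact (hL v ((Finset.mem_insert.1 hv).resolve_left hne)).trans
          (nbrs_mono hsub _)
    · rw [Finset.union_insert, card_cliquesIn_insert hwn, hc, Finset.sum_insert hw,
        Function.update_self, add_assoc, add_comm (#(cliquesIn G (nbrs G (N ∪ W) w) k))]
      congr 2
      refine Finset.sum_congr rfl fun v hv => ?_
      rw [Function.update_of_ne (ne_of_mem_of_not_mem hv hw)]

lemma card_cliqueFinset_two {V : Type*} [Fintype V] [DecidableEq V] (H : SimpleGraph V)
    [DecidableRel H.Adj] : #(H.cliqueFinset 2) = #H.edgeFinset := by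
  symm
  refine Finset.card_bij (fun e _ => e.toFinset) ?_ ?_ ?_
  · intro e he
    induction e with | h a b =>
    have hab : H.Adj a b := by simpa using he
    rw [SimpleGraph.mem_cliqueFinset_iff, SimpleGraph.isNClique_iff]
    have : s(a, b).toFinset = {a, b} := by ext; simp
    rw [this]
    refine ⟨?_, Finset.card_pair hab.ne⟩
    rw [Finset.coe_pair, SimpleGraph.isClique_pair]
    exact fun _ => hab
  · intro e _ e' _ h
    refine Sym2.ext fun x => ?_
    rw [← Sym2.mem_toFinset, ← Sym2.mem_toFinset]
    exact ⟨fun h' => h ▸ h', fun h' => h ▸ h'⟩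
  · intro t ht
    rw [SimpleGraph.mem_cliqueFinset_iff, SimpleGraph.isNClique_iff] at ht
    obtain ⟨a, b, hab, rfl⟩ := Finset.card_eq_two.1 ht.2
    have hadj : H.Adj a b := ht.1 (by simp) (by simp) hab
    exact ⟨s(a, b), by simpa using hadj, by ext; simp⟩

lemma card_cliqueFinset_induce (G : SimpleGraph ℕ) (U : Finset ℕ) (k : ℕ)
    [DecidableRel (G.induce (U : Set ℕ)).Adj] :
    #((G.induce (U : Set ℕ)).cliqueFinset k) = #(cliquesIn G U k) := by
  refine Finset.card_bij (fun t _ => t.map (Function.Embedding.subtype _)) ?_ ?_ ?_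
  · intro t ht
    rw [SimpleGraph.mem_cliqueFinset_iff, SimpleGraph.isNClique_iff] at ht
    refine mem_cliquesIn.2 ⟨⟨fun a ha => ?_, by rw [Finset.card_map, ht.2]⟩, ?_⟩
    · obtain ⟨v, -, rfl⟩ := Finset.mem_map.1 ha
      exact v.2
    · intro a ha b hb hab
      obtain ⟨v, hv, rfl⟩ := Finset.mem_map.1 ha
      obtain ⟨w, hw, rfl⟩ := Finset.mem_map.1 hb
      exact ht.1 hv hw fun h => hab (h ▸ rfl)
  · exact fun s _ t _ h => Finset.map_injective _ h
  · intro s hs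
    rw [mem_cliquesIn] at hs
    have hmap : (s.subtype (· ∈ (U : Set ℕ))).map (Function.Embedding.subtype _) = s :=
      Finset.subtype_map_of_mem fun a ha => hs.1.1 ha
    refine ⟨s.subtype (· ∈ (U : Set ℕ)), ?_, hmap⟩
    rw [SimpleGraph.mem_cliqueFinset_iff, SimpleGraph.isNClique_iff]
    refine ⟨fun v hv w hw hvw => ?_, ?_⟩
    · exact hs.2 (by simpa using hv) (by simpa using hw) fun h => hvw (Subtype.ext h)
    · rw [← hs.1.2]
      conv_rhs => rw [← hmap]
      rw [Finset.card_map]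

/-- Turán's theorem for the induced subgraph, with edges read as 2-cliques. -/
lemma card_cliquesIn_two_le {ρ : ℕ} (hρ : 0 < ρ) (h : cliquesIn G U (ρ + 1) = ∅) :
    #(cliquesIn G U 2) ≤ turanBinom #U 2 ρ := by
  classical
  have hcard : Fintype.card (U : Set ℕ) = #U := by simp
  have hfree : (G.induce (U : Set ℕ)).CliqueFree (ρ + 1) := by
    rw [← SimpleGraph.cliqueFinset_eq_empty_iff, ← Finset.card_eq_zero,
      card_cliqueFinset_induce, h, Finset.card_empty]
  obtain ⟨H, _, maxH⟩ := SimpleGraph.exists_isTuranMaximal (V := (U : Set ℕ)) hρ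
  have h1 := maxH.2 hfree
  rw [((SimpleGraph.isTuranMaximal_iff_nonempty_iso_turanGraph hρ).mp maxH).some.card_edgeFinset_eq,
    ← card_cliqueFinset_two, ← card_cliqueFinset_two, card_cliqueFinset_induce] at h1
  rw [hcard] at h1
  unfold turanBinom
  convert h1

end Cliques

/-! ### Clique numbers and shadows of initial segments -/

variable {r K : ℕ} {R : Finset ℕ} {J : Finset (Finset ℕ)}

/-- The number of `K`-cliques of a graph without `(|R| + 1)`-cliques is at least the size of the
shadow of an initial segment with as many elements as there are `(K + 1)`-cliques. -/
def CliqueBound (r : ℕ) (R : Finset ℕ) (K : ℕ) : Prop :=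
  ∀ (G : SimpleGraph ℕ) (U : Finset ℕ), cliquesIn G U (#R + 1) = ∅ →
    ∀ J, IsInit r R (K + 1) J → #J ≤ #(cliquesIn G U (K + 1)) → #(∂ J) ≤ #(cliquesIn G U K)

lemma IsInit.eq_empty_of_card_lt (h : IsInit r R K J) (hK : #R < K) : J = ∅ :=
  Finset.eq_empty_of_forall_notMem fun A hA => by
    have := (h.rainbow A hA).le_card
    omega

/-- **Turán's theorem** in terms of shadows. -/
lemma cliqueBound_one (hr : ∀ c ∈ R, c < r) : CliqueBound r R 1 := by
  intro G U hU J hJ hc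
  rcases R.eq_empty_or_nonempty with rfl | hR
  · simp [hJ.eq_empty_of_card_lt (by simp)]
  obtain ⟨d, -, hd⟩ := exists_colorCount_eq hr hR #U
  have h1 := hc.trans (card_cliquesIn_two_le hR.card_pos hU)
  rw [← hd, ← card_rainbowBelow hr] at h1
  have h2 := hJ.subset_of_card_le isInit_rainbowBelow h1
  rw [cliquesIn_one, ← hd, colorCount]
  refine (Finset.card_le_card (t := ((range d).filter fun a => a % r ∈ R).image
    fun a => {a}) fun A hA => ?_).trans Finset.card_image_le
  have hA' := rainbow_shadow hJ.rainbow A hA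
  obtain ⟨a, rfl⟩ := Finset.card_eq_one.1 hA'.card
  refine Finset.mem_image.2 ⟨a, Finset.mem_filter.2 ⟨Finset.mem_range.2 ?_,
    hA'.mem a (Finset.mem_singleton_self a)⟩, rfl⟩
  obtain ⟨B, hB, b, hb, e⟩ := Finset.mem_shadow_iff.1 hA
  exact (mem_rainbowBelow.1 (h2 hB)).2 a (Finset.mem_of_mem_erase (e ▸ Finset.mem_singleton_self a))

/-- The pairs in `F` are edges of a graph whose cliques are rainbow, hence have at most `#R`
vertices. The shadow of `F` is the vertex set, which Turán's theorem bounds from below. -/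
lemma shadowBound_two (hr : ∀ c ∈ R, c < r) : ShadowBound r R 2 := by
  intro F hF J hJ hc
  let G : SimpleGraph ℕ := SimpleGraph.fromRel fun a b => {a, b} ∈ F
  set U := F.biUnion id with hU
  have hadj : ∀ a b, G.Adj a b → ({a, b} : Finset ℕ) ∈ F := fun a b h => by
    rcases h.2 with h | h
    · exact h
    · rwa [Finset.pair_comm]
  have hempty : cliquesIn G U (#R + 1) = ∅ := by
    refine Finset.eq_empty_of_forall_notMem fun s hs => ?_
    rw [mem_cliquesIn] at hs
    have : IsRainbow r R (#R + 1) s := by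
      refine ⟨hs.1.2, fun a ha => ?_, fun a ha b hb e => ?_⟩
      · obtain ⟨A, hA, haA⟩ := Finset.mem_biUnion.1 (hs.1.1 ha)
        exact (hF A hA).mem a haA
      · by_contra hne
        exact hne ((hF _ (hadj a b (hs.2 ha hb hne))).inj a (by simp) b (by simp) e)
    have := this.le_card
    omega
  have hle : #F ≤ #(cliquesIn G U 2) := by
    refine Finset.card_le_card fun A hA => mem_cliquesIn.2 ⟨⟨?_, (hF A hA).card⟩, ?_⟩
    · exact Finset.subset_biUnion_of_mem id hA
    · intro a ha b hb hab
      refine ⟨hab, Or.inl ?_⟩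
      have : ({a, b} : Finset ℕ) = A := Finset.eq_of_subset_of_card_le
        (Finset.insert_subset ha (Finset.singleton_subset_iff.2 hb))
        (by rw [(hF A hA).card, Finset.card_pair hab])
      rwa [← this] at hA
  refine (cliqueBound_one hr G U hempty J hJ (hc.trans hle)).trans ?_
  rw [cliquesIn_one, ← Finset.card_image_of_injective U (Finset.singleton_injective)]
  refine Finset.card_le_card fun A hA => ?_
  obtain ⟨a, ha, rfl⟩ := Finset.mem_image.1 hA
  obtain ⟨B, hB, haB⟩ := Finset.mem_biUnion.1 ha
  refine Finset.mem_shadow_iff_exists_mem_card_add_one.2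
    ⟨B, hB, Finset.singleton_subset_iff.2 haB, ?_⟩
  rw [(hF B hB).card, Finset.card_singleton]

/-- The colored Kruskal–Katona theorem of Frankl, Füredi and Kalai. -/
theorem shadowBound (hr : ∀ c ∈ R, c < r) (K : ℕ) : ShadowBound r R (K + 2) :=
  shadowBound_of_two (fun _ h => shadowBound_two h) K R hr

/-- If there are too few colors for rainbow sets of size `K + 1`, there are no cliques of that size
either. -/
lemma exists_isInit_cliques (hr : ∀ c ∈ R, c < r) (G : SimpleGraph ℕ) (U : Finset ℕ)
    (h : cliquesIn G U (#R + 1) = ∅) (K : ℕ) :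
    ∃ J, IsInit r R (K + 1) J ∧ #J = #(cliquesIn G U (K + 1)) := by
  by_cases hK : K + 1 ≤ #R
  · exact exists_isInit_card hr hK _
  · exact ⟨∅, isInit_empty, by rw [cliquesIn_eq_empty_of_le h (by omega)]⟩

/-- Frohmader's theorem for a single pair of consecutive clique numbers. -/
theorem cliqueBound (K : ℕ) (R : Finset ℕ) (hr : ∀ c ∈ R, c < r) : CliqueBound r R (K + 1) := by
  induction hn : #R using Nat.strong_induction_on generalizing K R with
  | _ n ih =>
    subst hn
    obtain _ | K := K
    · exact cliqueBound_one hr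
    intro G U hU J hJ hc
    rcases R.eq_empty_or_nonempty with rfl | ⟨i, hi⟩
    · simp [hJ.eq_empty_of_card_lt (by simp)]
    rcases U.eq_empty_or_nonempty with rfl | hUne
    · have : cliquesIn G ∅ (K + 1 + 1 + 1) = ∅ := by
        refine Finset.eq_empty_of_forall_notMem fun s hs => ?_
        have h1 := (mem_cliquesIn.1 hs).1
        have h2 := Finset.card_le_card h1.1
        rw [h1.2, Finset.card_empty] at h2
        omega
      rw [this, Finset.card_empty, Nat.le_zero, Finset.card_eq_zero] at hc
      simp [hc]
    have hr' : ∀ c ∈ R.erase i, c < r := fun c hc => hr c (Finset.mem_of_mem_erase hc)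
    have hRc : #(R.erase i) + 1 = #R := Finset.card_erase_add_one hi
    have hlt := Finset.card_erase_lt_of_mem hi
    -- The choice of `v₀` guarantees that no `L w` below has more `(K + 2)`-cliques than `N`.
    obtain ⟨v₀, hv₀, hmax⟩ := Finset.exists_max_image U
      (fun v => #(cliquesIn G (nbrs G U v) (K + 2))) hUne
    set N := nbrs G U v₀ with hN
    set W := U \ N with hW
    have hNU : N ⊆ U := fun a ha => (mem_nbrs.1 ha).1
    have hNW : N ∪ W = U := Finset.union_sdiff_of_subset hNU
    have hNe : cliquesIn G N (#(R.erase i) + 1) = ∅ := by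
      rw [hRc]; exact cliquesIn_nbrs_eq_empty hv₀ hU
    obtain ⟨L, hL, hcount⟩ := exists_card_cliquesIn_union G N W Finset.disjoint_sdiff
    rw [hNW] at hL hcount
    have hWU : W ⊆ U := Finset.sdiff_subset
    have hLe : ∀ w ∈ W, cliquesIn G (L w) (#(R.erase i) + 1) = ∅ := fun w hw => by
      rw [hRc]
      have h1 := cliquesIn_nbrs_eq_empty (hWU hw) hU
      have h2 := cliquesIn_mono (G := G) (k := #R) (hL w hw)
      rw [h1] at h2
      exact Finset.subset_empty.1 h2
    obtain ⟨J₀, hJ₀, hc₀⟩ := exists_isInit_cliques hr' G N hNe (K + 2)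
    have hex : ∀ w, ∃ J', w ∈ W → IsInit r (R.erase i) (K + 2) J' ∧
        #J' = #(cliquesIn G (L w) (K + 2)) := fun w => by
      by_cases hw : w ∈ W
      · obtain ⟨J', hJ'⟩ := exists_isInit_cliques hr' G (L w) (hLe w hw) (K + 1)
        exact ⟨J', fun _ => hJ'⟩
      · exact ⟨∅, fun h => absurd h hw⟩
    choose J' hJ' using hex
    -- The vertices outside `N` are encoded as distinct numbers of the color `i`, which the initial
    -- segments `J₀` and `J' w` avoid.
    let g : ℕ → ℕ := fun w => i + r * w
    have hr0 : 0 < r := (Nat.zero_le _).trans_lt (hr i hi)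
    have hg : Set.InjOn g W := fun a _ b _ e =>
      Nat.eq_of_mul_eq_mul_left hr0 (Nat.add_left_cancel e)
    have hgi : ∀ w ∈ W, g w % r = i := fun w _ => by
      rw [Nat.add_mul_mod_self_left, Nat.mod_eq_of_lt (hr i hi)]
    have b0 := avoidsColor_of_erase hJ₀.rainbow
    have bw := fun w hw => avoidsColor_of_erase (hJ' w hw).1.rainbow
    have hcard : #(assemble J₀ W g J') = #(cliquesIn G U (K + 2 + 1)) := by
      rw [card_assemble b0 bw hg hgi, hcount, hc₀]
      congr 1
      exact Finset.sum_congr rfl fun w hw => (hJ' w hw).2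
    have h1 := shadowBound hr (K + 1) _
      (rainbow_assemble hi hJ₀.rainbow (fun w hw => (hJ' w hw).1.rainbow) hgi) J hJ
      (hc.trans hcard.ge)
    refine h1.trans ?_
    rw [card_shadow_assemble b0 bw hg hgi, hcount]
    refine Nat.add_le_add ?_ (Finset.sum_le_sum fun w hw => ?_)
    -- All the initial segments in the union are bounded by the `(K + 2)`-cliques of `N`: the shadow
    -- of `J₀` by induction, each `J' w` by the choice of `v₀`.
    · refine card_union_biUnion_le (hJ₀.shadow hr') (fun w hw => (hJ' w hw).1) ?_ fun w hw => ?_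
      · exact ih _ hlt (K + 1) _ hr' rfl G N hNe J₀ hJ₀ hc₀.le
      · rw [(hJ' w hw).2]
        exact (Finset.card_le_card (cliquesIn_mono (hL w hw))).trans (hmax w (hWU hw))
    · exact ih _ hlt K _ hr' rfl G (L w) (hLe w hw) _ (hJ' w hw).1 (hJ' w hw).2.le

/-! ### Canonical representations -/

variable {r K k m p : ℕ} {R A : Finset ℕ} {J : Finset (Finset ℕ)}

lemma IsInit.isInit_sectionAt (h : IsInit r R (K + 1) J) {d : ℕ} (hd : d % r ∈ R) :
    IsInit r (R.erase (d % r)) K (sectionAt J d) := by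
  refine ⟨rainbow_sectionAt h.rainbow rfl, fun B hB C hC hle => ?_⟩
  obtain ⟨h1, h2⟩ := mem_sectionAt.1 hB
  have hcol : ∀ c ∈ C, c % r ≠ d % r := fun c hc => Finset.ne_of_mem_erase (hC.mem c hc)
  have hdC : d ∉ C := fun h' => hcol d h' rfl
  refine mem_sectionAt.2 ⟨hdC, h.down _ h2 _ ?_ ?_⟩
  · exact (hC.mono (Finset.erase_subset _ _)).insert hd hcol
  · rw [colexVal_insert h1, colexVal_insert hdC]
    omega

lemma card_sectionAt (J : Finset (Finset ℕ)) (d : ℕ) :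
    #(sectionAt J d) = #(J.filter fun A => d ∈ A) := by
  refine Finset.card_image_of_injOn fun A hA B hB e => ?_
  have hA := (Finset.mem_filter.1 hA).2
  have hB := (Finset.mem_filter.1 hB).2
  have e : A.erase d = B.erase d := e
  rw [← Finset.insert_erase hA, ← Finset.insert_erase hB, e]

lemma IsInit.card_le_of_bounded (h : IsInit r R K J) {d : ℕ} (hd : ∀ A ∈ J, ∀ a ∈ A, a ≤ d) :
    #J ≤ #(rainbowBelow r R K d) + #(sectionAt J d) := by
  rw [card_sectionAt, ← Finset.card_filter_add_card_filter_not (s := J) (fun A => d ∈ A), add_comm]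
  refine Nat.add_le_add_right (Finset.card_le_card fun A hA => ?_) _
  obtain ⟨h1, h2⟩ := Finset.mem_filter.1 hA
  exact mem_rainbowBelow.2 ⟨h.rainbow A h1, fun a ha => lt_of_le_of_ne (hd A h1 a ha) fun e =>
    h2 (e ▸ ha)⟩

lemma IsInit.le_card_of_mem (h : IsInit r R K J) {d : ℕ} (hA : A ∈ J) (hd : d ∈ A) :
    #(rainbowBelow r R K d) + #(sectionAt J d) ≤ #J := by
  rw [card_sectionAt, ← Finset.card_union_of_disjoint]
  · refine Finset.card_le_card (Finset.union_subset (fun B hB => ?_) (Finset.filter_subset _ _))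
    obtain ⟨h1, h2⟩ := mem_rainbowBelow.1 hB
    exact h.down A hA B h1 ((colexVal_lt_two_pow h2).le.trans (two_pow_le_colexVal hd))
  · rw [Finset.disjoint_left]
    intro B hB hB'
    exact lt_irrefl _ ((mem_rainbowBelow.1 hB).2 d (Finset.mem_filter.1 hB').2)

/-- At most `p` rainbow `(k + 1)`-sets precede `A`, and at least `m` rainbow `k`-sets precede
`A` without its minimum. -/
structure IsWitness (r : ℕ) (R : Finset ℕ) (k m p : ℕ) (A : Finset ℕ) : Prop where
  rainbow : IsRainbow r R (k + 1) A
  mem : ∀ J, IsInit r R (k + 1) J → p < #J → A ∈ J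
  lt_card : ∀ a ∈ A, (∀ b ∈ A, a ≤ b) → ∀ J, IsInit r R k J → A.erase a ∈ J → m < #J

/-- Sets preceding `insert d A` either lie below `d` or contain `d`. The former are counted by
`rainbowBelow`, the latter by the link of `d`, an initial segment with one color fewer. -/
lemma IsWitness.insert {d : ℕ} (hd : d % r ∈ R) (h : IsWitness r (R.erase (d % r)) k m p A)
    (hA : ∀ a ∈ A, a < d) : IsWitness r R (k + 1) (#(rainbowBelow r R (k + 1) d) + m)
      (#(rainbowBelow r R (k + 1 + 1) d) + p) (insert d A) := by
  have hcol : ∀ a ∈ A, a % r ≠ d % r := fun a ha => Finset.ne_of_mem_erase (h.rainbow.mem a ha)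
  have hdA : d ∉ A := fun h' => lt_irrefl _ (hA d h')
  have hrb : IsRainbow r R (k + 2) (Insert.insert d A) :=
    (h.rainbow.mono (Finset.erase_subset _ _)).insert hd hcol
  refine ⟨hrb, fun J hJ hp => ?_, fun a ha hmin J hJ hmem => ?_⟩
  · by_contra hAJ
    have hlt : ∀ C ∈ J, colexVal C < colexVal (Insert.insert d A) := fun C hC => by
      by_contra! hc
      exact hAJ (hJ.down C hC _ hrb hc)
    have hbd : ∀ C ∈ J, ∀ c ∈ C, c ≤ d := fun C hC c hc => by
      by_contra! hdc
      have h1 := hlt C hC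
      have h2 := two_pow_le_colexVal hc
      have h3 : colexVal (Insert.insert d A) < 2 ^ (d + 1) := colexVal_lt_two_pow fun a ha => by
        rcases Finset.mem_insert.1 ha with rfl | ha
        · omega
        · have := hA a ha; omega
      have h4 : 2 ^ (d + 1) ≤ 2 ^ c := Nat.pow_le_pow_right (by norm_num) hdc
      omega
    have h1 := hJ.card_le_of_bounded hbd
    have h2 := h.mem _ (hJ.isInit_sectionAt hd) (by omega)
    exact hAJ (mem_sectionAt.1 h2).2
  · obtain ⟨b, hb⟩ : A.Nonempty := by
      rw [← Finset.card_pos, h.rainbow.card]; omega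
    have had : a ≠ d := by
      rintro rfl
      have h1 := hmin b (Finset.mem_insert_of_mem hb)
      have h2 := hA b hb
      omega
    have haA : a ∈ A := (Finset.mem_insert.1 ha).resolve_left had
    rw [Finset.erase_insert_of_ne had.symm] at hmem
    have h1 := hJ.le_card_of_mem hmem (Finset.mem_insert_self _ _)
    have h2 := h.lt_card a haA (fun b hb => hmin b (Finset.mem_insert_of_mem hb)) _
      (hJ.isInit_sectionAt hd) (mem_sectionAt.2 ⟨fun h' => hdA (Finset.mem_of_mem_erase h'), hmem⟩)
    omega

/-- The first rainbow set. -/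
lemma exists_isWitness_zero (hr : ∀ c ∈ R, c < r) (hk : k + 1 < #R) {d : ℕ} (hd : d % r ∈ R)
    (hdk : k + 1 ≤ colorCount r R d) :
    ∃ A, IsWitness r (R.erase (d % r)) k 0 0 A ∧ ∀ a ∈ A, a < d := by
  -- Some rainbow set lies below `d`, hence so does the first one. If `r ≤ d`, all colors have
  -- representatives below `d`; otherwise numbers below `d` are their own residues and differ from
  -- the color of `d`.
  obtain ⟨S, hS, hSc⟩ : ∃ S : Finset ℕ, (∀ a ∈ S, a ∈ R.erase (d % r) ∧ a < d) ∧ #S = k + 1 := by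
    by_cases hrd : r ≤ d
    · obtain ⟨S, hS, hSc⟩ := Finset.exists_subset_card_eq
        (show k + 1 ≤ #(R.erase (d % r)) by rw [Finset.card_erase_of_mem hd]; omega)
      exact ⟨S, fun a ha => ⟨hS ha, (hr a (Finset.mem_of_mem_erase (hS ha))).trans_le hrd⟩, hSc⟩
    · obtain ⟨S, hS, hSc⟩ := Finset.exists_subset_card_eq hdk
      refine ⟨S, fun a ha => ?_, hSc⟩
      obtain ⟨h1, h2⟩ := Finset.mem_filter.1 (hS ha)
      have h1 := Finset.mem_range.1 h1
      rw [Nat.mod_eq_of_lt (by omega)] at h2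
      rw [Nat.mod_eq_of_lt (by omega)]
      exact ⟨Finset.mem_erase.2 ⟨by omega, h2⟩, h1⟩
  have hSr : ∀ a ∈ S, a % r = a := fun a ha =>
    Nat.mod_eq_of_lt (hr a (Finset.mem_of_mem_erase (hS a ha).1))
  have hSrb : IsRainbow r (R.erase (d % r)) (k + 1) S :=
    ⟨hSc, fun a ha => by rw [hSr a ha]; exact (hS a ha).1, fun a ha b hb e => by
      rwa [hSr a ha, hSr b hb] at e⟩
  obtain ⟨A, hA, hmin⟩ := exists_minimal_nat (IsRainbow r (R.erase (d % r)) (k + 1)) colexVal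
    ⟨S, hSrb⟩
  refine ⟨A, ⟨hA, fun J hJ h0 => ?_, fun a _ _ J _ hmem => Finset.card_pos.2 ⟨_, hmem⟩⟩,
    fun a ha => ?_⟩
  · obtain ⟨C, hC⟩ := Finset.card_pos.1 h0
    exact hJ.down C hC A hA (hmin C (hJ.rainbow C hC))
  · by_contra! hc
    have h1 := two_pow_le_colexVal ha
    have h2 := hmin S hSrb
    have h3 := colexVal_lt_two_pow fun a ha => (hS a ha).2
    have h4 : 2 ^ d ≤ 2 ^ a := Nat.pow_le_pow_right (by norm_num) hc
    omega

/-- Each term of the representation fixes one element: `d` has exactly `N k` numbers of allowed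
color below it. After its color is deleted, `N k - N k / #R` of them remain, so the gap condition
says that the next element is smaller. The last element is completed by the first rainbow set in the
remaining colors. -/
lemma exists_isWitness (N : ℕ → ℕ) (s : ℕ) : ∀ (k : ℕ) (R : Finset ℕ), (∀ c ∈ R, c < r) →
    s < k → k < #R → (∀ i < s, N (k - i - 1) < N (k - i) - N (k - i) / (#R - i)) →
    k - s ≤ N (k - s) →
    ∃ d A, d % r ∈ R ∧ colorCount r R d = N k ∧ (∀ a ∈ A, a ≤ d) ∧
      IsWitness r R k (∑ i ∈ range (s + 1), turanBinom (N (k - i)) (k - i) (#R - i))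
        (∑ i ∈ range (s + 1), turanBinom (N (k - i)) (k - i + 1) (#R - i)) A := by
  induction s with
  | zero =>
    intro k R hr hk hkR _ hlast
    obtain ⟨k, rfl⟩ : ∃ j, k = j + 1 := ⟨k - 1, by omega⟩
    obtain ⟨d, hdR, hd⟩ := exists_colorCount_eq hr (Finset.card_pos.1 (by omega)) (N (k + 1))
    obtain ⟨A, hA, hAd⟩ := exists_isWitness_zero hr hkR hdR (by rw [hd]; exact hlast)
    have := hA.insert hdR hAd
    simp only [card_rainbowBelow hr, hd, add_zero] at this
    refine ⟨d, _, hdR, hd, fun a ha => ?_, by simpa using this⟩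
    rcases Finset.mem_insert.1 ha with rfl | ha
    · exact le_rfl
    · exact (hAd a ha).le
  | succ s ih =>
    intro k R hr hk hkR hgap hlast
    obtain ⟨k, rfl⟩ : ∃ j, k = j + 1 := ⟨k - 1, by omega⟩
    obtain ⟨d, hdR, hd⟩ := exists_colorCount_eq hr (Finset.card_pos.1 (by omega)) (N (k + 1))
    have hRc : #(R.erase (d % r)) = #R - 1 := Finset.card_erase_of_mem hdR
    have hsub : ∀ i, #R - 1 - i = #R - (i + 1) := fun i => by omega
    obtain ⟨d', A, hdR', hd', hAd', hA⟩ := ih k (R.erase (d % r))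
      (fun c hc => hr c (Finset.mem_of_mem_erase hc)) (by omega) (by omega) (fun i hi => by
        have := hgap (i + 1) (by omega)
        rw [Nat.add_sub_add_right] at this
        rwa [hRc, hsub]) (by rwa [Nat.add_sub_add_right] at hlast)
    have hlt : d' < d := by
      by_contra! hc
      have h1 := colorCount_mono (r := r) (R := R.erase (d % r)) hc
      rw [colorCount_erase hr hdR, hd, hd'] at h1
      have h2 := hgap 0 (by omega)
      simp only [Nat.sub_zero, Nat.add_sub_cancel] at h2
      omega
    have := hA.insert hdR fun a ha => (hAd' a ha).trans_lt hlt
    simp only [card_rainbowBelow hr, hd, hRc, hsub] at this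
    refine ⟨d, insert d A, hdR, hd, fun a ha => ?_, ?_⟩
    · rcases Finset.mem_insert.1 ha with rfl | ha
      · exact le_rfl
      · exact ((hAd' a ha).trans_lt hlt).le
    · rw [Finset.sum_range_succ', Finset.sum_range_succ' _ (s + 1)]
      simp only [Nat.add_sub_add_right, Nat.sub_zero]
      convert this using 1 <;> exact add_comm _ _

/-- With more cliques, an initial segment of that size would contain the witness `A`. Its shadow
would contain `A` without its minimum and hence exceed the number of `k`-cliques, against
`cliqueBound`. -/
lemma card_cliquesIn_succ_le {G : SimpleGraph ℕ} {U : Finset ℕ} {s : ℕ} {N : ℕ → ℕ}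
    (hU : cliquesIn G U (r + 1) = ∅) (hk : k < r)
    (h : IsCanonicalRep #(cliquesIn G U k) k r s N) :
    #(cliquesIn G U (k + 1)) ≤
      ∑ i ∈ range (s + 1), turanBinom (N (k - i)) (k - i + 1) (r - i) := by
  have hr : ∀ c ∈ range r, c < r := fun c hc => Finset.mem_range.1 hc
  obtain ⟨d, A, -, -, -, hA⟩ := exists_isWitness N s k (range r) hr h.lt (by rwa [card_range])
    (by rw [card_range]; exact h.gap) h.last
  rw [card_range, ← h.eq] at hA
  by_contra! hc
  rw [← card_range r] at hU
  obtain ⟨J, hJ, hJc⟩ := exists_isInit_cliques hr G U hU k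
  obtain ⟨k', rfl⟩ : ∃ j, k = j + 1 := ⟨k - 1, by have := h.lt; omega⟩
  have h1 := hA.mem J hJ (by rwa [hJc])
  obtain ⟨a, ha, hmin⟩ := Finset.exists_min_image A id (by
    rw [← Finset.card_pos, hA.rainbow.card]; omega)
  have h2 := hA.lt_card a ha hmin _ (hJ.shadow hr) (Finset.erase_mem_shadow h1 ha)
  have h3 := cliqueBound k' _ hr G U hU J hJ hJc.le
  omega

/-! ### Existence of canonical representations -/

section Existence

variable {ν ρ : ℕ}

lemma colorCount_range (hρ : 0 < ρ) (d : ℕ) : colorCount ρ (range ρ) d = d := by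
  rw [colorCount, Finset.filter_true_of_mem, card_range]
  exact fun a _ => Finset.mem_range.2 (Nat.mod_lt _ hρ)

lemma turanBinom_eq (hρ : 0 < ρ) : turanBinom ν k ρ = #(rainbowBelow ρ (range ρ) k ν) := by
  rw [card_rainbowBelow (fun c hc => Finset.mem_range.1 hc), colorCount_range hρ, card_range]

/-- Cliques through the last vertex `ν` lie in its link, where the color of `ν` is absent and `ν - ν
/ ρ` vertices remain. -/
lemma turanBinom_succ_le (hρ : 0 < ρ) : turanBinom (ν + 1) (k + 1) ρ ≤
    turanBinom ν (k + 1) ρ + turanBinom (ν - ν / ρ) k (ρ - 1) := by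
  have hr : ∀ c ∈ range ρ, c < ρ := fun c hc => Finset.mem_range.1 hc
  have hν : ν % ρ ∈ range ρ := Finset.mem_range.2 (Nat.mod_lt _ hρ)
  have h1 := (isInit_rainbowBelow (r := ρ) (R := range ρ) (k := k + 1)
    (d := ν + 1)).card_le_of_bounded (d := ν) fun A hA a ha =>
      Nat.lt_succ_iff.1 ((mem_rainbowBelow.1 hA).2 a ha)
  rw [turanBinom_eq hρ, turanBinom_eq hρ]
  refine h1.trans (Nat.add_le_add_left ?_ _)
  have h2 := card_rainbowBelow (R := (range ρ).erase (ν % ρ))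
    (fun c hc => hr c (Finset.mem_of_mem_erase hc)) k ν
  rw [colorCount_erase hr hν, colorCount_range hρ, Finset.card_erase_of_mem hν, card_range] at h2
  rw [← h2]
  refine Finset.card_le_card fun C hC => mem_rainbowBelow.2
    ⟨rainbow_sectionAt isInit_rainbowBelow.rainbow rfl C hC, fun c hc => ?_⟩
  obtain ⟨h3, h4⟩ := mem_sectionAt.1 hC
  have h5 := (mem_rainbowBelow.1 h4).2 c (Finset.mem_insert_of_mem hc)
  have : c ≠ ν := fun e => h3 (e ▸ hc)
  omega

lemma turanBinom_mono {ν' : ℕ} (hρ : 0 < ρ) (h : ν ≤ ν') :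
    turanBinom ν k ρ ≤ turanBinom ν' k ρ := by
  rw [turanBinom_eq hρ, turanBinom_eq hρ]
  refine Finset.card_le_card fun A hA => ?_
  obtain ⟨h1, h2⟩ := mem_rainbowBelow.1 hA
  exact mem_rainbowBelow.2 ⟨h1, fun a ha => (h2 a ha).trans_le h⟩

lemma turanBinom_le_choose : turanBinom ν k ρ ≤ ν.choose k := by
  unfold turanBinom
  exact (SimpleGraph.card_cliqueFinset_le).trans_eq (by rw [Fintype.card_fin])

lemma exists_lt_turanBinom (hk : k + 1 ≤ ρ) (m : ℕ) : ∃ ν, m < turanBinom ν (k + 1) ρ := by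
  have hr : ∀ c ∈ range ρ, c < ρ := fun c hc => Finset.mem_range.1 hc
  obtain ⟨J, hJ, hJc⟩ := exists_isInit_card hr (by rwa [card_range]) (K := k) (m + 1)
  refine ⟨J.sup (fun A => A.sup id) + 1, ?_⟩
  rw [turanBinom_eq (by omega), ← Nat.succ_le_iff, ← Nat.succ_eq_add_one, ← Nat.succ_eq_add_one,
    Nat.succ_eq_add_one m, ← hJc]
  refine Finset.card_le_card fun A hA => mem_rainbowBelow.2 ⟨hJ.rainbow A hA, fun a ha => ?_⟩
  exact Nat.lt_succ_of_le ((Finset.le_sup (f := id) ha).trans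
    (Finset.le_sup (f := fun A : Finset ℕ => A.sup id) hA))

/-- Every positive number has a canonical representation. -/
theorem exists_isCanonicalRep (k : ℕ) : ∀ m ρ : ℕ, 0 < m → k + 1 ≤ ρ →
    ∃ s N, IsCanonicalRep m (k + 1) ρ s N := by
  induction k with
  | zero =>
    intro m ρ hm hρ
    have h1 : ∀ ν, turanBinom ν 1 ρ = ν := fun ν => by
      refine le_antisymm (turanBinom_le_choose.trans_eq (Nat.choose_one_right ν)) ?_
      rw [turanBinom_eq (by omega)]
      conv_lhs => rw [← card_range ν, ← Finset.card_image_of_injective _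
        (Finset.singleton_injective)]
      refine Finset.card_le_card fun A hA => ?_
      obtain ⟨a, ha, rfl⟩ := Finset.mem_image.1 hA
      exact mem_rainbowBelow.2 ⟨⟨Finset.card_singleton _, by
        simpa using Nat.mod_lt a (show ρ > 0 by omega), by simp⟩, by simpa using ha⟩
    exact ⟨0, fun _ => m, ⟨by omega, by simp, by simpa using Nat.succ_le_of_lt hm, by simp [h1]⟩⟩
  | succ k ih =>
    intro m ρ hm hρ
    have hρ0 : 0 < ρ := by omega
    classical
    -- Greedy choice: `ν` is the largest number whose clique count is at most `m`, and the remainder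
    -- is represented with one color fewer.
    have hex := exists_lt_turanBinom (k := k + 1) hρ m
    obtain ⟨ν, hν⟩ : ∃ ν, Nat.find hex = ν + 1 := by
      refine ⟨Nat.find hex - 1, ?_⟩
      have : Nat.find hex ≠ 0 := fun h => by
        have h1 := Nat.find_spec hex
        rw [h] at h1
        have h2 := turanBinom_le_choose (ν := 0) (k := k + 1 + 1) (ρ := ρ)
        rw [Nat.choose_zero_succ] at h2
        omega
      omega
    have hlt := Nat.find_spec hex
    rw [hν] at hlt
    have hle : turanBinom ν (k + 1 + 1) ρ ≤ m :=
      not_lt.1 (Nat.find_min hex (by rw [hν]; omega))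
    have hkν : k + 1 + 1 ≤ ν := by
      by_contra! hc
      have h1 := turanBinom_le_choose (ν := ν + 1) (k := k + 1 + 1) (ρ := ρ)
      have h2 : (ν + 1).choose (k + 1 + 1) ≤ (k + 1 + 1).choose (k + 1 + 1) :=
        Nat.choose_le_choose _ (by omega)
      rw [Nat.choose_self] at h2
      omega
    have hrec := turanBinom_succ_le (ν := ν) (k := k + 1) hρ0
    rcases hle.eq_or_lt with heq | hlt'
    · exact ⟨0, fun _ => ν, ⟨by omega, by simp, by simpa using hkν, by simp [heq]⟩⟩
    · obtain ⟨s, N, hN⟩ := ih (m - turanBinom ν (k + 1 + 1) ρ) (ρ - 1) (by omega) (by omega)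
      have hsk := hN.lt
      have hupd : ∀ i, Function.update N (k + 1 + 1) ν (k + 1 - i) = N (k + 1 - i) := fun i =>
        Function.update_of_ne (by omega) _ _
      have hsub : ∀ i, ρ - 1 - i = ρ - (i + 1) := fun i => by omega
      refine ⟨s + 1, Function.update N (k + 1 + 1) ν, ⟨by omega, fun i hi => ?_, ?_, ?_⟩⟩
      · obtain _ | i := i
        · have h1 : k + 1 + 1 - 0 - 1 = k + 1 - 0 := by omega
          rw [h1, hupd, Nat.sub_zero, Nat.sub_zero, Nat.sub_zero, Function.update_self]
          -- If the gap failed, the remainder would be at least the number of cliques through the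
          -- next vertex, so `ν + 1` would still have been admissible.
          by_contra! hc
          have h2 := turanBinom_mono (k := k + 1) (show 0 < ρ - 1 by omega) hc
          have h3 := hN.eq
          rw [Finset.sum_range_succ'] at h3
          simp only [Nat.sub_zero] at h3
          omega
        · have h1 : k + 1 + 1 - (i + 1) = k + 1 - i := by omega
          have h2 : k + 1 - i - 1 = k + 1 - (i + 1) := by omega
          have h3 := hN.gap i (by omega)
          rw [h2] at h3
          rwa [h1, h2, hupd, hupd, ← hsub]
      · rw [Nat.add_sub_add_right, hupd]
        exact hN.last
      · rw [Finset.sum_range_succ']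
        simp only [Nat.add_sub_add_right, hupd, Nat.sub_zero, Function.update_self]
        have h1 := hN.eq
        simp only [hsub] at h1
        omega

end Existence

/-- The Frankl–Füredi–Kalai inequalities for the clique numbers of a graph without
`(r + 1)`-cliques. -/
theorem card_cliquesIn_succ_le_turanPower {G : SimpleGraph ℕ} {U : Finset ℕ}
    (hU : cliquesIn G U (r + 1) = ∅) (hk : 1 ≤ k) (hkr : k < r) :
    #(cliquesIn G U (k + 1)) ≤ turanPower #(cliquesIn G U k) k r := by
  rcases Nat.eq_zero_or_pos #(cliquesIn G U k) with h0 | hpos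
  · rw [cliquesIn_eq_empty_of_le (Finset.card_eq_zero.1 h0) (Nat.le_succ k), Finset.card_empty]
    exact Nat.zero_le _
  · obtain ⟨k, rfl⟩ : ∃ j, k = j + 1 := ⟨k - 1, by omega⟩
    obtain ⟨s, N, h⟩ := exists_isCanonicalRep k _ r hpos hkr.le
    have hex : ∃ p : ℕ × (ℕ → ℕ), IsCanonicalRep #(cliquesIn G U (k + 1)) (k + 1) r p.1 p.2 :=
      ⟨(s, N), h⟩
    -- The inequality holds for every canonical representation, so it does not matter which one
    -- `choose` picks.
    rw [turanPower, dif_pos hex]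
    exact card_cliquesIn_succ_le hU hkr hex.choose_spec

/-! ### Realizing γ-vectors by graphs -/

section Sums

variable {D : Finset (Finset ℕ)} {G : SimpleGraph ℕ} {U T σ τ : Finset ℕ} {x : ℚ}

/-- The weighted number of sets in `D` that contain `σ`. -/
def upSum (D : Finset (Finset ℕ)) (σ : Finset ℕ) (x : ℚ) : ℚ := ∑ τ ∈ D with σ ⊆ τ, x ^ #τ

open Classical in
/-- All cliques of `G` with vertices in `U`. -/
noncomputable def allCliques (G : SimpleGraph ℕ) (U : Finset ℕ) : Finset (Finset ℕ) :=
  U.powerset.filter fun s => G.IsClique s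

lemma mem_allCliques {s : Finset ℕ} : s ∈ allCliques G U ↔ s ⊆ U ∧ G.IsClique s := by
  simp [allCliques]

/-- The polynomial of degree `d` with γ-vector the clique vector of `G` on `U`. -/
noncomputable def cliqueSum (G : SimpleGraph ℕ) (U : Finset ℕ) (d : ℕ) (x : ℚ) : ℚ :=
  ∑ s ∈ allCliques G U, (x + x ^ 2) ^ #s * (1 + 2 * x) ^ (d - 2 * #s)

/-- The vertices `t ∈ T` that lie in `S a` for all `a ∈ σ`. -/
def supp (T : Finset ℕ) (S : ℕ → Finset ℕ) (σ : Finset ℕ) : Finset ℕ :=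
  T.filter fun t => ∀ a ∈ σ, t ∈ S a

lemma mem_supp {S : ℕ → Finset ℕ} {t : ℕ} : t ∈ supp T S σ ↔ t ∈ T ∧ ∀ a ∈ σ, t ∈ S a := by
  simp [supp]

lemma supp_union {S : ℕ → Finset ℕ} : supp T S (σ ∪ τ) = supp T S σ ∩ supp T S τ := by
  ext t
  simp only [mem_supp, Finset.mem_inter, Finset.mem_union]
  constructor
  · rintro ⟨h1, h2⟩
    exact ⟨⟨h1, fun a ha => h2 a (Or.inl ha)⟩, h1, fun a ha => h2 a (Or.inr ha)⟩
  · rintro ⟨⟨h1, h2⟩, -, h3⟩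
    exact ⟨h1, fun a ha => ha.elim (h2 a) (h3 a)⟩

/-- The graph obtained from `G` by adding a vertex `t` adjacent to `L`. -/
def addVertex (G : SimpleGraph ℕ) (t : ℕ) (L : Finset ℕ) : SimpleGraph ℕ :=
  SimpleGraph.fromRel fun p q => (G.Adj p q ∧ p ≠ t ∧ q ≠ t) ∨ (p = t ∧ q ∈ L)

lemma addVertex_adj {t : ℕ} {L : Finset ℕ} {p q : ℕ} (hp : p ≠ t) (hq : q ≠ t) :
    (addVertex G t L).Adj p q ↔ G.Adj p q := by
  simp only [addVertex, SimpleGraph.fromRel_adj, hp, hq, false_and, or_false, ne_eq,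
    not_false_eq_true, and_true]
  constructor
  · rintro ⟨-, h | h⟩
    exacts [h, h.symm]
  · exact fun h => ⟨h.ne, Or.inl h⟩

lemma addVertex_adj_left {t : ℕ} {L : Finset ℕ} {q : ℕ} (hq : q ≠ t) :
    (addVertex G t L).Adj t q ↔ q ∈ L := by
  simp only [addVertex, SimpleGraph.fromRel_adj, hq, false_and, or_false, ne_eq,
    not_true_eq_false, and_false, true_and, false_or, and_iff_right_iff_imp]
  exact fun _ => hq.symm

lemma isClique_addVertex {t : ℕ} {L s : Finset ℕ} (hs : t ∉ s) :
    (addVertex G t L).IsClique s ↔ G.IsClique s := by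
  refine forall₂_congr fun p hp => forall₂_congr fun q hq => forall_congr' fun _ => ?_
  exact addVertex_adj (fun h => hs (h ▸ hp)) (fun h => hs (h ▸ hq))

lemma isClique_addVertex_insert {t : ℕ} {L s : Finset ℕ} (hs : t ∉ s) :
    (addVertex G t L).IsClique (insert t s : Finset ℕ) ↔ s ⊆ L ∧ G.IsClique s := by
  rw [Finset.coe_insert, SimpleGraph.isClique_insert, isClique_addVertex hs, and_comm]
  refine and_congr_left fun _ => ⟨fun h a ha => ?_, fun h a ha hne => ?_⟩
  · have hne : a ≠ t := fun e => hs (e ▸ ha)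
    exact (addVertex_adj_left hne).1 (h a ha hne.symm)
  · exact (addVertex_adj_left hne.symm).2 (h ha)

lemma cliqueSum_addVertex {t : ℕ} {L : Finset ℕ} (hU : t ∉ U) (d : ℕ) :
    cliqueSum (addVertex G t L) U d x = cliqueSum G U d x := by
  unfold cliqueSum
  refine Finset.sum_congr ?_ fun _ _ => rfl
  ext s
  rw [mem_allCliques, mem_allCliques]
  exact and_congr_right fun h => isClique_addVertex fun ht => hU (h ht)

/-- Cliques through `t` are `t` together with a clique in `U ∩ L`; the extra vertex contributes the
factor `x + x ^ 2` and uses up two degrees. -/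
lemma cliqueSum_addVertex_insert {t : ℕ} {L : Finset ℕ} (hU : t ∉ U) (d : ℕ) :
    cliqueSum (addVertex G t L) (insert t U) d x =
      cliqueSum G U d x + (x + x ^ 2) * cliqueSum G (U ∩ L) (d - 2) x := by
  have hnot : ∀ s ∈ allCliques G (U ∩ L), t ∉ s := fun s hs ht =>
    hU (Finset.mem_inter.1 ((mem_allCliques.1 hs).1 ht)).1
  have hset : allCliques (addVertex G t L) (insert t U) =
      allCliques G U ∪ (allCliques G (U ∩ L)).image (insert t) := by
    ext s
    rw [Finset.mem_union, Finset.mem_image, mem_allCliques]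
    constructor
    · rintro ⟨h1, h2⟩
      by_cases ht : t ∈ s
      · have ht' := Finset.notMem_erase t s
        have hi := Finset.insert_erase ht
        rw [← hi, isClique_addVertex_insert ht'] at h2
        refine Or.inr ⟨s.erase t, mem_allCliques.2 ⟨Finset.subset_inter ?_ h2.1, h2.2⟩, hi⟩
        exact fun a ha => (Finset.mem_insert.1 (h1 (Finset.mem_of_mem_erase ha))).resolve_left
          (Finset.ne_of_mem_erase ha)
      · rw [isClique_addVertex ht] at h2
        exact Or.inl (mem_allCliques.2 ⟨fun a ha => (Finset.mem_insert.1 (h1 ha)).resolve_left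
          fun e => ht (e ▸ ha), h2⟩)
    · rintro (h | ⟨s, hs, rfl⟩)
      · obtain ⟨h1, h2⟩ := mem_allCliques.1 h
        exact ⟨h1.trans (Finset.subset_insert _ _), (isClique_addVertex fun ht => hU (h1 ht)).2 h2⟩
      · obtain ⟨h1, h2⟩ := mem_allCliques.1 hs
        exact ⟨Finset.insert_subset_insert _ (h1.trans Finset.inter_subset_left),
          (isClique_addVertex_insert (hnot s hs)).2 ⟨h1.trans Finset.inter_subset_right, h2⟩⟩
  unfold cliqueSum
  rw [hset, Finset.sum_union, Finset.sum_image, Finset.mul_sum]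
  · congr 1
    refine Finset.sum_congr rfl fun s hs => ?_
    rw [Finset.card_insert_of_notMem (hnot s hs), show d - 2 * (#s + 1) = d - 2 - 2 * #s by omega]
    ring
  · intro s hs s' hs' e
    have := congrArg (fun S => Finset.erase S t) e
    simpa [Finset.erase_insert (hnot s hs), Finset.erase_insert (hnot s' hs')] using this
  · rw [Finset.disjoint_left]
    intro s hs hs'
    obtain ⟨s', -, rfl⟩ := Finset.mem_image.1 hs'
    exact hU ((mem_allCliques.1 hs).1 (Finset.mem_insert_self _ _))

lemma upSum_eq_zero (hD : ∀ τ ∈ D, ∀ σ ⊆ τ, σ ∈ D) (h : σ ∉ D) : upSum D σ x = 0 := by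
  unfold upSum
  rw [Finset.filter_false_of_mem, Finset.sum_empty]
  exact fun τ hτ hs => h (hD τ hτ σ hs)

/-- The sets in the closed star of `e`, not containing `e`, that contain `σ`. -/
def starSum (D : Finset (Finset ℕ)) (e σ : Finset ℕ) (x : ℚ) : ℚ :=
  ∑ ρ ∈ D with ¬ e ⊆ ρ ∧ ρ ∪ e ∈ D ∧ σ ⊆ ρ, x ^ #ρ

/-- Fix the part `f` of `e` that `ρ` omits. Adding `e` and removing `f` are inverse bijections with
the simplices over `σ ∪ e`, and sizes differ by `#f`. If `f` meets `σ`, nothing is counted. -/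
lemma sum_star_fiber (hD : ∀ τ ∈ D, ∀ σ ⊆ τ, σ ∈ D) (hx : x ≠ 0) {e f : Finset ℕ} (hf : f ⊆ e)
    (hf0 : f.Nonempty) :
    ∑ ρ ∈ D with (¬ e ⊆ ρ ∧ ρ ∪ e ∈ D ∧ σ ⊆ ρ) ∧ e \ ρ = f, x ^ #ρ =
      if Disjoint f σ then upSum D (σ ∪ e) x / x ^ #f else 0 := by
  split_ifs with hd
  · rw [eq_div_iff (pow_ne_zero _ hx), Finset.sum_mul, upSum]
    refine Finset.sum_bij' (fun ρ _ => ρ ∪ e) (fun τ _ => τ \ f) ?_ ?_ ?_ ?_ ?_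
    · intro ρ hρ
      obtain ⟨-, ⟨-, h2, h3⟩, -⟩ := Finset.mem_filter.1 hρ
      exact Finset.mem_filter.2 ⟨h2, Finset.union_subset_union_left h3⟩
    · intro τ hτ
      obtain ⟨h1, h2⟩ := Finset.mem_filter.1 hτ
      have h3 : e ⊆ τ := Finset.subset_union_right.trans h2
      refine Finset.mem_filter.2 ⟨hD τ h1 _ Finset.sdiff_subset, ⟨fun h => ?_, ?_, ?_⟩, ?_⟩
      · obtain ⟨a, ha⟩ := hf0
        exact (Finset.mem_sdiff.1 (h (hf ha))).2 ha
      · exact hD τ h1 _ (Finset.union_subset Finset.sdiff_subset h3)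
      · exact Finset.subset_sdiff.2 ⟨Finset.subset_union_left.trans h2, hd.symm⟩
      · ext a
        simp only [Finset.mem_sdiff, not_and, not_not]
        exact ⟨fun ⟨h4, h5⟩ => h5 (h3 h4), fun h4 => ⟨hf h4, fun _ => h4⟩⟩
    · intro ρ hρ
      obtain ⟨-, -, rfl⟩ := Finset.mem_filter.1 hρ
      ext a
      simp only [Finset.mem_sdiff, Finset.mem_union]
      tauto
    · intro τ hτ
      obtain ⟨h1, h2⟩ := Finset.mem_filter.1 hτ
      have h3 : e ⊆ τ := Finset.subset_union_right.trans h2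
      ext a
      simp only [Finset.mem_sdiff, Finset.mem_union]
      constructor
      · rintro (h | h); exacts [h.1, h3 h]
      · intro h
        by_cases h' : a ∈ f
        · exact Or.inr (hf h')
        · exact Or.inl ⟨h, h'⟩
    · intro ρ hρ
      obtain ⟨-, -, rfl⟩ := Finset.mem_filter.1 hρ
      rw [← pow_add, ← Finset.card_union_of_disjoint Finset.disjoint_sdiff,
        Finset.union_sdiff_self_eq_union]
  · rw [Finset.filter_false_of_mem, Finset.sum_empty]
    rintro ρ - ⟨⟨-, -, h3⟩, rfl⟩
    exact hd (Finset.disjoint_of_subset_right h3 Finset.sdiff_disjoint)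

/-- The omitted part of an edge is either endpoint or both, which gives three fibers. -/
lemma starSum_pair (hD : ∀ τ ∈ D, ∀ σ ⊆ τ, σ ∈ D) (hx : x ≠ 0) {a b : ℕ} (hab : a ≠ b) :
    starSum D {a, b} σ x = (if a ∉ σ then upSum D (σ ∪ {a, b}) x / x else 0) +
      (if b ∉ σ then upSum D (σ ∪ {a, b}) x / x else 0) +
      (if a ∉ σ ∧ b ∉ σ then upSum D (σ ∪ {a, b}) x / x ^ 2 else 0) := by
  have hmaps : ∀ ρ ∈ D.filter (fun ρ => ¬ ({a, b} : Finset ℕ) ⊆ ρ ∧ ρ ∪ {a, b} ∈ D ∧ σ ⊆ ρ),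
      {a, b} \ ρ ∈ ({{a}, {b}, {a, b}} : Finset (Finset ℕ)) := by
    intro ρ hρ
    obtain ⟨-, h, -⟩ := Finset.mem_filter.1 hρ
    simp only [Finset.mem_insert, Finset.mem_singleton]
    by_cases ha : a ∈ ρ <;> by_cases hb : b ∈ ρ
    · exact absurd (Finset.insert_subset ha (Finset.singleton_subset_iff.2 hb)) h
    · right; left; ext c; simp only [Finset.mem_sdiff, Finset.mem_insert, Finset.mem_singleton]
      constructor
      · rintro ⟨rfl | rfl, h'⟩
        exacts [absurd ha h', rfl]
      · rintro rfl; exact ⟨Or.inr rfl, hb⟩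
    · left; ext c; simp only [Finset.mem_sdiff, Finset.mem_insert, Finset.mem_singleton]
      constructor
      · rintro ⟨rfl | rfl, h'⟩
        exacts [rfl, absurd hb h']
      · rintro rfl; exact ⟨Or.inl rfl, ha⟩
    · right; right; ext c; simp only [Finset.mem_sdiff, Finset.mem_insert, Finset.mem_singleton]
      constructor
      · exact fun h' => h'.1
      · rintro (rfl | rfl); exacts [⟨Or.inl rfl, ha⟩, ⟨Or.inr rfl, hb⟩]
  have h1 : ({a} : Finset ℕ) ∉ ({{b}, {a, b}} : Finset (Finset ℕ)) := by
    simp only [Finset.mem_insert, Finset.mem_singleton, Finset.singleton_inj, hab, false_or]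
    intro h
    have : b ∈ ({a} : Finset ℕ) := h ▸ (by simp)
    exact hab (Finset.mem_singleton.1 this).symm
  have h2 : ({b} : Finset ℕ) ∉ ({{a, b}} : Finset (Finset ℕ)) := by
    simp only [Finset.mem_singleton]
    intro h
    have : a ∈ ({b} : Finset ℕ) := h ▸ (by simp)
    exact hab (Finset.mem_singleton.1 this)
  rw [starSum, ← Finset.sum_fiberwise_of_maps_to hmaps, Finset.sum_insert h1, Finset.sum_insert h2,
    Finset.sum_singleton, ← add_assoc]
  simp only [Finset.filter_filter]
  rw [sum_star_fiber hD hx (by simp) (by simp), sum_star_fiber hD hx (by simp) (by simp),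
    sum_star_fiber hD hx subset_rfl (by simp)]
  simp [Finset.card_pair hab, Finset.disjoint_insert_left]

end Sums

/-- A simplicial complex `K` together with a graph `G` on `T` and, for every simplex `σ`, a vertex
set of `G` whose clique vector is the γ-vector of the link of `σ`. -/
structure IsRealization (n : ℕ) (K : PreAbstractSimplicialComplex ℕ) (D : Finset (Finset ℕ))
    (G : SimpleGraph ℕ) (T : Finset ℕ) (S : ℕ → Finset ℕ) : Prop where
  mem_iff : ∀ τ, τ ∈ D ↔ τ = ∅ ∨ τ ∈ K.faces
  flag : ∀ τ : Finset ℕ, (∀ a ∈ τ, ∀ b ∈ τ, {a, b} ∈ D) → τ ∈ D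
  clique_le : ∀ σ ∈ D, ∀ s ⊆ supp T S σ, G.IsClique s → 2 * #s + #σ ≤ n
  sum_eq : ∀ σ ∈ D, ∀ x : ℚ, x ≠ 0 →
    upSum D σ x = x ^ #σ * cliqueSum G (supp T S σ) (n - #σ) x

/-- `K` is a flag complex whose links have γ-vectors that are clique vectors of graphs. -/
def IsRealizable (n : ℕ) (K : PreAbstractSimplicialComplex ℕ) : Prop :=
  ∃ D G T S, IsRealization n K D G T S

namespace IsRealization

variable {n : ℕ} {K : PreAbstractSimplicialComplex ℕ} {D : Finset (Finset ℕ)}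
  {G : SimpleGraph ℕ} {T : Finset ℕ} {S : ℕ → Finset ℕ}

lemma empty_mem (h : IsRealization n K D G T S) : ∅ ∈ D := (h.mem_iff ∅).2 (Or.inl rfl)

lemma down (h : IsRealization n K D G T S) : ∀ τ ∈ D, ∀ σ ⊆ τ, σ ∈ D := by
  intro τ hτ σ hσ
  rw [h.mem_iff] at hτ ⊢
  rcases σ.eq_empty_or_nonempty with rfl | hne
  · exact Or.inl rfl
  · rcases hτ with rfl | hτ
    · exact Or.inl (Finset.subset_empty.1 hσ)
    · exact Or.inr ((K.isRelLowerSet_faces hτ).2 hσ hne)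

lemma card_le (h : IsRealization n K D G T S) {σ : Finset ℕ} (hσ : σ ∈ D) : #σ ≤ n := by
  simpa using h.clique_le σ hσ ∅ (Finset.empty_subset _) (by simp)

end IsRealization

/-! ### Stellar subdivision of an edge -/

/-- The effect of a suspension: the γ-vector stays and the polynomial gains a factor `1 + 2 * x`.
The clique bound keeps the subtraction in the exponent exact. -/
lemma cliqueSum_succ {G : SimpleGraph ℕ} {U : Finset ℕ} {d : ℕ} {x : ℚ}
    (h : ∀ s ⊆ U, G.IsClique s → 2 * #s ≤ d) :
    cliqueSum G U (d + 1) x = (1 + 2 * x) * cliqueSum G U d x := by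
  unfold cliqueSum
  rw [Finset.mul_sum]
  refine Finset.sum_congr rfl fun s hs => ?_
  have := h s (mem_allCliques.1 hs).1 (mem_allCliques.1 hs).2
  rw [show d + 1 - 2 * #s = (d - 2 * #s) + 1 by omega]
  ring

/-- The simplices of the stellar subdivision. -/
def stellarFaces (D : Finset (Finset ℕ)) (e : Finset ℕ) (v : ℕ) : Finset (Finset ℕ) :=
  D.filter (fun τ => ¬ e ⊆ τ) ∪ (D.filter fun ρ => ¬ e ⊆ ρ ∧ ρ ∪ e ∈ D).image (insert v)

/-! ### Face sums of the subdivided complex -/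

section StellarFaces

variable {D : Finset (Finset ℕ)} {e σ ρ : Finset ℕ} {v : ℕ} {x : ℚ}

lemma mem_stellarFaces (hσ : v ∉ σ) : σ ∈ stellarFaces D e v ↔ σ ∈ D ∧ ¬ e ⊆ σ := by
  simp only [stellarFaces, Finset.mem_union, Finset.mem_filter, Finset.mem_image]
  refine or_iff_left ?_
  rintro ⟨ρ, -, rfl⟩
  exact hσ (Finset.mem_insert_self _ _)

lemma insert_mem_stellarFaces (hv : ∀ τ ∈ D, v ∉ τ) (hρ : v ∉ ρ) :
    insert v ρ ∈ stellarFaces D e v ↔ ρ ∈ D ∧ ¬ e ⊆ ρ ∧ ρ ∪ e ∈ D := by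
  simp only [stellarFaces, Finset.mem_union, Finset.mem_filter, Finset.mem_image]
  constructor
  · rintro (⟨h, -⟩ | ⟨ρ', h, h'⟩)
    · exact absurd (Finset.mem_insert_self _ _) (hv _ h)
    · have : ρ' = ρ := by
        rw [← Finset.erase_insert (hv _ h.1), h', Finset.erase_insert hρ]
      exact this ▸ h
  · exact fun h => Or.inr ⟨ρ, h, rfl⟩

lemma injOn_insert_of_notMem {A : Finset (Finset ℕ)} (hv : ∀ τ ∈ A, v ∉ τ) :
    Set.InjOn (insert v) (A : Set (Finset ℕ)) := by
  intro s hs s' hs' h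
  rw [← Finset.erase_insert (hv s hs), h, Finset.erase_insert (hv s' hs')]

lemma upSum_union_image_insert {A B : Finset (Finset ℕ)} (hA : ∀ τ ∈ A, v ∉ τ)
    (hB : ∀ τ ∈ B, v ∉ τ) (hσ : v ∉ σ) :
    upSum (A ∪ B.image (insert v)) σ x = upSum A σ x + x * upSum B σ x := by
  have hd : Disjoint A (B.image (insert v)) := by
    rw [Finset.disjoint_left]
    intro τ h h'
    obtain ⟨ρ, -, rfl⟩ := Finset.mem_image.1 h'
    exact hA _ h (Finset.mem_insert_self _ _)
  unfold upSum
  rw [Finset.filter_union, Finset.sum_union (Finset.disjoint_filter_filter hd), Finset.filter_image,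
    Finset.sum_image, Finset.mul_sum]
  · congr 1
    refine Finset.sum_congr ?_ fun ρ hρ => ?_
    · exact Finset.filter_congr fun ρ _ => Finset.subset_insert_iff_of_notMem hσ
    · rw [Finset.card_insert_of_notMem (hB _ (Finset.mem_filter.1 hρ).1), pow_succ']
  · exact (injOn_insert_of_notMem hB).mono fun τ h => (Finset.mem_filter.1 h).1

lemma upSum_union_image_insert' {A B : Finset (Finset ℕ)} (hA : ∀ τ ∈ A, v ∉ τ)
    (hB : ∀ τ ∈ B, v ∉ τ) (hρ : v ∉ ρ) :
    upSum (A ∪ B.image (insert v)) (insert v ρ) x = x * upSum B ρ x := by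
  unfold upSum
  rw [Finset.filter_union, Finset.filter_false_of_mem (s := A), Finset.empty_union,
    Finset.filter_image, Finset.sum_image, Finset.mul_sum]
  · refine Finset.sum_congr ?_ fun τ hτ => ?_
    · exact Finset.filter_congr fun τ _ => Finset.insert_subset_insert_iff hρ
    · rw [Finset.card_insert_of_notMem (hB _ (Finset.mem_filter.1 hτ).1), pow_succ']
  · exact (injOn_insert_of_notMem hB).mono fun τ h => (Finset.mem_filter.1 h).1
  · exact fun τ h h' => hA τ h (h' (Finset.mem_insert_self _ _))

lemma upSum_filter_star :
    upSum (D.filter fun ρ => ¬ e ⊆ ρ ∧ ρ ∪ e ∈ D) σ x = starSum D e σ x := by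
  unfold upSum starSum
  rw [Finset.filter_filter]
  simp only [and_assoc]

lemma upSum_filter_not :
    upSum (D.filter fun ρ => ¬ e ⊆ ρ) σ x = upSum D σ x - upSum D (σ ∪ e) x := by
  unfold upSum
  rw [eq_sub_iff_add_eq, ← Finset.sum_filter_not_add_sum_filter (D.filter (σ ⊆ ·)) (fun ρ => e ⊆ ρ),
    Finset.filter_filter, Finset.filter_filter, Finset.filter_filter]
  simp only [Finset.union_subset_iff, and_comm]

/-- Simplices over `e` disappear, and the cone over the rest of the closed star, with one more
vertex per simplex, is added. -/
lemma upSum_stellarFaces (hv : ∀ τ ∈ D, v ∉ τ) (hσ : v ∉ σ) :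
    upSum (stellarFaces D e v) σ x =
      upSum D σ x - upSum D (σ ∪ e) x + x * starSum D e σ x := by
  rw [stellarFaces, upSum_union_image_insert _ _ hσ, upSum_filter_star, upSum_filter_not]
  · exact fun τ h => hv τ (Finset.mem_filter.1 h).1
  · exact fun τ h => hv τ (Finset.mem_filter.1 h).1

lemma upSum_stellarFaces_insert (hv : ∀ τ ∈ D, v ∉ τ) (hρ : v ∉ ρ) :
    upSum (stellarFaces D e v) (insert v ρ) x = x * starSum D e ρ x := by
  rw [stellarFaces, upSum_union_image_insert' _ _ hρ, upSum_filter_star]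
  · exact fun τ h => hv τ (Finset.mem_filter.1 h).1
  · exact fun τ h => hv τ (Finset.mem_filter.1 h).1

end StellarFaces

/-- The vertex sets of the stellar subdivision. -/
def stellarSupp (D : Finset (Finset ℕ)) (e : Finset ℕ) (v t : ℕ) (T : Finset ℕ)
    (S : ℕ → Finset ℕ) (c : ℕ) : Finset ℕ :=
  if c = v then supp T S e else if c ∉ e ∧ insert c e ∈ D then insert t (T ∩ S c) else T ∩ S c

/-! ### Supports of simplices after the subdivision -/

section Supp

variable {D : Finset (Finset ℕ)} {e σ ρ T : Finset ℕ} {v t : ℕ} {S : ℕ → Finset ℕ}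

lemma mem_stellarSupp_of_mem {c u : ℕ} (hc : c ≠ v) (hu : u ∈ T) (ht : t ∉ T) :
    u ∈ stellarSupp D e v t T S c ↔ u ∈ S c := by
  have : u ≠ t := fun h => ht (h ▸ hu)
  unfold stellarSupp
  rw [if_neg hc]
  split_ifs <;> simp [this, hu]

lemma mem_stellarSupp_self {c : ℕ} (hc : c ≠ v) (ht : t ∉ T) :
    t ∈ stellarSupp D e v t T S c ↔ c ∉ e ∧ insert c e ∈ D := by
  unfold stellarSupp
  rw [if_neg hc]
  split_ifs with h <;> simp [h, ht]

/-- The link of `insert v ρ` is, up to suspension, as large as that of `ρ ∪ e`, so both need the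
same graph. -/
lemma supp_stellar_insert (hv : v ∉ ρ) (ht : t ∉ T) :
    supp (insert t T) (stellarSupp D e v t T S) (insert v ρ) = supp T S (ρ ∪ e) := by
  have hSv : stellarSupp D e v t T S v = supp T S e := if_pos rfl
  ext u
  rw [supp_union, Finset.mem_inter, mem_supp, Finset.forall_mem_insert, hSv, Finset.mem_insert,
    mem_supp (σ := ρ)]
  constructor
  · rintro ⟨-, h2, h3⟩
    have hu := (mem_supp.1 h2).1
    exact ⟨⟨hu, fun c hc => (mem_stellarSupp_of_mem (ne_of_mem_of_not_mem hc hv) hu ht).1 (h3 c hc)⟩, h2⟩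
  · rintro ⟨⟨hu, h3⟩, h2⟩
    exact ⟨Or.inr hu, h2, fun c hc =>
      (mem_stellarSupp_of_mem (ne_of_mem_of_not_mem hc hv) hu ht).2 (h3 c hc)⟩

lemma supp_stellar (hv : v ∉ σ) (ht : t ∉ T) :
    supp (insert t T) (stellarSupp D e v t T S) σ =
      if ∀ c ∈ σ, c ∉ e ∧ insert c e ∈ D then insert t (supp T S σ) else supp T S σ := by
  have hT : ∀ u ∈ T, (∀ c ∈ σ, u ∈ stellarSupp D e v t T S c) ↔ ∀ c ∈ σ, u ∈ S c := fun u hu =>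
    forall₂_congr fun c hc => mem_stellarSupp_of_mem (fun h => hv (h ▸ hc)) hu ht
  have ht' : (∀ c ∈ σ, t ∈ stellarSupp D e v t T S c) ↔ ∀ c ∈ σ, c ∉ e ∧ insert c e ∈ D :=
    forall₂_congr fun c hc => mem_stellarSupp_self (fun h => hv (h ▸ hc)) ht
  have key : ∀ u, u ∈ supp (insert t T) (stellarSupp D e v t T S) σ ↔
      (u = t ∧ ∀ c ∈ σ, c ∉ e ∧ insert c e ∈ D) ∨ u ∈ supp T S σ := by
    intro u
    rw [mem_supp, mem_supp, Finset.mem_insert]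
    constructor
    · rintro ⟨rfl | h, h'⟩
      · exact Or.inl ⟨rfl, ht'.1 h'⟩
      · exact Or.inr ⟨h, (hT u h).1 h'⟩
    · rintro (⟨rfl, h⟩ | ⟨h, h'⟩)
      · exact ⟨Or.inl rfl, ht'.2 h⟩
      · exact ⟨Or.inr h, (hT u h).2 h'⟩
  ext u
  rw [key]
  split_ifs with h
  · simp only [Finset.mem_insert, and_iff_left h]
  · simp only [h, and_false, false_or]

end Supp

namespace IsRealization

variable {n : ℕ} {K : PreAbstractSimplicialComplex ℕ} {D : Finset (Finset ℕ)}
  {G : SimpleGraph ℕ} {T : Finset ℕ} {S : ℕ → Finset ℕ} {e σ : Finset ℕ} {v t : ℕ}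

lemma union_mem_iff (h : IsRealization n K D G T S) (he : e ∈ D) (hσ : σ ∈ D) :
    σ ∪ e ∈ D ↔ ∀ c ∈ σ, insert c e ∈ D := by
  constructor
  · intro h' c hc
    exact h.down _ h' _ (Finset.insert_subset (Finset.mem_union_left _ hc)
      Finset.subset_union_right)
  · intro h'
    refine h.flag _ fun a ha b hb => ?_
    rcases Finset.mem_union.1 ha with ha | ha <;> rcases Finset.mem_union.1 hb with hb | hb
    · exact h.down _ hσ _ (Finset.insert_subset ha (Finset.singleton_subset_iff.2 hb))
    · exact h.down _ (h' a ha) _ (Finset.insert_subset (Finset.mem_insert_self _ _)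
        (Finset.singleton_subset_iff.2 (Finset.mem_insert_of_mem hb)))
    · exact h.down _ (h' b hb) _ (Finset.insert_subset (Finset.mem_insert_of_mem ha)
        (Finset.singleton_subset_iff.2 (Finset.mem_insert_self _ _)))
    · exact h.down _ he _ (Finset.insert_subset ha (Finset.singleton_subset_iff.2 hb))

lemma notMem (h : IsRealization n K D G T S) (hv : ∀ τ ∈ K.faces, v ∉ τ) : ∀ τ ∈ D, v ∉ τ := by
  intro τ hτ
  rcases (h.mem_iff τ).1 hτ with rfl | hτ
  · simp
  · exact hv τ hτ

lemma stellarFaces_mem_iff (h : IsRealization n K D G T S) (hv : ∀ τ ∈ K.faces, v ∉ τ)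
    (he : e.Nonempty) (τ : Finset ℕ) :
    τ ∈ stellarFaces D e v ↔ τ = ∅ ∨ τ ∈ (stellar K e v).faces := by
  have hvD := h.notMem hv
  have hKD : ∀ τ : Finset ℕ, τ.Nonempty → (τ ∈ D ↔ τ ∈ K.faces) := fun τ hτ => by
    rw [h.mem_iff]; exact or_iff_right hτ.ne_empty
  rcases τ.eq_empty_or_nonempty with rfl | hne
  · simp [mem_stellarFaces, h.empty_mem, he.ne_empty]
  · rw [or_iff_right hne.ne_empty]
    simp only [stellarFaces, Finset.mem_union, Finset.mem_filter, Finset.mem_image, stellar,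
      Set.mem_ofPred_eq, hKD τ hne]
    refine or_congr Iff.rfl ⟨?_, ?_⟩
    · rintro ⟨ρ, ⟨-, h2, h3⟩, rfl⟩
      exact ⟨ρ, h2, (hKD _ (he.mono Finset.subset_union_right)).1 h3, rfl⟩
    · rintro ⟨ρ, h2, h3, rfl⟩
      have h4 := (hKD _ (he.mono Finset.subset_union_right)).2 h3
      exact ⟨ρ, ⟨h.down _ h4 _ Finset.subset_union_left, h2, h4⟩, rfl⟩

/-- The subdivided edge is now a missing pair, so the simplices over it are excluded pairwise. Being
joined to the edge is also a pairwise condition, by flagness of `D`. -/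
lemma stellarFaces_flag (h : IsRealization n K D G T S) (hv : ∀ τ ∈ K.faces, v ∉ τ) {a b : ℕ}
    (he : {a, b} ∈ D) (τ : Finset ℕ)
    (hτ : ∀ p ∈ τ, ∀ q ∈ τ, {p, q} ∈ stellarFaces D {a, b} v) : τ ∈ stellarFaces D {a, b} v := by
  have hvD := h.notMem hv
  have main : ∀ ρ ⊆ τ, v ∉ ρ → ρ ∈ D ∧ ¬ {a, b} ⊆ ρ := by
    intro ρ hρ hvρ
    have hpq : ∀ p ∈ ρ, ∀ q ∈ ρ, {p, q} ∈ D ∧ ¬ ({a, b} : Finset ℕ) ⊆ {p, q} := by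
      intro p hp q hq
      refine (mem_stellarFaces ?_).1 (hτ p (hρ hp) q (hρ hq))
      simp only [Finset.mem_insert, Finset.mem_singleton, not_or]
      exact ⟨fun h => hvρ (h ▸ hp), fun h => hvρ (h ▸ hq)⟩
    refine ⟨h.flag ρ fun p hp q hq => (hpq p hp q hq).1, fun hab => ?_⟩
    exact (hpq a (hab (by simp)) b (hab (by simp))).2 subset_rfl
  by_cases hvτ : v ∈ τ
  · have hv' := Finset.notMem_erase v τ
    obtain ⟨h1, h2⟩ := main (τ.erase v) (Finset.erase_subset _ _) hv'
    rw [← Finset.insert_erase hvτ, insert_mem_stellarFaces hvD hv']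
    refine ⟨h1, h2, (h.union_mem_iff he h1).2 fun c hc => ?_⟩
    have hcv := Finset.ne_of_mem_erase hc
    have := hτ v hvτ c (Finset.mem_of_mem_erase hc)
    rw [insert_mem_stellarFaces hvD (by simpa using hcv.symm)] at this
    rw [Finset.insert_eq c {a, b}]
    exact this.2.2
  · exact (mem_stellarFaces hvτ).2 (main τ subset_rfl hvτ)

/-- The new graph vertex `t` enters the support of `σ` exactly when `σ` lies in the link of `e`,
which is when `e` is an edge of the link of `σ` and gets subdivided there. -/
lemma supp_stellar_eq (h : IsRealization n K D G T S) (hv : v ∉ σ) (ht : t ∉ T) (he : e ∈ D)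
    (hσ : σ ∈ D) : supp (insert t T) (stellarSupp D e v t T S) σ =
      if Disjoint σ e ∧ σ ∪ e ∈ D then insert t (supp T S σ) else supp T S σ := by
  rw [supp_stellar hv ht]
  refine if_congr ?_ rfl rfl
  rw [h.union_mem_iff he hσ, Finset.disjoint_left]
  exact ⟨fun h' => ⟨fun c hc => (h' c hc).1, fun c hc => (h' c hc).2⟩,
    fun h' c hc => ⟨h'.1 hc, h'.2 c hc⟩⟩

lemma notMem_supp (ht : t ∉ T) : t ∉ supp T S σ := fun h => ht (mem_supp.1 h).1

/-- A clique through `t` leaves a clique supported on `σ ∪ {a, b}`; the two vertices of the edge pay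
for the extra vertex `t`. -/
lemma stellar_clique_le (h : IsRealization n K D G T S) (hv : ∀ τ ∈ K.faces, v ∉ τ) (ht : t ∉ T)
    {a b : ℕ} (hab : a ≠ b) (he : {a, b} ∈ D) (hσ : σ ∈ stellarFaces D {a, b} v) (s : Finset ℕ)
    (hs : s ⊆ supp (insert t T) (stellarSupp D {a, b} v t T S) σ)
    (hc : (addVertex G t (supp T S {a, b})).IsClique s) : 2 * #s + #σ ≤ n := by
  have hvD := h.notMem hv
  by_cases hvσ : v ∈ σ
  · obtain ⟨ρ, hvρ, rfl⟩ : ∃ ρ, v ∉ ρ ∧ σ = insert v ρ :=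
      ⟨_, Finset.notMem_erase v σ, (Finset.insert_erase hvσ).symm⟩
    obtain ⟨h1, h2, h3⟩ := (insert_mem_stellarFaces hvD hvρ).1 hσ
    rw [supp_stellar_insert hvρ ht] at hs
    rw [isClique_addVertex fun h' => notMem_supp ht (hs h')] at hc
    have := h.clique_le _ h3 s hs hc
    have h4 : #ρ < #(ρ ∪ {a, b}) := Finset.card_lt_card
      (Finset.ssubset_iff_subset_ne.2 ⟨Finset.subset_union_left, fun h' =>
        h2 (Finset.union_eq_left.1 h'.symm)⟩)
    rw [Finset.card_insert_of_notMem hvρ]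
    omega
  · obtain ⟨h1, -⟩ := (mem_stellarFaces hvσ).1 hσ
    rw [h.supp_stellar_eq hvσ ht he h1] at hs
    split_ifs at hs with hd
    · by_cases hts : t ∈ s
      · obtain ⟨s', hs', rfl⟩ : ∃ s', t ∉ s' ∧ s = insert t s' :=
          ⟨_, Finset.notMem_erase t s, (Finset.insert_erase hts).symm⟩
        rw [isClique_addVertex_insert hs'] at hc
        have h2 : s' ⊆ supp T S σ := (Finset.insert_subset_insert_iff hs').1 hs
        have := h.clique_le _ hd.2 s' (supp_union ▸ Finset.subset_inter h2 hc.1) hc.2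
        rw [Finset.card_union_of_disjoint hd.1, Finset.card_pair hab] at this
        rw [Finset.card_insert_of_notMem hs']
        omega
      · rw [isClique_addVertex hts] at hc
        exact h.clique_le _ h1 s ((Finset.subset_insert_iff_of_notMem hts).1 hs) hc
    · rw [isClique_addVertex fun h' => notMem_supp ht (hs h')] at hc
      exact h.clique_le _ h1 s hs hc

/-- For `σ` in the link of the edge, the sum divided by `x ^ #σ` gains `x + x ^ 2` times the
polynomial of the link of `σ ∪ {a, b}`; for other old simplices the changes cancel or vanish. For
`insert v ρ` one gets the polynomial of the link of `ρ ∪ {a, b}`, suspended if `ρ` is disjoint from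
the edge. -/
lemma stellar_sum_eq (h : IsRealization n K D G T S) (hv : ∀ τ ∈ K.faces, v ∉ τ) (ht : t ∉ T)
    {a b : ℕ} (hab : a ≠ b) (he : {a, b} ∈ D) (hσ : σ ∈ stellarFaces D {a, b} v) {x : ℚ}
    (hx : x ≠ 0) : upSum (stellarFaces D {a, b} v) σ x =
      x ^ #σ * cliqueSum (addVertex G t (supp T S {a, b}))
        (supp (insert t T) (stellarSupp D {a, b} v t T S) σ) (n - #σ) x := by
  have hvD := h.notMem hv
  have hcard : ∀ ρ : Finset ℕ, ¬ {a, b} ⊆ ρ →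
      (¬ Disjoint ρ {a, b} ∧ #(ρ ∪ {a, b}) = #ρ + 1 ∧
        starSum D {a, b} ρ x = upSum D (ρ ∪ {a, b}) x / x) ∨
      (Disjoint ρ {a, b} ∧ #(ρ ∪ {a, b}) = #ρ + 2 ∧
        starSum D {a, b} ρ x =
          2 * (upSum D (ρ ∪ {a, b}) x / x) + upSum D (ρ ∪ {a, b}) x / x ^ 2) := by
    intro ρ hρ
    rw [starSum_pair h.down hx hab]
    have hca := Finset.card_union_add_card_inter ρ {a, b}
    rw [Finset.card_pair hab] at hca
    by_cases ha : a ∈ ρ <;> by_cases hb : b ∈ ρ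
    · exact absurd (Finset.insert_subset ha (Finset.singleton_subset_iff.2 hb)) hρ
    · have hi : ρ ∩ {a, b} = {a} := by
        ext c
        simp only [Finset.mem_inter, Finset.mem_insert, Finset.mem_singleton]
        constructor
        · rintro ⟨h1, rfl | rfl⟩; exacts [rfl, absurd h1 hb]
        · rintro rfl; exact ⟨ha, Or.inl rfl⟩
      rw [hi, Finset.card_singleton] at hca
      refine Or.inl ⟨by simp [ha], by omega, by simp [ha, hb]⟩
    · have hi : ρ ∩ {a, b} = {b} := by
        ext c
        simp only [Finset.mem_inter, Finset.mem_insert, Finset.mem_singleton]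
        constructor
        · rintro ⟨h1, rfl | rfl⟩; exacts [absurd h1 ha, rfl]
        · rintro rfl; exact ⟨hb, Or.inr rfl⟩
      rw [hi, Finset.card_singleton] at hca
      refine Or.inl ⟨by simp [hb], by omega, by simp [ha, hb]⟩
    · have hd : Disjoint ρ {a, b} := by simp [ha, hb]
      rw [Finset.disjoint_iff_inter_eq_empty.1 hd, Finset.card_empty] at hca
      refine Or.inr ⟨hd, by omega, ?_⟩
      simp only [ha, hb, not_false_eq_true, if_true, and_self]
      ring
  by_cases hvσ : v ∈ σ
  · obtain ⟨ρ, hvρ, rfl⟩ : ∃ ρ, v ∉ ρ ∧ σ = insert v ρ :=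
      ⟨_, Finset.notMem_erase v σ, (Finset.insert_erase hvσ).symm⟩
    obtain ⟨h1, h2, h3⟩ := (insert_mem_stellarFaces hvD hvρ).1 hσ
    rw [upSum_stellarFaces_insert hvD hvρ, supp_stellar_insert hvρ ht,
      cliqueSum_addVertex (notMem_supp ht), Finset.card_insert_of_notMem hvρ]
    have hle := h.card_le h3
    rcases hcard ρ h2 with ⟨-, h4, h5⟩ | ⟨-, h4, h5⟩
    · rw [h5, mul_div_cancel₀ _ hx, h.sum_eq _ h3 x hx, h4]
    · rw [h5, h.sum_eq _ h3 x hx, h4, show n - (#ρ + 1) = n - (#ρ + 2) + 1 by omega,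
        cliqueSum_succ (d := n - (#ρ + 2))]
      · field_simp
        ring
      · intro s hs hc
        have := h.clique_le _ h3 s hs hc
        omega
  · obtain ⟨h1, h2⟩ := (mem_stellarFaces hvσ).1 hσ
    rw [upSum_stellarFaces hvD hvσ, h.supp_stellar_eq hvσ ht he h1]
    by_cases h3 : σ ∪ {a, b} ∈ D
    · rcases hcard σ h2 with ⟨h6, h4, h5⟩ | ⟨h6, h4, h5⟩
      · rw [if_neg fun h' => h6 h'.1, cliqueSum_addVertex (notMem_supp ht), h5,
          mul_div_cancel₀ _ hx, sub_add_cancel, h.sum_eq _ h1 x hx]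
      · rw [if_pos ⟨h6, h3⟩, cliqueSum_addVertex_insert (notMem_supp ht), ← supp_union, h5,
          h.sum_eq _ h1 x hx, h.sum_eq _ h3 x hx, h4, Nat.sub_sub]
        field_simp
        ring
    · rw [if_neg fun h' => h3 h'.2, cliqueSum_addVertex (notMem_supp ht), h.sum_eq _ h1 x hx,
        starSum_pair h.down hx hab, upSum_eq_zero h.down h3]
      simp

end IsRealization

lemma IsRealizable.stellar {n : ℕ} {K : PreAbstractSimplicialComplex ℕ} (h : IsRealizable n K)
    {e : Finset ℕ} {v : ℕ} (he : e ∈ K.faces) (hcard : #e = 2) (hv : ∀ τ ∈ K.faces, v ∉ τ) :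
    IsRealizable n (stellar K e v) := by
  obtain ⟨D, G, T, S, h⟩ := h
  obtain ⟨t, ht⟩ := Infinite.exists_notMem_finset T
  obtain ⟨a, b, hab, rfl⟩ := Finset.card_eq_two.1 hcard
  have heD := (h.mem_iff _).2 (Or.inr he)
  exact ⟨stellarFaces D {a, b} v, addVertex G t (supp T S {a, b}), insert t T,
    stellarSupp D {a, b} v t T S, h.stellarFaces_mem_iff hv (by simp),
    h.stellarFaces_flag hv heD, fun σ hσ s => h.stellar_clique_le hv ht hab heD hσ s,
    fun σ hσ x hx => h.stellar_sum_eq hv ht hab heD hσ hx⟩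

/-! ### Isomorphic complexes -/

lemma image_image_of_leftInvOn {p q : ℕ → ℕ} {τ : Finset ℕ} (h : ∀ a ∈ τ, p (q a) = a) :
    (τ.image q).image p = τ := by
  rw [Finset.image_image]
  exact (Finset.image_congr fun a ha => h a ha).trans Finset.image_id

/-- The graph is unchanged; only the labels of the sets `S` move along the vertex bijection. -/
lemma IsRealization.transfer {n : ℕ} {K K' : PreAbstractSimplicialComplex ℕ}
    {D D' : Finset (Finset ℕ)} {G : SimpleGraph ℕ} {T : Finset ℕ} {S : ℕ → Finset ℕ}
    (h : IsRealization n K D G T S) {p q : ℕ → ℕ} (hp : ∀ τ ∈ D, τ.image p ∈ D')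
    (hq : ∀ τ ∈ D', τ.image q ∈ D) (hqp : ∀ τ ∈ D, ∀ a ∈ τ, q (p a) = a)
    (hpq : ∀ τ ∈ D', ∀ a ∈ τ, p (q a) = a) (hD' : ∀ τ, τ ∈ D' ↔ τ = ∅ ∨ τ ∈ K'.faces) :
    IsRealization n K' D' G T (S ∘ q) := by
  have hsupp : ∀ τ, supp T (S ∘ q) τ = supp T S (τ.image q) := fun τ => by
    ext t
    simp [mem_supp]
  have hcard : ∀ τ ∈ D', #(τ.image q) = #τ := fun τ hτ =>
    Finset.card_image_of_injOn fun a ha b hb hab => by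
      rw [← hpq τ hτ a ha, hab, hpq τ hτ b hb]
  refine ⟨hD', fun τ hτ => ?_, fun σ hσ s hs hc => ?_, fun σ hσ x hx => ?_⟩
  · rw [← image_image_of_leftInvOn (p := p) (q := q) fun b hb => hpq _ (hτ b hb b hb) b (by simp)]
    refine hp _ (h.flag _ fun a ha b hb => ?_)
    obtain ⟨a, ha', rfl⟩ := Finset.mem_image.1 ha
    obtain ⟨b, hb', rfl⟩ := Finset.mem_image.1 hb
    simpa [Finset.image_insert] using hq _ (hτ a ha' b hb')
  · rw [← hcard σ hσ]
    exact h.clique_le _ (hq σ hσ) s (hsupp σ ▸ hs) hc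
  · rw [← hcard σ hσ, hsupp, ← h.sum_eq _ (hq σ hσ) x hx]
    refine Finset.sum_bij' (fun τ _ => τ.image q) (fun τ _ => τ.image p) ?_ ?_ ?_ ?_ ?_
    · intro τ hτ
      obtain ⟨h1, h2⟩ := Finset.mem_filter.1 hτ
      exact Finset.mem_filter.2 ⟨hq τ h1, Finset.image_subset_image h2⟩
    · intro τ hτ
      obtain ⟨h1, h2⟩ := Finset.mem_filter.1 hτ
      refine Finset.mem_filter.2 ⟨hp τ h1, ?_⟩
      rw [← image_image_of_leftInvOn (p := p) (q := q) fun b hb => hpq σ hσ b hb]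
      exact Finset.image_subset_image h2
    · exact fun τ hτ => image_image_of_leftInvOn (hpq τ (Finset.mem_filter.1 hτ).1)
    · exact fun τ hτ => image_image_of_leftInvOn (hqp τ (Finset.mem_filter.1 hτ).1)
    · exact fun τ hτ => by rw [hcard τ (Finset.mem_filter.1 hτ).1]

section VertexMap

variable {K K' : PreAbstractSimplicialComplex ℕ}

lemma simplex_subset {τ σ : Finset ℕ} (hτ : τ = ∅ ∨ τ ∈ K.faces) (h : σ ⊆ τ) :
    σ = ∅ ∨ σ ∈ K.faces := by
  rcases σ.eq_empty_or_nonempty with rfl | hne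
  · exact Or.inl rfl
  · rcases hτ with rfl | hτ
    · exact Or.inl (Finset.subset_empty.1 h)
    · exact Or.inr ((K.isRelLowerSet_faces hτ).2 h hne)

lemma orderIso_empty (f : Simplex K ≃o Simplex K') :
    (f ⟨∅, Or.inl rfl⟩).1 = ∅ := by
  have h : f ⟨∅, Or.inl rfl⟩ ≤ ⟨∅, Or.inl rfl⟩ := by
    rw [← f.le_symm_apply]
    exact Finset.empty_subset _
  exact Finset.subset_empty.1 h

/-- Singletons are the simplices directly above the empty one, so an order isomorphism permutes
them. -/
lemma orderIso_singleton (f : Simplex K ≃o Simplex K') {a : ℕ}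
    (ha : {a} = (∅ : Finset ℕ) ∨ {a} ∈ K.faces) : ∃ b, (f ⟨{a}, ha⟩).1 = {b} := by
  have hne : (f ⟨{a}, ha⟩).1.Nonempty := by
    rw [Finset.nonempty_iff_ne_empty]
    intro h
    have h' : f ⟨{a}, ha⟩ = f ⟨∅, Or.inl rfl⟩ := Subtype.ext (h.trans (orderIso_empty f).symm)
    simpa using congrArg Subtype.val (f.injective h')
  obtain ⟨b, hb⟩ := hne
  have hbs := simplex_subset (f ⟨{a}, ha⟩).2 (Finset.singleton_subset_iff.2 hb)
  have hle : (⟨{b}, hbs⟩ : Simplex K') ≤ f ⟨{a}, ha⟩ := Finset.singleton_subset_iff.2 hb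
  have hle' : f.symm ⟨{b}, hbs⟩ ≤ ⟨{a}, ha⟩ := (f.symm_apply_le).2 hle
  refine ⟨b, ?_⟩
  rcases Finset.subset_singleton_iff.1 (show (f.symm ⟨{b}, hbs⟩).1 ⊆ {a} from hle') with h | h
  · have h' : f.symm ⟨{b}, hbs⟩ = f.symm ⟨∅, Or.inl rfl⟩ :=
      Subtype.ext (h.trans (orderIso_empty f.symm).symm)
    simpa using congrArg Subtype.val (f.symm.injective h')
  · have h' : f.symm ⟨{b}, hbs⟩ = ⟨{a}, ha⟩ := Subtype.ext h
    rw [← h', f.apply_symm_apply]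

open Classical in
/-- The vertex map underlying an isomorphism of simplex posets. -/
noncomputable def vertexMap (f : Simplex K ≃o Simplex K') (a : ℕ) : ℕ :=
  if ha : {a} ∈ K.faces then (orderIso_singleton f (Or.inr ha)).choose else 0

lemma orderIso_apply_singleton (f : Simplex K ≃o Simplex K') {a : ℕ} (ha : {a} ∈ K.faces) :
    (f ⟨{a}, Or.inr ha⟩).1 = {vertexMap f a} := by
  rw [vertexMap, dif_pos ha]
  exact (orderIso_singleton f (Or.inr ha)).choose_spec

lemma singleton_mem_faces {τ : Finset ℕ} (hτ : τ = ∅ ∨ τ ∈ K.faces) {a : ℕ} (ha : a ∈ τ) :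
    {a} ∈ K.faces :=
  (simplex_subset hτ (Finset.singleton_subset_iff.2 ha)).resolve_left (by simp)

lemma vertexMap_symm (f : Simplex K ≃o Simplex K') {a : ℕ} (ha : {a} ∈ K.faces) :
    {vertexMap f a} ∈ K'.faces ∧ vertexMap f.symm (vertexMap f a) = a := by
  have h1 := orderIso_apply_singleton f ha
  have h2 : {vertexMap f a} ∈ K'.faces :=
    singleton_mem_faces (f ⟨{a}, Or.inr ha⟩).2 (h1 ▸ Finset.mem_singleton_self _)
  refine ⟨h2, ?_⟩
  have h3 := orderIso_apply_singleton f.symm h2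
  have h4 : (⟨{vertexMap f a}, Or.inr h2⟩ : Simplex K') = f ⟨{a}, Or.inr ha⟩ :=
    Subtype.ext h1.symm
  rw [h4, f.symm_apply_apply] at h3
  exact (Finset.singleton_injective h3).symm

/-- A simplex is determined by the singletons below it. -/
lemma orderIso_apply_eq_image (f : Simplex K ≃o Simplex K') (τ : Simplex K) :
    (f τ).1 = τ.1.image (vertexMap f) := by
  have hmem : ∀ a (ha : {a} ∈ K.faces), vertexMap f a ∈ (f τ).1 ↔ a ∈ τ.1 := by
    intro a ha
    rw [← Finset.singleton_subset_iff, ← orderIso_apply_singleton f ha,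
      ← Finset.singleton_subset_iff]
    exact f.le_iff_le (x := ⟨{a}, Or.inr ha⟩) (y := τ)
  ext b
  rw [Finset.mem_image]
  constructor
  · intro hb
    have hb' := singleton_mem_faces (f τ).2 hb
    obtain ⟨h1, h2⟩ := vertexMap_symm f.symm hb'
    rw [OrderIso.symm_symm] at h2
    exact ⟨_, (hmem _ h1).1 (h2.symm ▸ hb), h2⟩
  · rintro ⟨a, ha, rfl⟩
    exact (hmem a (singleton_mem_faces τ.2 ha)).2 ha

/-- A truncation may choose its own dual complex, so realizability has to depend only on the simplex
poset. -/
lemma IsRealizable.of_orderIso {n : ℕ} (h : IsRealizable n K) (f : Simplex K ≃o Simplex K') :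
    IsRealizable n K' := by
  obtain ⟨D, G, T, S, h⟩ := h
  have hmem : ∀ τ ∈ D, τ.image (vertexMap f) = ∅ ∨ τ.image (vertexMap f) ∈ K'.faces := by
    intro τ hτ
    rw [← orderIso_apply_eq_image f ⟨τ, (h.mem_iff τ).1 hτ⟩]
    exact (f _).2
  have hmem' : ∀ τ, τ = ∅ ∨ τ ∈ K'.faces → τ.image (vertexMap f.symm) ∈ D := by
    intro τ hτ
    rw [← orderIso_apply_eq_image f.symm ⟨τ, hτ⟩]
    exact (h.mem_iff _).2 (f.symm _).2
  have hinv : ∀ τ, τ = ∅ ∨ τ ∈ K'.faces → ∀ b ∈ τ, vertexMap f (vertexMap f.symm b) = b := by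
    intro τ hτ b hb
    have := (vertexMap_symm f.symm (singleton_mem_faces hτ hb)).2
    rwa [OrderIso.symm_symm] at this
  have hD' : ∀ τ, τ ∈ D.image (Finset.image (vertexMap f)) ↔ τ = ∅ ∨ τ ∈ K'.faces := by
    intro τ
    rw [Finset.mem_image]
    constructor
    · rintro ⟨τ, hτ, rfl⟩
      exact hmem τ hτ
    · exact fun hτ => ⟨_, hmem' τ hτ, image_image_of_leftInvOn (hinv τ hτ)⟩
  refine ⟨_, G, T, _, h.transfer (p := vertexMap f) (q := vertexMap f.symm)
    (fun τ hτ => Finset.mem_image_of_mem _ hτ) (fun τ hτ => hmem' τ ((hD' τ).1 hτ))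
    (fun τ hτ a ha => ?_) (fun τ hτ => hinv τ ((hD' τ).1 hτ)) hD'⟩
  exact (vertexMap_symm f (singleton_mem_faces ((h.mem_iff τ).1 hτ) ha)).2

end VertexMap

/-! ### The cross polytope -/

/-- The simplices of the boundary of the `n`-dimensional cross polytope, whose pairs of opposite
vertices are `{2i, 2i+1}`. -/
def crossFaces (n : ℕ) : Finset (Finset ℕ) :=
  (range (2 * n)).powerset.filter fun τ => ∀ a ∈ τ, ∀ b ∈ τ, a / 2 = b / 2 → a = b

lemma mem_crossFaces {n : ℕ} {τ : Finset ℕ} :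
    τ ∈ crossFaces n ↔ (∀ a ∈ τ, a < 2 * n) ∧ ∀ a ∈ τ, ∀ b ∈ τ, a / 2 = b / 2 → a = b := by
  rw [crossFaces, Finset.mem_filter, Finset.mem_powerset]
  exact and_congr_left fun _ => forall₂_congr fun a _ => Finset.mem_range

lemma crossFaces_subset {n : ℕ} : ∀ τ ∈ crossFaces n, ∀ σ ⊆ τ, σ ∈ crossFaces n := by
  intro τ hτ σ hσ
  rw [mem_crossFaces] at hτ ⊢
  exact ⟨fun a ha => hτ.1 a (hσ ha), fun a ha b hb => hτ.2 a (hσ ha) b (hσ hb)⟩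

/-- The boundary complex of the `n`-dimensional cross polytope. -/
def crossComplex (n : ℕ) : PreAbstractSimplicialComplex ℕ where
  faces := {τ | τ.Nonempty ∧ τ ∈ crossFaces n}
  isRelLowerSet_faces := fun _ hτ => ⟨hτ.1, fun _ hσ hne => ⟨hne, crossFaces_subset _ hτ.2 _ hσ⟩⟩

lemma mem_crossFaces_iff {n : ℕ} (τ : Finset ℕ) :
    τ ∈ crossFaces n ↔ τ = ∅ ∨ τ ∈ (crossComplex n).faces := by
  rcases τ.eq_empty_or_nonempty with rfl | hne
  · simp [mem_crossFaces]
  · rw [or_iff_right hne.ne_empty]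
    exact ⟨fun h => ⟨hne, h⟩, fun h => h.2⟩

lemma card_le_of_mem_crossFaces {n : ℕ} {τ : Finset ℕ} (hτ : τ ∈ crossFaces n) : #τ ≤ n := by
  rw [mem_crossFaces] at hτ
  calc #τ = #(τ.image (· / 2)) := (Finset.card_image_of_injOn fun a ha b hb => hτ.2 a ha b hb).symm
    _ ≤ #(range n) := Finset.card_le_card fun c hc => by
      obtain ⟨a, ha, rfl⟩ := Finset.mem_image.1 hc
      have := hτ.1 a ha
      exact Finset.mem_range.2 (by omega)
    _ = n := Finset.card_range n

lemma insert_mem_crossFaces {n c : ℕ} {ρ : Finset ℕ} (hc : c / 2 = n) (hρ : c ∉ ρ) :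
    insert c ρ ∈ crossFaces (n + 1) ↔ ρ ∈ crossFaces n := by
  rw [mem_crossFaces, mem_crossFaces]
  constructor
  · rintro ⟨h1, h2⟩
    refine ⟨fun a ha => ?_, fun a ha b hb => h2 a (by simp [ha]) b (by simp [hb])⟩
    have h3 := h1 a (by simp [ha])
    by_contra h4
    exact hρ (h2 a (by simp [ha]) c (by simp) (by omega) ▸ ha)
  · rintro ⟨h1, h2⟩
    refine ⟨fun a ha => ?_, fun a ha b hb hab => ?_⟩
    · rcases Finset.mem_insert.1 ha with rfl | ha
      · omega
      · have := h1 a ha; omega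
    · rcases Finset.mem_insert.1 ha with rfl | ha' <;>
        rcases Finset.mem_insert.1 hb with rfl | hb'
      · rfl
      · have := h1 b hb'; omega
      · have := h1 a ha'; omega
      · exact h2 a ha' b hb' hab

lemma notMem_of_mem_crossFaces {n c : ℕ} (hc : n ≤ c / 2) : ∀ τ ∈ crossFaces n, c ∉ τ :=
  fun τ hτ h => by have := (mem_crossFaces.1 hτ).1 c h; omega

/-- The boundary is the suspension of the previous one with apexes `2 * n` and `2 * n + 1`. -/
lemma crossFaces_succ (n : ℕ) : crossFaces (n + 1) =
    (crossFaces n ∪ (crossFaces n).image (insert (2 * n))) ∪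
      (crossFaces n).image (insert (2 * n + 1)) := by
  have hins : ∀ c, c / 2 = n → ∀ ρ ∈ crossFaces n, insert c ρ ∈ crossFaces (n + 1) :=
    fun c hc ρ hρ => (insert_mem_crossFaces hc (notMem_of_mem_crossFaces hc.ge ρ hρ)).2 hρ
  have hera : ∀ c, c / 2 = n → ∀ τ ∈ crossFaces (n + 1), c ∈ τ →
      τ ∈ (crossFaces n).image (insert c) := fun c hc τ hτ h => by
    rw [← Finset.insert_erase h] at hτ ⊢
    exact Finset.mem_image_of_mem _ ((insert_mem_crossFaces hc (Finset.notMem_erase c τ)).1 hτ)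
  ext τ
  rw [Finset.mem_union, Finset.mem_union]
  constructor
  · intro hτ
    by_cases h1 : 2 * n + 1 ∈ τ
    · exact Or.inr (hera _ (by omega) τ hτ h1)
    by_cases h2 : 2 * n ∈ τ
    · exact Or.inl (Or.inr (hera _ (by omega) τ hτ h2))
    refine Or.inl (Or.inl ?_)
    rw [mem_crossFaces] at hτ ⊢
    refine ⟨fun a ha => ?_, hτ.2⟩
    have h3 := hτ.1 a ha
    have h4 : a ≠ 2 * n := fun h => h2 (h ▸ ha)
    have h5 : a ≠ 2 * n + 1 := fun h => h1 (h ▸ ha)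
    omega
  · rintro ((h | h) | h)
    · rw [mem_crossFaces] at h ⊢
      exact ⟨fun a ha => by have := h.1 a ha; omega, h.2⟩
    · obtain ⟨ρ, hρ, rfl⟩ := Finset.mem_image.1 h
      exact hins _ (by omega) ρ hρ
    · obtain ⟨ρ, hρ, rfl⟩ := Finset.mem_image.1 h
      exact hins _ (by omega) ρ hρ

lemma upSum_crossFaces {n : ℕ} {σ : Finset ℕ} (hσ : σ ∈ crossFaces n) (x : ℚ) :
    upSum (crossFaces n) σ x = x ^ #σ * (1 + 2 * x) ^ (n - #σ) := by
  induction n generalizing σ with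
  | zero =>
    have h0 := Finset.card_eq_zero.1 (Nat.le_zero.1 (card_le_of_mem_crossFaces hσ))
    subst h0
    have : crossFaces 0 = {∅} := rfl
    simp [upSum, this]
  | succ n ih =>
    have hA1 : ∀ τ ∈ crossFaces n ∪ (crossFaces n).image (insert (2 * n)), 2 * n + 1 ∉ τ := by
      intro τ hτ
      rcases Finset.mem_union.1 hτ with h | h
      · exact notMem_of_mem_crossFaces (by omega) τ h
      · obtain ⟨ρ, hρ, rfl⟩ := Finset.mem_image.1 h
        rw [Finset.mem_insert, not_or]
        exact ⟨by omega, notMem_of_mem_crossFaces (by omega) ρ hρ⟩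
    have h1 : ∀ τ ∈ crossFaces n, 2 * n + 1 ∉ τ := notMem_of_mem_crossFaces (by omega)
    have h0 : ∀ τ ∈ crossFaces n, 2 * n ∉ τ := notMem_of_mem_crossFaces (by omega)
    rw [crossFaces_succ]
    have hle : ∀ ρ ∈ crossFaces n, #ρ ≤ n := fun ρ => card_le_of_mem_crossFaces
    by_cases hσ1 : 2 * n + 1 ∈ σ
    · obtain ⟨ρ, hρ, rfl⟩ : ∃ ρ, 2 * n + 1 ∉ ρ ∧ σ = insert (2 * n + 1) ρ :=
        ⟨_, Finset.notMem_erase _ σ, (Finset.insert_erase hσ1).symm⟩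
      rw [insert_mem_crossFaces (by omega) hρ] at hσ
      rw [upSum_union_image_insert' hA1 h1 hρ, ih hσ, Finset.card_insert_of_notMem hρ,
        Nat.add_sub_add_right]
      ring
    by_cases hσ0 : 2 * n ∈ σ
    · obtain ⟨ρ, hρ, rfl⟩ : ∃ ρ, 2 * n ∉ ρ ∧ σ = insert (2 * n) ρ :=
        ⟨_, Finset.notMem_erase _ σ, (Finset.insert_erase hσ0).symm⟩
      rw [insert_mem_crossFaces (by omega) hρ] at hσ
      rw [upSum_union_image_insert hA1 h1 hσ1, upSum_union_image_insert' h0 h0 hρ, ih hσ,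
        upSum_eq_zero crossFaces_subset fun h => h0 _ h (Finset.mem_insert_self _ _),
        Finset.card_insert_of_notMem hρ, Nat.add_sub_add_right]
      ring
    · have hσ' : σ ∈ crossFaces n := by
        rw [mem_crossFaces] at hσ ⊢
        refine ⟨fun a ha => ?_, hσ.2⟩
        have h3 := hσ.1 a ha
        have h4 : a ≠ 2 * n := fun h => hσ0 (h ▸ ha)
        have h5 : a ≠ 2 * n + 1 := fun h => hσ1 (h ▸ ha)
        omega
      have := hle σ hσ'
      rw [upSum_union_image_insert hA1 h1 hσ1, upSum_union_image_insert h0 h0 hσ0, ih hσ',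
        show n + 1 - #σ = n - #σ + 1 by omega]
      ring

/-- The graph has no vertices, and the empty clique accounts for the powers of `1 + 2 * x` of all
links. -/
lemma isRealizable_crossComplex (n : ℕ) : IsRealizable n (crossComplex n) := by
  refine ⟨crossFaces n, ⊥, ∅, fun _ => ∅, mem_crossFaces_iff, fun τ hτ => ?_, fun σ hσ s hs _ => ?_,
    fun σ hσ x _ => ?_⟩
  · rw [mem_crossFaces]
    refine ⟨fun a ha => (mem_crossFaces.1 (hτ a ha a ha)).1 a (by simp), fun a ha b hb => ?_⟩
    exact (mem_crossFaces.1 (hτ a ha b hb)).2 a (by simp) b (by simp)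
  · have : s = ∅ := Finset.subset_empty.1 (hs.trans (Finset.filter_subset _ _))
    simpa [this] using card_le_of_mem_crossFaces hσ
  · have h0 : supp ∅ (fun _ => ∅) σ = ∅ := rfl
    have h1 : allCliques (⊥ : SimpleGraph ℕ) ∅ = {∅} := by
      ext s
      rw [mem_allCliques, Finset.subset_empty, Finset.mem_singleton, and_iff_left_iff_imp]
      rintro rfl
      simp
    rw [upSum_crossFaces hσ, h0, cliqueSum, h1]
    simp

/-! ### Dimensions of faces -/

section Dimension

variable {n : ℕ} {P F G : Set (EuclideanSpace ℝ (Fin n))} {K : PreAbstractSimplicialComplex ℕ}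

lemma IsFace.subset (hF : IsFace P F) : F ⊆ P := hF.1.subset

/-- A functional exposing `F` vanishes on the directions of `F`. If `G` had the same directions, all
of `G` would be maximal and lie in `F`. -/
lemma faceDim_lt_faceDim (hF : IsFace P F) (hG : IsFace P G) (h : F ⊂ G) :
    faceDim F < faceDim G := by
  obtain ⟨l, hl⟩ := hF.1 hF.2
  obtain ⟨y, hy⟩ := hF.2
  obtain ⟨x, hxG, hxF⟩ := Set.exists_of_ssubset h
  have hmax : ∀ z ∈ F, ∀ w ∈ P, l w ≤ l z := fun z hz => by
    rw [hl] at hz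
    exact hz.2
  refine Submodule.finrank_lt_finrank_of_lt
    (lt_of_le_of_ne (vectorSpan_mono ℝ h.1) fun heq => hxF ?_)
  have hker : vectorSpan ℝ F ≤ LinearMap.ker (l : EuclideanSpace ℝ (Fin n) →ₗ[ℝ] ℝ) := by
    rw [vectorSpan_def, Submodule.span_le]
    rintro _ ⟨p, hp, q, hq, rfl⟩
    have h1 := hmax p hp q (hF.subset hq)
    have h2 := hmax q hq p (hF.subset hp)
    simp only [vsub_eq_sub, SetLike.mem_coe, LinearMap.mem_ker, ContinuousLinearMap.coe_coe,
      map_sub]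
    linarith
  have hxy : x -ᵥ y ∈ vectorSpan ℝ F := heq ▸ vsub_mem_vectorSpan ℝ hxG (h.1 hy)
  have h0 := hker hxy
  simp only [vsub_eq_sub, LinearMap.mem_ker, ContinuousLinearMap.coe_coe, map_sub] at h0
  rw [hl]
  refine ⟨hG.subset hxG, fun z hz => ?_⟩
  have := hmax y hy z hz
  linarith

lemma IsSimplePolytope.isFace_self (hP : IsSimplePolytope P) : IsFace P P := by
  refine ⟨IsExposed.refl P, ?_⟩
  rw [Set.nonempty_iff_ne_empty]
  rintro rfl
  have h := hP.full_dim
  rw [AffineSubspace.span_empty] at h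
  exact AffineSubspace.bot_ne_top _ _ _ h

lemma IsSimplePolytope.faceDim_self (hP : IsSimplePolytope P) : faceDim P = n := by
  rw [faceDim, ← direction_affineSpan, hP.full_dim, AffineSubspace.direction_top, finrank_top,
    finrank_euclideanSpace_fin]

/-- Tilt the functional `l` exposing `F` by a small multiple of a functional `g` separating `p` from
`q`. Equivalently, expose by a large multiple of `l` plus `g`; on the finitely many generators this
selects a lexicographic maximum. -/
lemma exists_isFace_ssubset {S : Set (EuclideanSpace ℝ (Fin n))} (hS : S.Finite)
    (hP : P = convexHull ℝ S) (hF : IsFace P F) {p q : EuclideanSpace ℝ (Fin n)} (hp : p ∈ F)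
    (hq : q ∈ F) (hpq : p ≠ q) : ∃ F', IsFace P F' ∧ F' ⊂ F := by
  obtain ⟨l, hl⟩ := hF.1 hF.2
  let g : StrongDual ℝ (EuclideanSpace ℝ (Fin n)) := innerSL ℝ (p - q)
  have hg : g p ≠ g q := by
    intro h
    have h' : g (p - q) = 0 := by rw [map_sub, h, sub_self]
    exact hpq (sub_eq_zero.1 (inner_self_eq_zero.1 h'))
  have hSP : S ⊆ P := hP ▸ subset_convexHull ℝ S
  have hSne : S.Nonempty := by
    rw [← convexHull_nonempty_iff (𝕜 := ℝ), ← hP]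
    exact ⟨p, hF.subset hp⟩
  have hconv : ∀ (h : StrongDual ℝ (EuclideanSpace ℝ (Fin n))) (c : ℝ), (∀ s ∈ S, h s ≤ c) →
      ∀ x ∈ P, h x ≤ c := by
    intro h c hc x hx
    rw [hP] at hx
    exact convexHull_min hc (convex_halfSpace_le (LinearMap.isLinear h.toLinearMap) c) hx
  obtain ⟨s₀, hs₀, hmax⟩ := Set.exists_max_image S (fun s => toLex (l s, g s)) hS hSne
  have hlex : ∀ s ∈ S, l s < l s₀ ∨ l s = l s₀ ∧ g s ≤ g s₀ := fun s hs =>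
    (Prod.Lex.toLex_le_toLex).1 (hmax s hs)
  have hls : ∀ x ∈ P, l x ≤ l s₀ :=
    hconv l _ fun s hs => (hlex s hs).elim le_of_lt fun h => h.1.le
  obtain ⟨N, hN⟩ : ∃ N : ℝ, ∀ s ∈ S, N * l s + g s ≤ N * l s₀ + g s₀ := by
    have : ∀ᶠ N : ℝ in Filter.atTop, ∀ s ∈ S, N * l s + g s ≤ N * l s₀ + g s₀ := by
      rw [Filter.eventually_all_finite hS]
      intro s hs
      rcases hlex s hs with h | h
      · filter_upwards [Filter.eventually_ge_atTop ((g s - g s₀) / (l s₀ - l s))] with N hN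
        rw [div_le_iff₀ (sub_pos.2 h)] at hN
        linarith
      · exact Filter.Eventually.of_forall fun N => by rw [h.1]; linarith [h.2]
    exact this.exists
  have hNP : ∀ x ∈ P, N * l x + g x ≤ N * l s₀ + g s₀ := by
    have := hconv (N • l + g) (N * l s₀ + g s₀) (by simpa using hN)
    simpa using this
  -- The extra copy of `l` forces a maximizer of `h` to maximize `l` and `N • l + g` separately,
  -- hence to lie in `F` with a fixed value of `g`.
  let h : StrongDual ℝ (EuclideanSpace ℝ (Fin n)) := (N + 1) • l + g
  have hh : ∀ x, h x = (N * l x + g x) + l x := fun x => by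
    simp only [h, add_apply, smul_apply, smul_eq_mul]
    ring
  have hF' : ∀ x ∈ P, (∀ y ∈ P, h y ≤ h x) → x ∈ F ∧ g x = g s₀ := by
    intro x hx hxm
    have h1 := hxm s₀ (hSP hs₀)
    rw [hh, hh] at h1
    have h2 := hNP x hx
    have h3 := hls x hx
    have h4 : l x = l s₀ := by linarith
    refine ⟨?_, ?_⟩
    · rw [hl]
      exact ⟨hx, fun y hy => h4 ▸ hls y hy⟩
    · rw [h4] at h1 h2
      linarith
  refine ⟨{x ∈ P | ∀ y ∈ P, h y ≤ h x}, ⟨fun _ => ⟨h, rfl⟩, s₀, hSP hs₀, fun y hy => ?_⟩, ?_⟩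
  · rw [hh, hh]
    linarith [hNP y hy, hls y hy]
  · refine Set.ssubset_iff_subset_ne.2 ⟨fun x hx => (hF' x hx.1 hx.2).1, fun heq => hg ?_⟩
    rw [← heq] at hp hq
    rw [(hF' p hp.1 hp.2).2, (hF' q hq.1 hq.2).2]

lemma faceDim_eq_zero_of_minimal (hP : IsSimplePolytope P) (hF : IsFace P F)
    (hmin : ∀ F', IsFace P F' → ¬ F' ⊂ F) : faceDim F = 0 := by
  obtain ⟨S, hS, hPS⟩ := hP.exists_finite
  have hsub : F.Subsingleton := fun p hp q hq => by
    by_contra hpq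
    obtain ⟨F', h1, h2⟩ := exists_isFace_ssubset hS hPS hF hp hq hpq
    exact hmin F' h1 h2
  rw [faceDim, vectorSpan_of_subsingleton ℝ hsub, finrank_bot]

/-- The face of `P` that corresponds to a simplex. -/
def faceOf (φ : DualBoundaryIso P K) (τ : Simplex K) : Face P := φ.symm (OrderDual.toDual τ)

/-- The simplex that corresponds to a face of `P`. -/
def simplexOf (φ : DualBoundaryIso P K) (F : Face P) : Simplex K := OrderDual.ofDual (φ F)

section

variable (φ : DualBoundaryIso P K)

lemma faceOf_simplexOf (F : Face P) : faceOf φ (simplexOf φ F) = F := φ.symm_apply_apply F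

lemma simplexOf_faceOf (τ : Simplex K) : simplexOf φ (faceOf φ τ) = τ :=
  congrArg OrderDual.ofDual (φ.apply_symm_apply (OrderDual.toDual τ))

lemma faceOf_le_faceOf {σ τ : Simplex K} : faceOf φ τ ≤ faceOf φ σ ↔ σ ≤ τ :=
  φ.symm.le_iff_le

lemma faceOf_lt_faceOf {σ τ : Simplex K} : faceOf φ τ < faceOf φ σ ↔ σ < τ :=
  φ.symm.lt_iff_lt

lemma faceOf_empty (hP : IsSimplePolytope P) : (faceOf φ ⟨∅, Or.inl rfl⟩).1 = P := by
  refine subset_antisymm (faceOf φ _).2.subset ?_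
  have h : (⟨P, hP.isFace_self⟩ : Face P) ≤ faceOf φ ⟨∅, Or.inl rfl⟩ := by
    rw [← faceOf_simplexOf φ ⟨P, hP.isFace_self⟩, faceOf_le_faceOf]
    exact Finset.empty_subset _
  exact h

/-- Each added vertex of the simplex lowers the dimension of the face by at least one. -/
lemma faceDim_faceOf_add_card_le {σ τ : Simplex K} (h : σ.1 ⊆ τ.1) :
    faceDim (faceOf φ τ).1 + #τ.1 ≤ faceDim (faceOf φ σ).1 + #σ.1 := by
  induction hk : #(τ.1 \ σ.1) generalizing σ with
  | zero =>
    have : σ = τ := Subtype.ext (subset_antisymm h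
      (Finset.sdiff_eq_empty_iff_subset.1 (Finset.card_eq_zero.1 hk)))
    rw [this]
  | succ k ih =>
    obtain ⟨a, ha⟩ := Finset.card_pos.1 (show 0 < #(τ.1 \ σ.1) by omega)
    obtain ⟨ha, ha'⟩ := Finset.mem_sdiff.1 ha
    have hsub : insert a σ.1 ⊆ τ.1 := Finset.insert_subset ha h
    have h1 := ih (σ := ⟨insert a σ.1, simplex_subset τ.2 hsub⟩) hsub (by
      have := Finset.card_sdiff_of_subset hsub
      have h2 := Finset.card_sdiff_of_subset h
      rw [Finset.card_insert_of_notMem ha'] at this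
      simp only at this ⊢
      omega)
    have h2 : faceDim (faceOf φ ⟨insert a σ.1, simplex_subset τ.2 hsub⟩).1 <
        faceDim (faceOf φ σ).1 := by
      refine faceDim_lt_faceDim (faceOf φ _).2 (faceOf φ _).2 ?_
      exact (faceOf_lt_faceOf φ).2 (Finset.ssubset_insert ha')
    simp only [Finset.card_insert_of_notMem ha'] at h1
    omega

lemma faceDim_faceOf_add_card_le_dim (hP : IsSimplePolytope P) (τ : Simplex K) :
    faceDim (faceOf φ τ).1 + #τ.1 ≤ n := by
  have h := faceDim_faceOf_add_card_le φ (σ := ⟨∅, Or.inl rfl⟩) (τ := τ) (Finset.empty_subset _)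
  rwa [faceOf_empty φ hP, hP.faceDim_self, Finset.card_empty, add_zero] at h

/-- By simplicity `n` facets contain the vertex. A facet has a one-element simplex by the dimension
bound, so these facets come from distinct elements of `τ`. -/
lemma le_card_of_faceDim_eq_zero (hP : IsSimplePolytope P) {τ : Simplex K}
    (h : faceDim (faceOf φ τ).1 = 0) : n ≤ #τ.1 := by
  classical
  let f : ℕ → Set (EuclideanSpace ℝ (Fin n)) := fun a =>
    if ha : {a} ∈ K.faces then (faceOf φ ⟨{a}, Or.inr ha⟩).1 else ∅
  have hsub : {F | IsFace P F ∧ faceDim F + 1 = n ∧ (faceOf φ τ).1 ⊆ F} ⊆ f '' (τ.1 : Set ℕ) := by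
    rintro F ⟨hF, hd, hV⟩
    have h1 := faceDim_faceOf_add_card_le_dim φ hP (simplexOf φ ⟨F, hF⟩)
    have h2 := faceOf_simplexOf φ ⟨F, hF⟩
    have hle : simplexOf φ ⟨F, hF⟩ ≤ τ := by
      rw [← faceOf_le_faceOf φ, h2]
      exact hV
    rw [h2] at h1
    have hne : #(simplexOf φ ⟨F, hF⟩).1 ≠ 0 := by
      intro h0
      have h3 : simplexOf φ ⟨F, hF⟩ = ⟨∅, Or.inl rfl⟩ := Subtype.ext (Finset.card_eq_zero.1 h0)
      rw [h3] at h2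
      have h4 : F = P := (congrArg Subtype.val h2).symm.trans (faceOf_empty φ hP)
      rw [h4, hP.faceDim_self] at hd
      omega
    obtain ⟨a, ha⟩ := Finset.card_eq_one.1
      (show #(simplexOf φ ⟨F, hF⟩).1 = 1 by simp only at h1; omega)
    have hmem : a ∈ (simplexOf φ ⟨F, hF⟩).1 := ha ▸ Finset.mem_singleton_self a
    have hK := singleton_mem_faces (simplexOf φ ⟨F, hF⟩).2 hmem
    refine ⟨a, hle hmem, ?_⟩
    simp only [f, dif_pos hK]
    rw [show (⟨{a}, Or.inr hK⟩ : Simplex K) = simplexOf φ ⟨F, hF⟩ from Subtype.ext ha.symm, h2]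
  calc n = Set.ncard _ := (hP.simple _ (faceOf φ τ).2 h).symm
    _ ≤ Set.ncard (f '' (τ.1 : Set ℕ)) := Set.ncard_le_ncard hsub
        ((Finset.finite_toSet _).image f)
    _ ≤ Set.ncard (τ.1 : Set ℕ) := Set.ncard_image_le (Finset.finite_toSet _)
    _ = #τ.1 := Set.ncard_coe_finset _

end

lemma exists_maximal_simplex (φ : DualBoundaryIso P K) (hP : IsSimplePolytope P) (σ : Simplex K) :
    ∃ τ : Simplex K, σ.1 ⊆ τ.1 ∧ ∀ ρ : Simplex K, ¬ τ < ρ := by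
  induction hk : n - #σ.1 using Nat.strong_induction_on generalizing σ with
  | _ k ih =>
    by_cases h : ∀ ρ : Simplex K, ¬ σ < ρ
    · exact ⟨σ, subset_rfl, h⟩
    · push Not at h
      obtain ⟨ρ, hρ⟩ := h
      have h1 := Finset.card_lt_card (show σ.1 ⊂ ρ.1 from hρ)
      have h2 := faceDim_faceOf_add_card_le_dim φ hP ρ
      obtain ⟨τ, h3, h4⟩ := ih (n - #ρ.1) (by omega) ρ rfl
      exact ⟨τ, (show σ.1 ⊆ ρ.1 from hρ.le).trans h3, h4⟩

/-- Extend `σ` to a maximal simplex. Its face has dimension 0 and the simplex has at least `n`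
elements, so no dimension drop along the way exceeds one. -/
lemma faceDim_faceOf_add_card (φ : DualBoundaryIso P K) (hP : IsSimplePolytope P) (σ : Simplex K) :
    faceDim (faceOf φ σ).1 + #σ.1 = n := by
  refine le_antisymm (faceDim_faceOf_add_card_le_dim φ hP σ) ?_
  obtain ⟨τ, h1, h2⟩ := exists_maximal_simplex φ hP σ
  have h3 : faceDim (faceOf φ τ).1 = 0 := by
    refine faceDim_eq_zero_of_minimal hP (faceOf φ τ).2 fun F' hF' hlt => ?_
    refine h2 (simplexOf φ ⟨F', hF'⟩) ?_
    rw [← faceOf_lt_faceOf φ, faceOf_simplexOf]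
    exact hlt
  have h4 := faceDim_faceOf_add_card_le φ h1
  have h5 := le_card_of_faceDim_eq_zero φ hP h3
  omega

lemma faceCount_eq (φ : DualBoundaryIso P K) (hP : IsSimplePolytope P) {D : Finset (Finset ℕ)}
    (hD : ∀ τ, τ ∈ D ↔ τ = ∅ ∨ τ ∈ K.faces) (i : ℕ) :
    faceCount P i = #(D.filter fun τ => i + #τ = n) := by
  rw [faceCount, ← Set.ncard_coe_finset]
  refine Set.ncard_congr (fun F hF => (simplexOf φ ⟨F, hF.1⟩).1) ?_ ?_ ?_
  · rintro F ⟨hF, rfl⟩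
    have := faceDim_faceOf_add_card φ hP (simplexOf φ ⟨F, hF⟩)
    rw [faceOf_simplexOf] at this
    exact Finset.mem_coe.2 (Finset.mem_filter.2 ⟨(hD _).2 (simplexOf φ ⟨F, hF⟩).2, this⟩)
  · intro F F' hF hF' h
    have h1 := congrArg (faceOf φ) (Subtype.ext h)
    rw [faceOf_simplexOf, faceOf_simplexOf] at h1
    exact congrArg Subtype.val h1
  · intro τ hτ
    obtain ⟨h1, h2⟩ := Finset.mem_filter.1 (Finset.mem_coe.1 hτ)
    refine ⟨(faceOf φ ⟨τ, (hD τ).1 h1⟩).1, ⟨(faceOf φ _).2, ?_⟩, ?_⟩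
    · have := faceDim_faceOf_add_card φ hP ⟨τ, (hD τ).1 h1⟩
      simp only at this
      omega
    · exact congrArg Subtype.val (simplexOf_faceOf φ ⟨τ, (hD τ).1 h1⟩)

end Dimension

/-! ### The faces of the cube -/

section Cube

variable {n : ℕ}

lemma apply_eq_sum (l : StrongDual ℝ (EuclideanSpace ℝ (Fin n))) (x : EuclideanSpace ℝ (Fin n)) :
    l x = ∑ i, l (EuclideanSpace.single i 1) * x i := by
  conv_lhs => rw [← (EuclideanSpace.basisFun (Fin n) ℝ).sum_repr x]
  simp [mul_comm]

/-- The cube is a product, so a linear functional is maximized in each coordinate separately. -/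
lemma maximizers_stdCube (l : StrongDual ℝ (EuclideanSpace ℝ (Fin n))) :
    {x ∈ stdCube n | ∀ y ∈ stdCube n, l y ≤ l x} =
      {x ∈ stdCube n | ∀ i, (0 < l (EuclideanSpace.single i 1) → x i = 1) ∧
        (l (EuclideanSpace.single i 1) < 0 → x i = 0)} := by
  ext x
  refine and_congr_right fun hx => ⟨fun h i => ?_, fun h y hy => ?_⟩
  · have key : ∀ c : ℝ, 0 ≤ c → c ≤ 1 → (c - x i) * l (EuclideanSpace.single i 1) ≤ 0 := by
      intro c h0 h1
      have h2 := h (x + (c - x i) • EuclideanSpace.single i 1) fun j => by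
        by_cases hj : j = i
        · subst hj
          simp [h0, h1]
        · simpa [hj] using hx j
      rw [map_add, map_smul, smul_eq_mul] at h2
      linarith
    constructor
    · intro hl
      have h2 := key 1 zero_le_one le_rfl
      have h3 := (hx i).2
      nlinarith
    · intro hl
      have h2 := key 0 le_rfl zero_le_one
      have h3 := (hx i).1
      nlinarith
  · rw [apply_eq_sum l, apply_eq_sum l x]
    refine Finset.sum_le_sum fun i _ => ?_
    rcases lt_trichotomy (l (EuclideanSpace.single i 1)) 0 with hl | hl | hl
    · rw [(h i).2 hl, mul_zero]
      exact mul_nonpos_of_nonpos_of_nonneg hl.le (hy i).1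
    · rw [hl, zero_mul, zero_mul]
    · rw [(h i).1 hl]
      exact mul_le_mul_of_nonneg_left (hy i).2 hl.le

/-- The face of the cube on which the coordinates in `σ` are fixed: `2i ∈ σ` means `x i = 0` and
`2i + 1 ∈ σ` means `x i = 1`. -/
def cubeFace (n : ℕ) (σ : Finset ℕ) : Set (EuclideanSpace ℝ (Fin n)) :=
  {x ∈ stdCube n | ∀ i : Fin n, (2 * i.1 + 1 ∈ σ → x i = 1) ∧ (2 * i.1 ∈ σ → x i = 0)}

open Classical in
/-- The centre of a face of the cube. -/
noncomputable def cubeCenter (n : ℕ) (σ : Finset ℕ) : EuclideanSpace ℝ (Fin n) :=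
  WithLp.toLp 2 fun i => if 2 * i.1 + 1 ∈ σ then 1 else if 2 * i.1 ∈ σ then 0 else 1 / 2

lemma notMem_or_notMem {σ : Finset ℕ} (hσ : σ ∈ crossFaces n) {i : ℕ} (h : 2 * i + 1 ∈ σ) :
    2 * i ∉ σ := fun h' => by
  have := (mem_crossFaces.1 hσ).2 _ h _ h' (by omega)
  omega

lemma cubeCenter_mem {σ : Finset ℕ} (hσ : σ ∈ crossFaces n) : cubeCenter n σ ∈ cubeFace n σ := by
  refine ⟨fun i => ?_, fun i => ⟨fun h => ?_, fun h => ?_⟩⟩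
  · simp only [cubeCenter]
    split_ifs <;> norm_num
  · simp [cubeCenter, h]
  · have : 2 * i.1 + 1 ∉ σ := fun h' => notMem_or_notMem hσ h' h
    simp [cubeCenter, h, this]

lemma isFace_cubeFace {σ : Finset ℕ} (hσ : σ ∈ crossFaces n) :
    IsFace (stdCube n) (cubeFace n σ) := by
  classical
  refine ⟨fun _ => ?_, _, cubeCenter_mem hσ⟩
  let c : Fin n → ℝ := fun i => if 2 * i.1 + 1 ∈ σ then 1 else if 2 * i.1 ∈ σ then -1 else 0
  let l : StrongDual ℝ (EuclideanSpace ℝ (Fin n)) :=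
    ∑ i, c i • (EuclideanSpace.proj i : EuclideanSpace ℝ (Fin n) →L[ℝ] ℝ)
  have hl : ∀ i, l (EuclideanSpace.single i 1) = c i := fun i => by
    simp [l]
  refine ⟨l, ?_⟩
  rw [maximizers_stdCube]
  ext x
  refine and_congr_right fun _ => forall_congr' fun i => ?_
  rw [hl]
  by_cases h1 : 2 * i.1 + 1 ∈ σ
  · simp [c, h1, notMem_or_notMem hσ h1, not_lt.2 (zero_le_one (α := ℝ))]
  · by_cases h0 : 2 * i.1 ∈ σ
    · simp [c, h1, h0]
    · simp [c, h1, h0]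

lemma exists_eq_cubeFace {F : Set (EuclideanSpace ℝ (Fin n))} (hF : IsFace (stdCube n) F) :
    ∃ σ ∈ crossFaces n, F = cubeFace n σ := by
  classical
  obtain ⟨l, hl⟩ := hF.1 hF.2
  let c : ℕ → ℝ := fun i => if h : i < n then l (EuclideanSpace.single ⟨i, h⟩ 1) else 0
  -- The signs of the coefficients of `l` say which coordinates are fixed, and at which value.
  let σ := (range (2 * n)).filter fun a =>
    (a % 2 = 1 ∧ 0 < c (a / 2)) ∨ (a % 2 = 0 ∧ c (a / 2) < 0)
  refine ⟨σ, ?_, ?_⟩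
  · rw [mem_crossFaces]
    refine ⟨fun a ha => Finset.mem_range.1 (Finset.mem_filter.1 ha).1, fun a ha b hb hab => ?_⟩
    have h1 := (Finset.mem_filter.1 ha).2
    have h2 := (Finset.mem_filter.1 hb).2
    rw [← hab] at h2
    rcases h1 with h1 | h1 <;> rcases h2 with h2 | h2
    · omega
    · linarith [h1.2, h2.2]
    · linarith [h1.2, h2.2]
    · omega
  · rw [hl, maximizers_stdCube]
    ext x
    refine and_congr_right fun _ => forall_congr' fun i => ?_
    have hc : c i.1 = l (EuclideanSpace.single i 1) := by simp [c]
    have h1 : 2 * i.1 + 1 ∈ σ ↔ 0 < l (EuclideanSpace.single i 1) := by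
      have e1 : (2 * i.1 + 1) / 2 = i.1 := by omega
      have e2 : (2 * i.1 + 1) % 2 = 1 := by omega
      have e3 : 2 * i.1 + 1 < 2 * n := by omega
      simp [σ, e1, e2, e3, hc]
    have h0 : 2 * i.1 ∈ σ ↔ l (EuclideanSpace.single i 1) < 0 := by
      have e1 : (2 * i.1) / 2 = i.1 := by omega
      have e2 : (2 * i.1) % 2 = 0 := by omega
      have e3 : 2 * i.1 < 2 * n := by omega
      simp [σ, hc]
    rw [h1, h0]

/-- The centre of a face has coordinates 0 or 1 only where `σ` prescribes them, so the inclusion can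
be tested there. -/
lemma cubeFace_subset_iff {σ τ : Finset ℕ} (hσ : σ ∈ crossFaces n) (hτ : τ ∈ crossFaces n) :
    cubeFace n σ ⊆ cubeFace n τ ↔ τ ⊆ σ := by
  constructor
  · intro h a ha
    have h1 := (mem_crossFaces.1 hτ).1 a ha
    have h2 := (h (cubeCenter_mem hσ)).2 ⟨a / 2, by omega⟩
    rcases Nat.mod_two_eq_zero_or_one a with hm | hm
    · rw [show a = 2 * (a / 2) by omega] at ha ⊢
      by_contra hn
      have h3 := h2.2 ha
      simp only [cubeCenter, hn, if_false] at h3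
      split_ifs at h3 <;> norm_num at h3
    · rw [show a = 2 * (a / 2) + 1 by omega] at ha ⊢
      by_contra hn
      have h3 := h2.1 ha
      simp only [cubeCenter, hn, if_false] at h3
      split_ifs at h3 <;> norm_num at h3
  · exact fun h x hx => ⟨hx.1, fun i => ⟨fun hi => (hx.2 i).1 (h hi), fun hi => (hx.2 i).2 (h hi)⟩⟩

/-- The boundary complex of the polytope dual to the cube is that of the cross polytope. -/
noncomputable def cubeIso (n : ℕ) : DualBoundaryIso (stdCube n) (crossComplex n) :=
  OrderIso.symm <| RelIso.ofSurjective
    (OrderEmbedding.ofMapLEIff (fun σ : (Simplex (crossComplex n))ᵒᵈ =>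
      (⟨cubeFace n (OrderDual.ofDual σ).1, isFace_cubeFace
        ((mem_crossFaces_iff _).2 (OrderDual.ofDual σ).2)⟩ : Face (stdCube n)))
      fun σ τ => cubeFace_subset_iff ((mem_crossFaces_iff _).2 (OrderDual.ofDual σ).2)
        ((mem_crossFaces_iff _).2 (OrderDual.ofDual τ).2))
    fun F => by
      obtain ⟨σ, hσ, h⟩ := exists_eq_cubeFace F.2
      exact ⟨OrderDual.toDual ⟨σ, (mem_crossFaces_iff σ).1 hσ⟩, Subtype.ext h.symm⟩

end Cube

/-! ### Realizations of 2-truncated cubes -/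

lemma IsTwoTruncatedCube.isSimplePolytope {n : ℕ} {P : Set (EuclideanSpace ℝ (Fin n))}
    (h : IsTwoTruncatedCube P) : IsSimplePolytope P := by
  cases h <;> assumption

lemma IsTwoTruncatedCube.exists_isRealizable {n : ℕ} {P : Set (EuclideanSpace ℝ (Fin n))}
    (h : IsTwoTruncatedCube P) :
    ∃ K, Nonempty (DualBoundaryIso P K) ∧ IsRealizable n K := by
  induction h with
  | cube P _ hP =>
    obtain ⟨f⟩ := hP
    exact ⟨crossComplex n, ⟨f.trans (cubeIso n)⟩, isRealizable_crossComplex n⟩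
  | truncate P G P' hP hG _ hT ih =>
    obtain ⟨K₀, ⟨φ₀⟩, h₀⟩ := ih
    obtain ⟨K, φ, v, hv, ⟨φ'⟩⟩ := hT
    -- The complex from the induction and the one in the truncation are both dual to `P`.
    have hK : IsRealizable n K := h₀.of_orderIso (φ₀.symm.trans φ).dual
    have hcard := faceDim_faceOf_add_card φ hP.isSimplePolytope (simplexOf φ G)
    rw [faceOf_simplexOf] at hcard
    have h2 : #(simplexOf φ G).1 = 2 := by omega
    have hne : (simplexOf φ G).1 ≠ ∅ := fun h => by simp [h] at h2
    exact ⟨_, ⟨φ'⟩, hK.stellar ((simplexOf φ G).2.resolve_left hne) h2 hv⟩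

/-! ### γ-vectors -/

section GammaVector

variable {n : ℕ} {P : Set (EuclideanSpace ℝ (Fin n))}

lemma coeff_X_pow_mul_X_add_one_pow (i j m : ℕ) :
    ((Polynomial.X ^ i * (Polynomial.X + 1) ^ m : Polynomial ℤ)).coeff j =
      if i ≤ j then (m.choose (j - i) : ℤ) else 0 := by
  rw [Polynomial.coeff_X_pow_mul']
  split_ifs with h
  · rw [Polynomial.coeff_X_add_one_pow]
  · rfl

/-- Setting `α = X` and `t = 1`, the polynomials `X ^ i * (X + 1) ^ (n - 2 * i)` have distinct
lowest terms `X ^ i`, so the coefficients are determined successively. -/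
lemma IsGammaVector.unique {γ γ' : ℕ → ℤ} (h : IsGammaVector P γ) (h' : IsGammaVector P γ') :
    γ = γ' := by
  have key : ∑ i ∈ range (n / 2 + 1),
      Polynomial.C (γ i) * (Polynomial.X ^ i * (Polynomial.X + 1) ^ (n - 2 * i)) =
      ∑ i ∈ range (n / 2 + 1),
      Polynomial.C (γ' i) * (Polynomial.X ^ i * (Polynomial.X + 1) ^ (n - 2 * i)) := by
    have := congrArg (MvPolynomial.aeval ![(Polynomial.X : Polynomial ℤ), 1]) (h.1.symm.trans h'.1)
    simpa [map_sum, mul_assoc] using this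
  have hcoeff : ∀ j, ∑ i ∈ range (n / 2 + 1),
      γ i * (if i ≤ j then ((n - 2 * i).choose (j - i) : ℤ) else 0) = ∑ i ∈ range (n / 2 + 1),
      γ' i * (if i ≤ j then ((n - 2 * i).choose (j - i) : ℤ) else 0) := fun j => by
    simpa only [Polynomial.finsetSum_coeff, Polynomial.coeff_C_mul,
      coeff_X_pow_mul_X_add_one_pow] using congrArg (fun p => Polynomial.coeff p j) key
  funext j
  induction j using Nat.strong_induction_on with
  | _ j ih =>
    by_cases hj : n / 2 < j
    · rw [h.2 j hj, h'.2 j hj]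
    · have hmem : j ∈ range (n / 2 + 1) := Finset.mem_range.2 (by omega)
      have := hcoeff j
      rw [← Finset.add_sum_erase _ _ hmem, ← Finset.add_sum_erase _ _ hmem,
        Finset.sum_congr rfl (g := fun i =>
          γ' i * (if i ≤ j then ((n - 2 * i).choose (j - i) : ℤ) else 0))] at this
      · simpa using this
      · intro i hi
        by_cases hij : i ≤ j
        · rw [ih i (lt_of_le_of_ne hij (Finset.ne_of_mem_erase hi))]
        · simp [hij]

lemma IsGammaVector.gammaVector_eq {γ : ℕ → ℤ} (h : IsGammaVector P γ) : gammaVector P = γ := by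
  have hex : ∃ γ, IsGammaVector P γ := ⟨γ, h⟩
  rw [gammaVector, dif_pos hex]
  exact hex.choose_spec.unique h

end GammaVector

lemma cliqueSum_eq_sum_range {G : SimpleGraph ℕ} {T : Finset ℕ} {d : ℕ} {x : ℚ}
    (h : ∀ s ⊆ T, G.IsClique s → 2 * #s ≤ d) :
    cliqueSum G T d x = ∑ i ∈ range (d / 2 + 1),
      (#(cliquesIn G T i) : ℚ) * ((x + x ^ 2) ^ i * (1 + 2 * x) ^ (d - 2 * i)) := by
  have hmaps : ∀ s ∈ allCliques G T, #s ∈ range (d / 2 + 1) := fun s hs => by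
    have := h s (mem_allCliques.1 hs).1 (mem_allCliques.1 hs).2
    exact Finset.mem_range.2 (by omega)
  rw [cliqueSum, ← Finset.sum_fiberwise_of_maps_to hmaps]
  refine Finset.sum_congr rfl fun i _ => ?_
  have hset : (allCliques G T).filter (fun s => #s = i) = cliquesIn G T i := by
    ext s
    rw [Finset.mem_filter, mem_allCliques, mem_cliquesIn]
    tauto
  rw [Finset.sum_congr rfl (g := fun _ => (x + x ^ 2) ^ i * (1 + 2 * x) ^ (d - 2 * i))
    fun s hs => by rw [(Finset.mem_filter.1 hs).2], Finset.sum_const, hset, nsmul_eq_mul]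

/-! ### The γ-vector as a clique vector -/

namespace IsRealization

variable {n : ℕ} {K : PreAbstractSimplicialComplex ℕ} {D : Finset (Finset ℕ)}
  {G : SimpleGraph ℕ} {T : Finset ℕ} {S : ℕ → Finset ℕ} {P : Set (EuclideanSpace ℝ (Fin n))}

lemma supp_empty : supp T S ∅ = T := by
  ext t
  simp [mem_supp]

lemma two_mul_card_le (h : IsRealization n K D G T S) (s : Finset ℕ) (hs : s ⊆ T)
    (hc : G.IsClique s) : 2 * #s ≤ n := by
  simpa using h.clique_le ∅ h.empty_mem s (supp_empty.symm ▸ hs) hc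

lemma cliquesIn_eq_empty (h : IsRealization n K D G T S) {i : ℕ} (hi : n / 2 < i) :
    cliquesIn G T i = ∅ := by
  refine Finset.eq_empty_of_forall_notMem fun s hs => ?_
  obtain ⟨⟨h1, h2⟩, h3⟩ := mem_cliquesIn.1 hs
  have := h.two_mul_card_le s h1 h3
  omega

/-- This is the realization identity for the empty simplex at `x = z / y`, made homogeneous by `y ^
n`. -/
lemma sum_faceCount (h : IsRealization n K D G T S) (φ : DualBoundaryIso P K)
    (hP : IsSimplePolytope P) {y z : ℚ} (hy : y ≠ 0) (hz : z ≠ 0) :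
    ∑ i ∈ range (n + 1), (faceCount P i : ℚ) * y ^ i * z ^ (n - i) =
      ∑ i ∈ range (n / 2 + 1), (#(cliquesIn G T i) : ℚ) * ((y + z) * z) ^ i *
        (y + 2 * z) ^ (n - 2 * i) := by
  have h1 : ∑ i ∈ range (n + 1), (faceCount P i : ℚ) * y ^ i * z ^ (n - i) =
      ∑ τ ∈ D, y ^ (n - #τ) * z ^ #τ := by
    rw [← Finset.sum_fiberwise_of_maps_to (g := fun τ => n - #τ) (t := range (n + 1))
      fun τ _ => Finset.mem_range.2 (by omega)]
    refine Finset.sum_congr rfl fun i hi => ?_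
    have hi := Finset.mem_range.1 hi
    have hset : D.filter (fun τ => n - #τ = i) = D.filter fun τ => i + #τ = n := by
      refine Finset.filter_congr fun τ hτ => ?_
      have := h.card_le hτ
      omega
    rw [faceCount_eq φ hP h.mem_iff, hset, Finset.sum_congr rfl (g := fun _ => y ^ i * z ^ (n - i)),
      Finset.sum_const, nsmul_eq_mul, mul_assoc]
    intro τ hτ
    have := (Finset.mem_filter.1 hτ).2
    rw [show n - #τ = i by omega, show #τ = n - i by omega]
  have h2 : ∑ τ ∈ D, y ^ (n - #τ) * z ^ #τ = y ^ n * upSum D ∅ (z / y) := by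
    rw [upSum, Finset.mul_sum, Finset.filter_true_of_mem fun τ _ => Finset.empty_subset τ]
    refine Finset.sum_congr rfl fun τ hτ => ?_
    have hle := h.card_le hτ
    rw [div_pow, show y ^ n = y ^ (n - #τ) * y ^ #τ by rw [← pow_add, Nat.sub_add_cancel hle]]
    field_simp
  rw [h1, h2, h.sum_eq ∅ h.empty_mem _ (div_ne_zero hz hy), supp_empty, Finset.card_empty, pow_zero,
    one_mul, Nat.sub_zero, cliqueSum_eq_sum_range h.two_mul_card_le, Finset.mul_sum]
  refine Finset.sum_congr rfl fun i hi => ?_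
  have hi := Finset.mem_range.1 hi
  have e1 : y ^ n = (y ^ 2) ^ i * y ^ (n - 2 * i) := by
    rw [← pow_mul, ← pow_add]; congr 1; omega
  have e2 : (y + z) * z = y ^ 2 * (z / y + (z / y) ^ 2) := by field_simp
  have e3 : y + 2 * z = y * (1 + 2 * (z / y)) := by field_simp
  rw [e1, e2, e3, mul_pow, mul_pow]
  ring

open MvPolynomial in
-- Both polynomials agree at all integer points with nonzero coordinates, an infinite set in each
-- variable.
lemma fPoly_eq (h : IsRealization n K D G T S) (φ : DualBoundaryIso P K)
    (hP : IsSimplePolytope P) :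
    fPoly P = ∑ i ∈ range (n / 2 + 1), C (#(cliquesIn G T i) : ℤ) * ((X 0 + X 1) * X 1) ^ i *
      (X 0 + 2 * X 1) ^ (n - 2 * i) := by
  refine funext_set (fun _ => ({0}ᶜ : Set ℤ)) (fun _ => (Set.finite_singleton 0).infinite_compl)
    fun y hy => ?_
  have hy0 : (y 0 : ℚ) ≠ 0 := Int.cast_ne_zero.2 (hy 0 trivial)
  have hy1 : (y 1 : ℚ) ≠ 0 := Int.cast_ne_zero.2 (hy 1 trivial)
  have := h.sum_faceCount φ hP hy0 hy1
  simp only [fPoly, map_sum, map_mul, map_pow, map_add, eval_C, eval_X, map_ofNat]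
  exact_mod_cast this

open MvPolynomial in
lemma isGammaVector (h : IsRealization n K D G T S) (φ : DualBoundaryIso P K)
    (hP : IsSimplePolytope P) : IsGammaVector P fun i => (#(cliquesIn G T i) : ℤ) := by
  refine ⟨?_, fun i hi => by simp [h.cliquesIn_eq_empty hi]⟩
  rw [hPoly, h.fPoly_eq φ hP, map_sum]
  refine Finset.sum_congr rfl fun i _ => ?_
  simp only [map_mul, map_pow, map_add, aeval_X, map_ofNat, Matrix.cons_val_zero,
    Matrix.cons_val_one, algHom_C, algebraMap_eq, sub_add_cancel]
  congr 2
  ring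

end IsRealization

lemma card_cliquesIn_two_le_choose (G : SimpleGraph ℕ) (T : Finset ℕ) :
    #(cliquesIn G T 2) ≤ (#(cliquesIn G T 1)).choose 2 := by
  rw [cliquesIn_one, ← Finset.card_powersetCard]
  exact Finset.card_le_card fun s hs => Finset.mem_powersetCard.2 (mem_cliquesIn.1 hs).1

end TwoTruncated

theorem mainTheorem3 (n : ℕ) (P : Set (EuclideanSpace ℝ (Fin n)))
    (hP : TwoTruncated.IsTwoTruncatedCube P) :
    TwoTruncated.IsGammaVector P (TwoTruncated.gammaVector P) ∧
    (∀ i ≤ n / 2, 0 ≤ TwoTruncated.gammaVector P i) ∧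
    (∀ k, 1 ≤ k → k + 1 ≤ n / 2 →
      TwoTruncated.gammaVector P (k + 1) ≤
        (TwoTruncated.turanPower (TwoTruncated.gammaVector P k).toNat k (n / 2) : ℤ)) ∧
    (n = 4 ∨ n = 5 →
      0 ≤ TwoTruncated.gammaVector P 1 ∧ 0 ≤ TwoTruncated.gammaVector P 2 ∧
      (TwoTruncated.gammaVector P 2 : ℚ) ≤
        (TwoTruncated.gammaVector P 1 : ℚ) * ((TwoTruncated.gammaVector P 1 : ℚ) - 1) / 2) := by
  obtain ⟨K, ⟨φ⟩, D, G, T, S, h⟩ := hP.exists_isRealizable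
  have hγ := h.isGammaVector φ hP.isSimplePolytope
  rw [hγ.gammaVector_eq]
  refine ⟨hγ, fun i _ => Int.natCast_nonneg _, fun k hk hkr => ?_, fun _ =>
    ⟨Int.natCast_nonneg _, Int.natCast_nonneg _, ?_⟩⟩
  · rw [Int.toNat_natCast]
    refine Int.ofNat_le.2 ?_
    -- A clique has at most `n / 2` vertices, so the Turán parameter is `n / 2`.
    exact TwoTruncated.card_cliquesIn_succ_le_turanPower
      (h.cliquesIn_eq_empty (Nat.lt_succ_self _)) hk hkr
  -- Here `γ_1` counts the vertices and `γ_2` the edges of the graph.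
  · simp only [Int.cast_natCast]
    rw [← Nat.cast_choose_two]
    exact_mod_cast TwoTruncated.card_cliquesIn_two_le_choose G T
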